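/- Let $\mathcal S,\mathcal A$ be finite sets with $S\ge 1$ and $A\ge 1$ elements, $r:\mathcal S\times\mathcal A\to[0,1]$ a known reward function, $\nu$ a distribution on $\mathcal S$, and $(P_\theta)_{\theta\in\varTheta}$ a measurable family of transition laws $P_\theta(\cdot\mid s,a)$ on $\mathcal S$, with a prior distribution $\mu_0$ on $\varTheta$. Write $\mathcal M(\theta)$ for the MDP with transition law $P_\theta$, reward $r$ and initial distribution $\nu$. Assume that every $\mathcal M(\theta)$ is communicating: for all states $s,s'$ some stationary Markov policy reaches $s'$ from $s$ in some number of steps with positive probability. Fix $\hat s\in\mathcal S$. With $V^*_\gamma(s;\theta)$ the optimal $\gamma$-discounted value in $\mathcal M(\theta)$ started at $s$, put $$\bar r^*(\theta)=\lim_{\gamma\uparrow1}(1-\gamma)V^*_\gamma(\hat s;\theta),\qquad v(s;\theta)=\lim_{\gamma\uparrow1}\big[V^*_\gamma(s;\theta)-V^*_\gamma(\hat s;\theta)\big],\qquad q(s,a;\theta)=r(s,a)+\sum_{s'}P_\theta(s'\mid s,a)\,v(s';\theta).$$ Let $\bar v\ge0$ be such that $\max_s v(s;\theta)-\min_s v(s;\theta)\le\bar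 v$ for all $\theta\in\varTheta$. Let $\mathtt{MDPSolve}$ be a (measurable) map assigning to each $\theta$ a deterministic stationary policy that maximizes $q(s,\cdot;\theta)$ at every state $s$. The true parameter $\theta^*$ has law $\mu_0$. Given $\theta^*$, the offline data set $\mathcal D_0=(\bar s_0,\bar a_0,\dots,\bar a_{N-1},\bar s_N)$, $N\ge 0$, is a trajectory of $\mathcal M(\theta^*)$ from a fixed state $\bar s_0$ under the policy $\pi^\beta_{\theta^*}$, where $\pi^\beta_\theta(a\mid s)=e^{\beta q(s,a;\theta)}/\sum_{a'}e^{\beta q(s,a';\theta)}$ and $\beta>0$ is known. Given episode lengths $T_1,T_2,\dots\ge1$, the algorithm inf-iPSRL, denoted $\phi^{\mathrm{iPSRL}}$, works as follows. Let $t_k=\sum_{j<k}T_j$ for $k\ge1$, and let $\mu_1(d\theta)\propto\prod_{t<N}P_\theta(\bar s_{t+1}\mid\bar s_t,\bar a_t)\,\pi^\beta_\theta(\bar a_t\mid\bar s_t)\,\mu_0(d\theta)$. The initial state is $s_0\sim\nu$. In episode $k$, i.e. at the times $t_k\le t<t_{k+1}$, the algorithm samples $\tilde\theta^k\sim\mu_k$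 at time $t_k$, plays $a_t=\tilde\pi^k(s_t)$ with $\tilde\pi^k=\mathtt{MDPSolve}(\tilde\theta^k)$ throughout the episode, and then sets $\mu_{k+1}(d\theta)\propto\prod_{t=t_k}^{t_{k+1}-1}P_\theta(s_{t+1}\mid s_t,a_t)\,\mu_k(d\theta)$. Let $\varepsilon=\Pr(\tilde\pi^1\ne\mathtt{MDPSolve}(\theta^*))$, and let $\mathfrak{BR}_T(\phi^{\mathrm{iPSRL}})=\mathbb E_{\theta^*\sim\mu_0}\big[T\bar r^*(\theta^*)-\mathbb E[\sum_{t=0}^{T-1}r(s_t,a_t)\mid\theta^*]\big]$ be the Bayesian regret, where the inner expectation is over $\mathcal D_0$, the sampling of the algorithm and the online trajectory. Consider the episode schedule $T_k=k$. Then there are absolute constants $C$ and $p$ such that, in every such setting and for every $T\ge1$, with $L=(1+\log(SAT))^p$, $$\mathfrak{BR}_T(\phi^{\mathrm{iPSRL}})\le C\,\bar v\,SA\sqrt T\;L,$$ that is, $\mathfrak{BR}_T\le\tilde O(\bar vSA\sqrt T)$, and $$\mathfrak{BR}_T(\phi^{\mathrm{iPSRL}})\le 3\bar v+2\varepsilon\bar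 vT+\sqrt\varepsilon\,\bar v\cdot C\sqrt{S^2AT}\;L,$$ that is, $\mathfrak{BR}_T\le3\bar v+2\varepsilon\bar vT+\sqrt\varepsilon\,\bar v\,\tilde O(\sqrt{S^2AT})$. In particular, for fixed $\bar v,S,A,T$ the regret is $O(1)+O(\sqrt\varepsilon)$: $\mathfrak{BR}_T(\phi^{\mathrm{iPSRL}})\le3\bar v+B\sqrt\varepsilon$ with $B$ depending only on $(\bar v,S,A,T)$. -/

import Mathlib

open MeasureTheory Filter Topology
open scoped ENNReal

noncomputable section

namespace InfIPSRL

/-- Expectation of a real function of a discrete random variable with law `p`. -/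
def expect {α : Type*} (p : PMF α) (f : α → ℝ) : ℝ := ∑' x, (p x).toReal * f x

/-- A finite trajectory `s₀, a₀, s₁, a₁, …`, recorded as the chronological list of its transitions
`(s_t, a_t, s_{t+1})`. -/
abbrev History (S A : Type*) := List (S × A × S)

/-- The probability distribution on `A` proportional to `exp ∘ f`. -/
def softmax {A : Type*} [Fintype A] [Nonempty A] (f : A → ℝ) : PMF A :=
  PMF.ofFintype (fun a => ENNReal.ofReal (Real.exp (f a) / ∑ a', Real.exp (f a'))) <| by
    have hpos : 0 < ∑ a', Real.exp (f a') :=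
      Finset.sum_pos (fun a _ => Real.exp_pos _) Finset.univ_nonempty
    rw [← ENNReal.ofReal_sum_of_nonneg fun a _ => by positivity, ← Finset.sum_div,
      div_self hpos.ne', ENNReal.ofReal_one]

/-! ### Controlled Markov chains -/

section MDP

variable {S A : Type*}

/-- Law of `(history up to time t, s_t)` when the possibly history-dependent and randomized policy
`π` is applied to the controlled chain with transition law `P` and initial law `init`. -/
def trajLaw (P : S → A → PMF S) (π : History S A → S → PMF A) (init : PMF S) :
    ℕ → PMF (History S A × S)
  | 0 => init.map fun s => ([], s)
  | t + 1 => (trajLaw P π init t).bind fun x =>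
      (π x.1 x.2).bind fun a => (P x.2 a).map fun s' => (x.1 ++ [(x.2, a, s')], s')

/-- `E^π[r(s_t, a_t) | s₀ = s]`. -/
def stepReward (P : S → A → PMF S) (r : S → A → ℝ) (π : History S A → S → PMF A) (s : S) (t : ℕ) :
    ℝ :=
  expect ((trajLaw P π (PMF.pure s) t).bind fun x => (π x.1 x.2).map fun a => (x.2, a))
    fun y => r y.1 y.2

/-- `V_γ^*(s) = max_π E^π[∑_t γ^t r(s_t, a_t) | s₀ = s]`, over all policies. -/
def discountedValue (P : S → A → PMF S) (r : S → A → ℝ) (γ : ℝ) (s : S) : ℝ :=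
  ⨆ π : History S A → S → PMF A, ∑' t : ℕ, γ ^ t * stepReward P r π s t

/-- Any state can be reached from any state with positive probability, under some stationary
Markov policy. -/
def Communicating (P : S → A → PMF S) : Prop :=
  ∀ s s' : S, ∃ (π : S → PMF A) (k : ℕ),
    0 < ((trajLaw P (fun _ => π) (PMF.pure s) k).map Prod.snd) s'

end MDP

/-! ### The Bayesian environment -/

/-- A family of MDPs `M(θ)` with known reward function `r` and initial law `ν` and with transition
law `P θ`, a prior on the parameter, and the reference state used to normalize the relative values. -/
structure BayesianMDP (S A Θ : Type*) [MeasurableSpace Θ] where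
  P : Θ → S → A → PMF S
  measurable_P : ∀ s a s', Measurable fun θ => P θ s a s'
  r : S → A → ℝ
  r_mem : ∀ s a, r s a ∈ Set.Icc (0 : ℝ) 1
  ν : PMF S
  prior : ProbabilityMeasure Θ
  ref : S

/-- Parameters of the offline data set: a trajectory of `N` transitions started at the fixed state
`init`, produced by an expert with deliberateness `β > 0`. -/
structure Expert (S : Type*) where
  β : ℝ
  β_pos : 0 < β
  N : ℕ
  init : S

variable {S A Θ : Type*} [Fintype S] [Fintype A] [MeasurableSpace Θ]

namespace BayesianMDP

/-- Optimal average reward `r̄^*(θ) = lim_{γ → 1} (1 - γ) V_γ^*(ref; θ)`. -/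
def rbar (M : BayesianMDP S A Θ) (θ : Θ) : ℝ :=
  limUnder (𝓝[<] (1 : ℝ)) fun γ => (1 - γ) * discountedValue (M.P θ) M.r γ M.ref

/-- Relative value `v(s; θ) = lim_{γ → 1} (V_γ^*(s; θ) - V_γ^*(ref; θ))`. -/
def v (M : BayesianMDP S A Θ) (θ : Θ) (s : S) : ℝ :=
  limUnder (𝓝[<] (1 : ℝ)) fun γ =>
    discountedValue (M.P θ) M.r γ s - discountedValue (M.P θ) M.r γ M.ref

/-- Relative state-action value `q(s, a; θ)`. -/
def q (M : BayesianMDP S A Θ) (θ : Θ) (s : S) (a : A) : ℝ :=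
  M.r s a + ∑ s', (M.P θ s a s').toReal * M.v θ s'

/-- The expert's stationary policy `π^β` in the environment `θ`. -/
def expertPolicy [Nonempty A] (M : BayesianMDP S A Θ) (E : Expert S) (θ : Θ) (s : S) : PMF A :=
  softmax fun a => E.β * M.q θ s a

/-- Law of the offline data set in the environment `θ`. -/
def offlineLaw [Nonempty A] (M : BayesianMDP S A Θ) (E : Expert S) (θ : Θ) : PMF (History S A) :=
  (trajLaw (M.P θ) (fun _ => M.expertPolicy E θ) (PMF.pure E.init) E.N).map Prod.fst

/-- Likelihood of an offline data set, as a function of `θ`. -/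
def offlineLik [Nonempty A] (M : BayesianMDP S A Θ) (E : Expert S) (D : History S A) (θ : Θ) :
    ℝ≥0∞ :=
  (D.map fun x => M.P θ x.1 x.2.1 x.2.2 * M.expertPolicy E θ x.1 x.2.1).prod

/-- Transition likelihood of a stretch of online data, as a function of `θ`. -/
def onlineLik (M : BayesianMDP S A Θ) (h : History S A) (θ : Θ) : ℝ≥0∞ :=
  (h.map fun x => M.P θ x.1 x.2.1 x.2.2).prod

end BayesianMDP

/-- A planning oracle: a (measurable) map from parameters to deterministic stationary policies that
choose an action maximizing `q(s, ·; θ)` in every state `s`. -/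
structure Oracle (M : BayesianMDP S A Θ) where
  solve : Θ → S → A
  measurable_solve : ∀ π : S → A, MeasurableSet {θ | solve θ = π}
  optimal : ∀ θ s a, M.q θ s a ≤ M.q θ s (solve θ s)

open Classical in
/-- The probability measure proportional to `∫_{θ ∈ ·} L θ dμ(θ)`; when the normalizing constant
vanishes, which happens only for data of probability zero, `μ` is kept. -/
def bayesUpdate (μ : ProbabilityMeasure Θ) (L : Θ → ℝ≥0∞) : ProbabilityMeasure Θ :=
  if h : ∫⁻ θ, L θ ∂(μ : Measure Θ) ≠ 0 ∧ ∫⁻ θ, L θ ∂(μ : Measure Θ) ≠ ∞ then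
    ⟨(∫⁻ θ, L θ ∂(μ : Measure Θ))⁻¹ • (μ : Measure Θ).withDensity L, ⟨by
      rw [Measure.smul_apply, withDensity_apply _ MeasurableSet.univ, Measure.restrict_univ,
        smul_eq_mul, ENNReal.inv_mul_cancel h.1 h.2]⟩⟩
  else μ

/-- Starting time `t_k = ∑_{1 ≤ j < k} T_j` of episode `k ≥ 1`. -/
def epStart (Tep : ℕ → ℕ) (k : ℕ) : ℕ := ∑ j ∈ Finset.Ico 1 k, Tep j

/-- Index of the episode to which time `t` belongs, the largest `k` with `t_k ≤ t` (every episode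
has positive length, so `k ≤ t + 1`). -/
def epIndex (Tep : ℕ → ℕ) (t : ℕ) : ℕ := Nat.findGreatest (fun k => epStart Tep k ≤ t) (t + 1)

/-! ### The algorithm -/

section Algorithm

variable [Nonempty A]

/-- The sequence of beliefs, computed from the offline data `D` and the online history `h`:
the prior `μ₀`, the informed prior `μ₁`, and, for `k ≥ 1`, `μ_{k+1}` obtained from `μ_k` and the
transitions observed during episode `k`. -/
def belief (M : BayesianMDP S A Θ) (E : Expert S) (Tep : ℕ → ℕ) (D h : History S A) :
    ℕ → ProbabilityMeasure Θ
  | 0 => M.prior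
  | 1 => bayesUpdate M.prior (M.offlineLik E D)
  | k + 2 => bayesUpdate (belief M E Tep D h (k + 1))
      (M.onlineLik ((h.drop (epStart Tep (k + 1))).take (Tep (k + 1))))

open Classical in
/-- Law of the policy `solve θ̃` when `θ̃` is sampled from `μ`. -/
def samplePolicy {M : BayesianMDP S A Θ} (O : Oracle M) (μ : ProbabilityMeasure Θ) : PMF (S → A) :=
  PMF.ofFintype (fun π => (μ : Measure Θ) {θ | O.solve θ = π}) <| by
    have h : ⋃ π : S → A, {θ | O.solve θ = π} = Set.univ := by ext; simp
    rw [← tsum_fintype (L := .unconditional _), ← measure_iUnion _ O.measurable_solve, h,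
      measure_univ]
    intro π π' hne
    refine Set.disjoint_left.2 fun θ h1 h2 => hne ?_
    have h1' : O.solve θ = π := h1
    exact h1'.symm.trans h2

open Classical in
/-- Law, in the environment `θ` and given the offline data `D`, of
`(online history up to time t, s_t, policy in force at time t)` under the algorithm with episode
lengths `Tep`: a fresh policy is sampled exactly at the starting times of the episodes. -/
def onlineLaw (M : BayesianMDP S A Θ) (E : Expert S) (O : Oracle M) (Tep : ℕ → ℕ) (θ : Θ)
    (D : History S A) : ℕ → PMF (History S A × S × (S → A))
  | 0 => M.ν.bind fun s => (samplePolicy O (belief M E Tep D [] 1)).map fun π => ([], s, π)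
  | t + 1 => (onlineLaw M E O Tep θ D t).bind fun x =>
      (M.P θ x.2.1 (x.2.2 x.2.1)).bind fun s' =>
        let h' := x.1 ++ [(x.2.1, x.2.2 x.2.1, s')]
        if epStart Tep (epIndex Tep (t + 1)) = t + 1 then
          (samplePolicy O (belief M E Tep D h' (epIndex Tep (t + 1)))).map fun π' => (h', s', π')
        else PMF.pure (h', s', x.2.2)

/-- Regret over the times `0, …, T - 1` in the environment `θ`; the expectation is over the offline
data, the sampling of the algorithm and the online trajectory. -/
def regret (M : BayesianMDP S A Θ) (E : Expert S) (O : Oracle M) (Tep : ℕ → ℕ) (T : ℕ) (θ : Θ) :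
    ℝ :=
  T * M.rbar θ -
    expect ((M.offlineLaw E θ).bind fun D => onlineLaw M E O Tep θ D T)
      fun x => (x.1.map fun y => M.r y.1 y.2.1).sum

/-- Bayesian regret: the expectation of the regret over the prior. -/
def bayesRegret (M : BayesianMDP S A Θ) (E : Expert S) (O : Oracle M) (Tep : ℕ → ℕ) (T : ℕ) : ℝ :=
  ∫ θ, regret M E O Tep T θ ∂(M.prior : Measure Θ)

/-- Initial mismatch probability `ε = Pr(π̃¹ ≠ π^*)`, where `π^* = solve θ^*`, `θ^*` has the prior
law, the offline data are generated in the environment `θ^*`, and `π̃¹ = solve θ̃¹` with `θ̃¹`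
sampled from `μ₁`. -/
def mismatchProb (M : BayesianMDP S A Θ) (E : Expert S) (O : Oracle M) : ℝ :=
  (∫⁻ θ, ((M.offlineLaw E θ).bind fun D =>
      samplePolicy O (bayesUpdate M.prior (M.offlineLik E D))).toOuterMeasure
        {π | π ≠ O.solve θ} ∂(M.prior : Measure Θ)).toReal

end Algorithm

end InfIPSRL

end

set_option linter.unusedSectionVars false

noncomputable section

namespace InfIPSRL

/-! ### Expectations under finitely supported laws -/

section Expect

variable {α β : Type*}

/-! Both regret bounds treat "reward so far plus a relative value" as a process with drift. The
optimal policy of `θ'` satisfies `r + P_θ' v_θ' = r̄(θ') + v_θ'` along its actions, and it is run in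
the environment `θ`. At the start of an episode the true `θ` and the sample `θ'` are, given the
data, independent draws from the same posterior, so expectations are symmetric in the two
(`isPosterior_obsBelief`, `pairE_swap`).

Mismatch bound, with the relative value of the true parameter. Where the two policies agree, each
step gains `r̄(θ)`. Where they differ, it gains at least `r̄(θ') - 2 v̄`, and by exchange symmetry
`r̄(θ) - r̄(θ')` averages to zero on the mismatch event. Each step of episode `k` thus loses at most
`2 v̄ Pr(mismatch in episode k)`. This probability is at most `ε`: agreement has probability `∑_π
E[μ_k(π)²]`, and second moments of posterior probabilities grow with the data (`mismatchAt_le_one`).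
Since `v_θ` is the same function in all episodes, its boundary terms telescope to at most `2 v̄`.
The resulting bound `2 v̄ + 2 ε v̄ T` implies the last two claims, as the `√ε` term is nonnegative
and `ε ≤ √ε`.

Concentration bound, with the relative value of the sample. Now every one of the `O(√T)` episodes
costs a boundary term `v̄`, and every step costs at most `v̄ ‖P_θ' - P_θ‖₁`, while `r̄(θ')` and
`r̄(θ)` have the same mean. No confidence sets are used. Gaussian mixtures of exponential
martingales, summed over state-action pairs and sign patterns, form a supermartingale started at `S
A 2^S`; it controls the deviation of the data from `P_θ`, and by symmetry that from `P_θ'`. AM-GM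
with a free weight `η` splits the distance into `η` times a logarithmic width and `1/(η · visits)`.
The first sums to order `η T (S + log)`, the second to order `S A log T / η`, and `η = 1/√T`
balances the dependence on `T`.

The optimality equation requires the limits defining `r̄` and `v` to exist. Near `γ = 1` the
discounted value is a maximum of finitely many rational functions of `γ`, communication bounds its
span uniformly in `γ`, and a bounded rational function has a limit. -/

theorem expect_eq_sum {p : PMF α} {s : Finset α} (h : p.support ⊆ s) (f : α → ℝ) :
    expect p f = ∑ x ∈ s, (p x).toReal * f x := by
  refine tsum_eq_sum fun x hx => ?_
  have : p x = 0 := by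
    by_contra h0
    exact hx (h ((p.mem_support_iff x).2 h0))
  simp [this]

theorem expect_fintype [Fintype α] (p : PMF α) (f : α → ℝ) :
    expect p f = ∑ x, (p x).toReal * f x :=
  expect_eq_sum (by simp) f

theorem expect_pure (a : α) (f : α → ℝ) : expect (PMF.pure a) f = f a := by
  rw [expect_eq_sum (s := {a}) (by simp)]
  simp

theorem finite_support_pure (a : α) : (PMF.pure a).support.Finite := by simp

theorem finite_support_bind {p : PMF α} {f : α → PMF β} (hp : p.support.Finite)
    (hf : ∀ x, (f x).support.Finite) : (p.bind f).support.Finite := by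
  rw [PMF.support_bind]
  exact hp.biUnion fun x _ => hf x

theorem finite_support_map {p : PMF α} (f : α → β) (hp : p.support.Finite) :
    (p.map f).support.Finite := by
  rw [PMF.support_map]
  exact hp.image f

theorem expect_bind {p : PMF α} {f : α → PMF β} (hp : p.support.Finite)
    (hf : ∀ x, (f x).support.Finite) (g : β → ℝ) :
    expect (p.bind f) g = expect p fun x => expect (f x) g := by
  classical
  set s := hp.toFinset with hs
  set u := s.biUnion fun x => (hf x).toFinset with hu
  have h1 : (p.bind f).support ⊆ u := by
    intro y hy
    rw [PMF.mem_support_bind_iff] at hy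
    obtain ⟨x, hx, hy⟩ := hy
    simp only [hu, hs, Finset.coe_biUnion, Set.mem_iUnion]
    exact ⟨x, by simpa using hx, by simpa using hy⟩
  have h2 : p.support ⊆ s := by simp [hs]
  rw [expect_eq_sum h1, expect_eq_sum h2]
  have h3 : ∀ y, ((p.bind f) y).toReal = ∑ x ∈ s, (p x).toReal * (f x y).toReal := by
    intro y
    rw [PMF.bind_apply, tsum_eq_sum (s := s), ENNReal.toReal_sum]
    · simp
    · exact fun x _ => ENNReal.mul_ne_top (p.apply_ne_top x) ((f x).apply_ne_top y)
    · intro x hx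
      have : p x = 0 := by
        by_contra h0
        exact hx (h2 ((p.mem_support_iff x).2 h0))
      simp [this]
  have h4 : ∀ x ∈ s, expect (f x) g = ∑ y ∈ u, (f x y).toReal * g y := by
    intro x hx
    refine expect_eq_sum ?_ g
    intro y hy
    simp only [hu, Finset.coe_biUnion, Set.mem_iUnion]
    exact ⟨x, hx, by simpa using hy⟩
  have h5 : ∑ x ∈ s, (p x).toReal * expect (f x) g
      = ∑ x ∈ s, ∑ y ∈ u, (p x).toReal * ((f x y).toReal * g y) :=
    Finset.sum_congr rfl fun x hx => by rw [h4 x hx, Finset.mul_sum]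
  rw [h5, Finset.sum_comm]
  refine Finset.sum_congr rfl fun y _ => ?_
  rw [h3, Finset.sum_mul]
  exact Finset.sum_congr rfl fun x _ => by ring

theorem expect_map {p : PMF α} (hp : p.support.Finite) (f : α → β) (g : β → ℝ) :
    expect (p.map f) g = expect p fun x => g (f x) := by
  change expect (p.bind (PMF.pure ∘ f)) g = _
  rw [expect_bind (f := PMF.pure ∘ f) hp fun x => finite_support_pure _]
  simp [expect_pure]

theorem expect_mono {p : PMF α} (hp : p.support.Finite) {f g : α → ℝ}
    (h : ∀ x ∈ p.support, f x ≤ g x) : expect p f ≤ expect p g := by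
  have h2 : p.support ⊆ hp.toFinset := by simp
  rw [expect_eq_sum h2, expect_eq_sum h2]
  refine Finset.sum_le_sum fun x hx => ?_
  exact mul_le_mul_of_nonneg_left (h x (by simpa using hx)) ENNReal.toReal_nonneg

theorem expect_congr {p : PMF α} {f g : α → ℝ}
    (h : ∀ x ∈ p.support, f x = g x) : expect p f = expect p g := by
  refine tsum_congr fun x => ?_
  by_cases hx : x ∈ p.support
  · rw [h x hx]
  · rw [PMF.mem_support_iff, not_not] at hx
    simp [hx]

theorem expect_add {p : PMF α} (hp : p.support.Finite) (f g : α → ℝ) :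
    expect p (fun x => f x + g x) = expect p f + expect p g := by
  have h2 : p.support ⊆ hp.toFinset := by simp
  rw [expect_eq_sum h2, expect_eq_sum h2, expect_eq_sum h2, ← Finset.sum_add_distrib]
  exact Finset.sum_congr rfl fun x _ => by ring

theorem expect_const_mul (p : PMF α) (c : ℝ) (f : α → ℝ) :
    expect p (fun x => c * f x) = c * expect p f := by
  rw [expect, expect, ← tsum_mul_left]
  exact tsum_congr fun x => by ring

theorem expect_sub {p : PMF α} (hp : p.support.Finite) (f g : α → ℝ) :
    expect p (fun x => f x - g x) = expect p f - expect p g := by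
  have h2 : p.support ⊆ hp.toFinset := by simp
  rw [expect_eq_sum h2, expect_eq_sum h2, expect_eq_sum h2, ← Finset.sum_sub_distrib]
  exact Finset.sum_congr rfl fun x _ => by ring

theorem expect_const {p : PMF α} (hp : p.support.Finite) (c : ℝ) :
    expect p (fun _ => c) = c := by
  have h2 : p.support ⊆ hp.toFinset := by simp
  rw [expect_eq_sum h2, ← Finset.sum_mul]
  have : ∑ x ∈ hp.toFinset, (p x).toReal = 1 := by
    rw [← ENNReal.toReal_sum fun x _ => p.apply_ne_top x,
      (p.hasSum_coe_one.unique (hasSum_sum_of_ne_finset_zero (s := hp.toFinset) ?_)).symm,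
      ENNReal.toReal_one]
    intro x hx
    by_contra h0
    exact hx (by simpa using h0)
  rw [this, one_mul]

theorem expect_sum {ι : Type*} {p : PMF α} (hp : p.support.Finite) (s : Finset ι)
    (f : ι → α → ℝ) :
    expect p (fun x => ∑ i ∈ s, f i x) = ∑ i ∈ s, expect p (f i) := by
  have h2 : p.support ⊆ hp.toFinset := by simp
  simp_rw [expect_eq_sum h2, Finset.mul_sum]
  exact Finset.sum_comm

theorem expect_nonneg {p : PMF α} {f : α → ℝ} (h : ∀ x, 0 ≤ f x) : 0 ≤ expect p f :=
  tsum_nonneg fun x => mul_nonneg ENNReal.toReal_nonneg (h x)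

theorem expect_le {p : PMF α} (hp : p.support.Finite) {f : α → ℝ} {c : ℝ}
    (h : ∀ x ∈ p.support, f x ≤ c) : expect p f ≤ c :=
  (expect_mono hp h).trans_eq (expect_const hp c)

theorem le_expect {p : PMF α} (hp : p.support.Finite) {f : α → ℝ} {c : ℝ}
    (h : ∀ x ∈ p.support, c ≤ f x) : c ≤ expect p f :=
  (expect_const hp c).symm.trans_le (expect_mono hp h)

theorem abs_expect_le {p : PMF α} (hp : p.support.Finite) {f : α → ℝ} {c : ℝ}
    (h : ∀ x ∈ p.support, |f x| ≤ c) : |expect p f| ≤ c :=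
  abs_le.2 ⟨le_expect hp fun x hx => (abs_le.1 (h x hx)).1,
    expect_le hp fun x hx => (abs_le.1 (h x hx)).2⟩

theorem prob_mul_le_expect {p : PMF α} (hp : p.support.Finite) {f : α → ℝ} (hf : ∀ x, 0 ≤ f x)
    (a : α) : (p a).toReal * f a ≤ expect p f := by
  by_cases ha : a ∈ p.support
  · have h2 : p.support ⊆ hp.toFinset := by simp
    rw [expect_eq_sum h2]
    exact Finset.single_le_sum (f := fun x => (p x).toReal * f x)
      (fun x _ => mul_nonneg ENNReal.toReal_nonneg (hf x)) (by simpa using ha)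
  · rw [PMF.mem_support_iff, not_not] at ha
    rw [ha]
    simpa using expect_nonneg hf

end Expect

/-! ### The discounted optimality equation -/

section Discounted

variable {S A : Type*} [Fintype S] [Fintype A]

theorem finite_support_trajLaw (P : S → A → PMF S) (π : History S A → S → PMF A) (init : PMF S)
    (t : ℕ) : (trajLaw P π init t).support.Finite := by
  induction t with
  | zero => exact finite_support_map _ (Set.toFinite _)
  | succ t ih =>
    exact finite_support_bind ih fun x => finite_support_bind (Set.toFinite _) fun a =>
      finite_support_map _ (Set.toFinite _)

theorem expect_trajLaw_zero (P : S → A → PMF S) (π : History S A → S → PMF A) (s : S)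
    (V : S → ℝ) : expect (trajLaw P π (PMF.pure s) 0) (fun x => V x.2) = V s := by
  rw [trajLaw, expect_map (Set.toFinite _), expect_pure]

theorem expect_trajLaw_succ (P : S → A → PMF S) (π : History S A → S → PMF A) (init : PMF S)
    (t : ℕ) (V : S → ℝ) :
    expect (trajLaw P π init (t + 1)) (fun x => V x.2) =
      expect (trajLaw P π init t) fun x => expect (π x.1 x.2) fun a => expect (P x.2 a) V := by
  rw [trajLaw, expect_bind (finite_support_trajLaw ..) fun x =>
    finite_support_bind (Set.toFinite _) fun a => finite_support_map _ (Set.toFinite _)]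
  refine expect_congr fun x _ => ?_
  rw [expect_bind (Set.toFinite _) fun a => finite_support_map _ (Set.toFinite _)]
  exact expect_congr fun a _ => expect_map (Set.toFinite _) _ _

theorem stepReward_eq (P : S → A → PMF S) (r : S → A → ℝ) (π : History S A → S → PMF A) (s : S)
    (t : ℕ) : stepReward P r π s t =
      expect (trajLaw P π (PMF.pure s) t) fun x => expect (π x.1 x.2) fun a => r x.2 a := by
  rw [stepReward, expect_bind (finite_support_trajLaw ..) fun x =>
    finite_support_map _ (Set.toFinite _)]
  exact expect_congr fun x _ => expect_map (Set.toFinite _) _ _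

variable [Nonempty A]

/-- The Bellman optimality operator of the discounted problem. -/
def bellman (P : S → A → PMF S) (r : S → A → ℝ) (γ : ℝ) (V : S → ℝ) (s : S) : ℝ :=
  Finset.univ.sup' Finset.univ_nonempty fun a => r s a + γ * expect (P s a) V

theorem le_bellman (P : S → A → PMF S) (r : S → A → ℝ) (γ : ℝ) (V : S → ℝ) (s : S) (a : A) :
    r s a + γ * expect (P s a) V ≤ bellman P r γ V s :=
  Finset.le_sup' (fun a => r s a + γ * expect (P s a) V) (Finset.mem_univ a)

theorem exists_bellman_eq (P : S → A → PMF S) (r : S → A → ℝ) (γ : ℝ) (V : S → ℝ) :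
    ∃ π : S → A, ∀ s, bellman P r γ V s = r s (π s) + γ * expect (P s (π s)) V := by
  have : ∀ s, ∃ a, bellman P r γ V s = r s a + γ * expect (P s a) V := fun s => by
    obtain ⟨a, -, ha⟩ := Finset.exists_mem_eq_sup' Finset.univ_nonempty
      fun a => r s a + γ * expect (P s a) V
    exact ⟨a, ha⟩
  exact Classical.axiom_of_choice this

theorem bellman_sub_le (P : S → A → PMF S) (r : S → A → ℝ) {γ : ℝ} (hγ : 0 ≤ γ)
    (V W : S → ℝ) (s : S) : bellman P r γ V s - bellman P r γ W s ≤ γ * dist V W := by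
  obtain ⟨π, hπ⟩ := exists_bellman_eq P r γ V
  have h1 := le_bellman P r γ W s (π s)
  have h2 : expect (P s (π s)) V - expect (P s (π s)) W ≤ dist V W := by
    rw [← expect_sub (Set.toFinite _)]
    refine expect_le (Set.toFinite _) fun x _ => ?_
    exact (le_abs_self _).trans ((Real.dist_eq _ _).symm.trans_le (dist_le_pi_dist V W x))
  rw [hπ]
  nlinarith [mul_le_mul_of_nonneg_left h2 hγ]

theorem bellman_contracting (P : S → A → PMF S) (r : S → A → ℝ) {γ : ℝ} (h0 : 0 ≤ γ)
    (h1 : γ < 1) : ContractingWith ⟨γ, h0⟩ (bellman P r γ) := by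
  refine ⟨by exact_mod_cast h1, LipschitzWith.of_dist_le_mul fun V W => ?_⟩
  refine (dist_pi_le_iff (by positivity)).2 fun s => ?_
  rw [Real.dist_eq, abs_le]
  have h3 := bellman_sub_le P r h0 V W s
  have h4 := bellman_sub_le P r h0 W V s
  rw [dist_comm W V] at h4
  change -(γ * dist V W) ≤ _ ∧ _ ≤ γ * dist V W
  exact ⟨by linarith, h3⟩

/-- The hypothesis holds at every action, so it survives averaging over any randomized,
history-dependent choice of action. -/
theorem bellman_step {P : S → A → PMF S} {r : S → A → ℝ} {γ : ℝ} {V : S → ℝ}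
    (hV : ∀ s a, r s a + γ * expect (P s a) V ≤ V s) (π : History S A → S → PMF A) (s : S)
    (t : ℕ) :
    stepReward P r π s t + γ * expect (trajLaw P π (PMF.pure s) (t + 1)) (fun x => V x.2) ≤
      expect (trajLaw P π (PMF.pure s) t) fun x => V x.2 := by
  rw [stepReward_eq, expect_trajLaw_succ, ← expect_const_mul,
    ← expect_add (finite_support_trajLaw ..)]
  refine expect_mono (finite_support_trajLaw ..) fun x _ => ?_
  rw [← expect_const_mul, ← expect_add (Set.toFinite _)]
  exact expect_le (Set.toFinite _) fun a _ => hV x.2 a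

theorem bellman_step_eq {P : S → A → PMF S} {r : S → A → ℝ} {γ : ℝ} {V : S → ℝ} {δ : S → A}
    (hV : ∀ s, V s = r s (δ s) + γ * expect (P s (δ s)) V) (s : S) (t : ℕ) :
    stepReward P r (fun _ s => PMF.pure (δ s)) s t +
        γ * expect (trajLaw P (fun _ s => PMF.pure (δ s)) (PMF.pure s) (t + 1)) (fun x => V x.2) =
      expect (trajLaw P (fun _ s => PMF.pure (δ s)) (PMF.pure s) t) fun x => V x.2 := by
  rw [stepReward_eq, expect_trajLaw_succ, ← expect_const_mul,
    ← expect_add (finite_support_trajLaw ..)]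
  refine expect_congr fun x _ => ?_
  rw [expect_pure, expect_pure, ← hV]

theorem stepReward_mem {P : S → A → PMF S} {r : S → A → ℝ} (hr : ∀ s a, r s a ∈ Set.Icc (0 : ℝ) 1)
    (π : History S A → S → PMF A) (s : S) (t : ℕ) :
    stepReward P r π s t ∈ Set.Icc (0 : ℝ) 1 := by
  rw [stepReward_eq]
  exact ⟨expect_nonneg fun x => expect_nonneg fun a => (hr _ _).1,
    expect_le (finite_support_trajLaw ..) fun x _ => expect_le (Set.toFinite _) fun a _ =>
      (hr _ _).2⟩

theorem summable_stepReward {P : S → A → PMF S} {r : S → A → ℝ}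
    (hr : ∀ s a, r s a ∈ Set.Icc (0 : ℝ) 1) {γ : ℝ} (h0 : 0 ≤ γ) (h1 : γ < 1)
    (π : History S A → S → PMF A) (s : S) : Summable fun t => γ ^ t * stepReward P r π s t := by
  refine Summable.of_nonneg_of_le (fun t => mul_nonneg (by positivity) (stepReward_mem hr π s t).1)
    (fun t => ?_) (summable_geometric_of_lt_one h0 h1)
  exact mul_le_of_le_one_right (by positivity) (stepReward_mem hr π s t).2

theorem tendsto_pow_mul_expect (P : S → A → PMF S) {γ : ℝ} (h0 : 0 ≤ γ) (h1 : γ < 1)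
    (π : History S A → S → PMF A) (s : S) (V : S → ℝ) :
    Tendsto (fun n => γ ^ n * expect (trajLaw P π (PMF.pure s) n) fun x => V x.2) atTop (𝓝 0) := by
  have h := tendsto_pow_atTop_nhds_zero_of_lt_one h0 h1
  have h2 : Tendsto (fun n : ℕ => γ ^ n * ‖V‖) atTop (𝓝 0) := by simpa using h.mul_const ‖V‖
  refine squeeze_zero_norm (fun n => ?_) h2
  rw [norm_mul, norm_pow, Real.norm_of_nonneg h0]
  refine mul_le_mul_of_nonneg_left ?_ (by positivity)
  exact abs_expect_le (finite_support_trajLaw ..) fun x _ => norm_le_pi_norm V x.2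

/-- Verification argument: telescoping `bellman_step` bounds every policy by `V`, and the greedy
stationary policy turns the inequalities into equalities. The remainder `γ ^ n E[V(s_n)]` vanishes
in both cases. -/
theorem discountedValue_eq_of_bellman {P : S → A → PMF S} {r : S → A → ℝ}
    (hr : ∀ s a, r s a ∈ Set.Icc (0 : ℝ) 1) {γ : ℝ} (h0 : 0 ≤ γ) (h1 : γ < 1) {V : S → ℝ}
    (hV : bellman P r γ V = V) : discountedValue P r γ = V := by
  have hub : ∀ (π : History S A → S → PMF A) (s : S),
      ∑' t : ℕ, γ ^ t * stepReward P r π s t ≤ V s := by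
    intro π s
    have hs := (summable_stepReward (P := P) hr h0 h1 π s).hasSum.tendsto_sum_nat
    have hle : ∀ n, ∑ t ∈ Finset.range n, γ ^ t * stepReward P r π s t ≤
        V s - γ ^ n * expect (trajLaw P π (PMF.pure s) n) fun x => V x.2 := by
      intro n
      induction n with
      | zero => simp [expect_trajLaw_zero]
      | succ n ih =>
        have hst := bellman_step (P := P) (r := r) (γ := γ) (V := V)
          (fun s a => (le_bellman P r γ V s a).trans_eq (congrFun hV s)) π s n
        have := mul_le_mul_of_nonneg_left hst (pow_nonneg h0 n)
        rw [Finset.sum_range_succ, pow_succ]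
        nlinarith
    have hlim := (tendsto_pow_mul_expect P h0 h1 π s V).const_sub (V s)
    rw [sub_zero] at hlim
    exact le_of_tendsto_of_tendsto' hs hlim hle
  funext s
  refine le_antisymm (ciSup_le fun π => hub π s) ?_
  obtain ⟨δ, hδ⟩ := exists_bellman_eq P r γ V
  rw [hV] at hδ
  have hbdd : BddAbove (Set.range fun π : History S A → S → PMF A =>
      ∑' t : ℕ, γ ^ t * stepReward P r π s t) := by
    refine ⟨V s, ?_⟩
    rintro _ ⟨π, rfl⟩
    exact hub π s
  refine le_trans (le_of_eq ?_) (le_ciSup hbdd fun _ s => PMF.pure (δ s))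
  have hs := (summable_stepReward (P := P) hr h0 h1 (fun _ s => PMF.pure (δ s)) s).hasSum
    |>.tendsto_sum_nat
  have hle : ∀ n, ∑ t ∈ Finset.range n, γ ^ t * stepReward P r (fun _ s => PMF.pure (δ s)) s t =
      V s - γ ^ n * expect (trajLaw P (fun _ s => PMF.pure (δ s)) (PMF.pure s) n)
        fun x => V x.2 := by
    intro n
    induction n with
    | zero => simp [expect_trajLaw_zero]
    | succ n ih =>
      have hst := bellman_step_eq (P := P) (r := r) (γ := γ) (V := V) hδ s n
      rw [Finset.sum_range_succ, pow_succ, ih, ← hst]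
      ring
  have hlim := (tendsto_pow_mul_expect P h0 h1 (fun _ s => PMF.pure (δ s)) s V).const_sub (V s)
  rw [sub_zero] at hlim
  exact tendsto_nhds_unique hlim (hs.congr hle)

theorem bellman_discountedValue {P : S → A → PMF S} {r : S → A → ℝ}
    (hr : ∀ s a, r s a ∈ Set.Icc (0 : ℝ) 1) {γ : ℝ} (h0 : 0 ≤ γ) (h1 : γ < 1) :
    bellman P r γ (discountedValue P r γ) = discountedValue P r γ := by
  have h := (bellman_contracting P r h0 h1).fixedPoint_isFixedPt
  rw [discountedValue_eq_of_bellman hr h0 h1 h]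
  exact h

theorem tendsto_iterate_bellman {P : S → A → PMF S} {r : S → A → ℝ}
    (hr : ∀ s a, r s a ∈ Set.Icc (0 : ℝ) 1) {γ : ℝ} (h0 : 0 ≤ γ) (h1 : γ < 1) :
    Tendsto (fun n => (bellman P r γ)^[n] 0) atTop (𝓝 (discountedValue P r γ)) := by
  have h := (bellman_contracting P r h0 h1).tendsto_iterate_fixedPoint 0
  rwa [← discountedValue_eq_of_bellman hr h0 h1
    (bellman_contracting P r h0 h1).fixedPoint_isFixedPt] at h

theorem discountedValue_nonneg {P : S → A → PMF S} {r : S → A → ℝ}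
    (hr : ∀ s a, r s a ∈ Set.Icc (0 : ℝ) 1) {γ : ℝ} (h0 : 0 ≤ γ) (s : S) :
    0 ≤ discountedValue P r γ s :=
  Real.iSup_nonneg fun π => tsum_nonneg fun t =>
    mul_nonneg (by positivity) (stepReward_mem hr π s t).1

theorem one_sub_mul_discountedValue_le {P : S → A → PMF S} {r : S → A → ℝ}
    (hr : ∀ s a, r s a ∈ Set.Icc (0 : ℝ) 1) {γ : ℝ} (h0 : 0 ≤ γ) (h1 : γ < 1) (s : S) :
    (1 - γ) * discountedValue P r γ s ≤ 1 := by
  have h : discountedValue P r γ s ≤ (1 - γ)⁻¹ := by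
    refine ciSup_le fun π => ?_
    rw [← tsum_geometric_of_lt_one h0 h1]
    refine (summable_stepReward hr h0 h1 π s).tsum_le_tsum (fun t => ?_)
      (summable_geometric_of_lt_one h0 h1)
    exact mul_le_of_le_one_right (by positivity) (stepReward_mem hr π s t).2
  have h2 : 0 < 1 - γ := by linarith
  calc (1 - γ) * discountedValue P r γ s ≤ (1 - γ) * (1 - γ)⁻¹ := by gcongr
    _ = 1 := mul_inv_cancel₀ h2.ne'

/-- The nonnegative rewards of the first `k` steps are dropped. -/
theorem pow_mul_expect_le_discountedValue {P : S → A → PMF S} {r : S → A → ℝ}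
    (hr : ∀ s a, r s a ∈ Set.Icc (0 : ℝ) 1) {γ : ℝ} (h0 : 0 ≤ γ) (h1 : γ < 1)
    (π : History S A → S → PMF A) (s : S) (k : ℕ) :
    γ ^ k * expect (trajLaw P π (PMF.pure s) k) (fun x => discountedValue P r γ x.2) ≤
      discountedValue P r γ s := by
  induction k with
  | zero => rw [expect_trajLaw_zero, pow_zero, one_mul]
  | succ k ih =>
    have hst := bellman_step (P := P) (r := r) (γ := γ) (V := discountedValue P r γ)
      (fun s a => (le_bellman P r γ _ s a).trans_eq (congrFun (bellman_discountedValue hr h0 h1) s))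
      π s k
    have h2 := mul_le_mul_of_nonneg_left hst (pow_nonneg h0 k)
    have h3 := mul_nonneg (pow_nonneg h0 k) (stepReward_mem (P := P) hr π s k).1
    rw [pow_succ]
    nlinarith

/-- In a communicating MDP the discounted values have a span that is bounded uniformly in the
discount factor. -/
theorem exists_span_discountedValue_le {P : S → A → PMF S} {r : S → A → ℝ}
    (hr : ∀ s a, r s a ∈ Set.Icc (0 : ℝ) 1) (hP : Communicating P) :
    ∃ C : ℝ, ∀ γ : ℝ, 0 ≤ γ → γ < 1 → ∀ s s', discountedValue P r γ s - discountedValue P r γ s' ≤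
      C := by
  choose π k hk using hP
  set p : S → S → ℝ := fun s s' =>
    (((trajLaw P (fun _ => π s s') (PMF.pure s) (k s s')).map Prod.snd) s').toReal with hp
  have hp0 : ∀ s s', 0 < p s s' := fun s s' =>
    ENNReal.toReal_pos (hk s s').ne' (PMF.apply_ne_top _ _)
  -- Each pair contributes its horizon divided by its reaching probability; the sum dominates the
  -- one term that is needed.
  refine ⟨∑ s, ∑ s', k s s' / p s s', fun γ h0 h1 s s'' => ?_⟩
  have : Nonempty S := ⟨s⟩
  set V := discountedValue P r γ with hV
  -- From a state `m` of least value, the policy aiming at `s` hits `s` with probability `p m s`,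
  -- and all other end states are worth at least `V m`. Hence `p (V s - V m)` is at most the
  -- expected final value minus `V m`.
  obtain ⟨m, hm⟩ := Finite.exists_min V
  have hsum : (k m s : ℝ) / p m s ≤ ∑ s, ∑ s', k s s' / p s s' := by
    have hnn : ∀ s s', 0 ≤ (k s s' : ℝ) / p s s' := fun s s' =>
      div_nonneg (by positivity) (hp0 s s').le
    refine le_trans ?_ (Finset.single_le_sum (f := fun m => ∑ s', (k m s' : ℝ) / p m s')
      (fun i _ => Finset.sum_nonneg fun j _ => hnn i j) (Finset.mem_univ m))
    exact Finset.single_le_sum (f := fun s' => (k m s' : ℝ) / p m s') (fun j _ => hnn m j)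
      (Finset.mem_univ s)
  refine le_trans ?_ hsum
  have h2 : V s - V s'' ≤ V s - V m := by linarith [hm s'']
  refine h2.trans ?_
  rw [le_div_iff₀ (hp0 m s)]
  have hfin : (trajLaw P (fun _ => π m s) (PMF.pure m) (k m s)).support.Finite :=
    finite_support_trajLaw ..
  have hmain := pow_mul_expect_le_discountedValue (P := P) hr h0 h1 (fun _ => π m s) m (k m s)
  have hexp : p m s * (V s - V m) ≤
      expect (trajLaw P (fun _ => π m s) (PMF.pure m) (k m s)) (fun x => V x.2) - V m := by
    have := prob_mul_le_expect (finite_support_map Prod.snd hfin) (f := fun x => V x - V m)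
      (fun x => by linarith [hm x]) s
    rw [expect_map hfin, expect_sub hfin, expect_const hfin] at this
    exact this
  set e := expect (trajLaw P (fun _ => π m s) (PMF.pure m) (k m s)) (fun x => V x.2) with he
  -- Removing the discount `γ ^ k` costs at most `k (1 - γ) e ≤ k`, uniformly in `γ`.
  have hbern : 1 - (k m s : ℝ) * (1 - γ) ≤ γ ^ k m s := by
    have := one_add_mul_le_pow (a := γ - 1) (by linarith) (k m s)
    rw [add_sub_cancel] at this
    linarith
  have he0 : 0 ≤ e := expect_nonneg fun x => discountedValue_nonneg hr h0 _
  have he1 : (1 - γ) * e ≤ 1 := by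
    rw [he, ← expect_const_mul]
    exact expect_le hfin fun x _ => one_sub_mul_discountedValue_le hr h0 h1 _
  have hkk : (0 : ℝ) ≤ k m s := by positivity
  nlinarith [mul_le_mul_of_nonneg_right hbern he0, mul_le_mul_of_nonneg_left he1 hkk]

end Discounted

/-! ### Functions that are rational near `1` -/

section Rational

open Polynomial

/-- `f` agrees with a rational function on a left neighbourhood of `1`. -/
def RationalNearOne (f : ℝ → ℝ) : Prop :=
  ∃ N D : ℝ[X], D ≠ 0 ∧ ∀ᶠ x in 𝓝[<] (1 : ℝ), D.eval x * f x = N.eval x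

theorem eventually_eval_ne_zero {D : ℝ[X]} (hD : D ≠ 0) :
    ∀ᶠ x in 𝓝[<] (1 : ℝ), D.eval x ≠ 0 := by
  have h1 : ∀ᶠ x in 𝓝[≠] (1 : ℝ), x ∉ (D.roots.toFinset : Set ℝ) := by
    have := (D.roots.toFinset.finite_toSet.subset
      (Set.sdiff_subset (t := {(1 : ℝ)}))).isClosed.isOpen_compl.mem_nhds (x := (1 : ℝ)) (by simp)
    filter_upwards [nhdsWithin_le_nhds this, self_mem_nhdsWithin] with x hx hx1 hx2
    exact hx ⟨hx2, hx1⟩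
  filter_upwards [nhdsWithin_mono _ (fun x (hx : x < 1) => hx.ne) h1] with x hx h0
  exact hx (by simpa using ⟨hD, h0⟩)

/-- Near `1`, a nonzero polynomial is a power of `1 - x` times a function with a nonzero limit. -/
theorem exists_eval_eq_pow_mul {p : ℝ[X]} (hp : p ≠ 0) :
    ∃ (n : ℕ) (q : ℝ[X]), q.eval 1 ≠ 0 ∧ ∀ x, p.eval x = (1 - x) ^ n * q.eval x := by
  obtain ⟨q, hq, hdvd⟩ := exists_eq_pow_rootMultiplicity_mul_and_not_dvd p hp 1
  -- The extracted factor is a power of `x - 1`; the constant turns it into a power of `1 - x`,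
  -- which is positive to the left of `1`.
  refine ⟨p.rootMultiplicity 1, C ((-1) ^ p.rootMultiplicity 1) * q, ?_, fun x => ?_⟩
  · rw [eval_mul, eval_C]
    refine mul_ne_zero (by simp) fun h => hdvd (dvd_iff_isRoot.2 h)
  · conv_lhs => rw [hq]
    rw [eval_mul, eval_pow, eval_mul, eval_C, ← mul_assoc, ← mul_pow]
    simp

theorem eventually_sign_eval (p : ℝ[X]) :
    (∀ᶠ x in 𝓝[<] (1 : ℝ), 0 ≤ p.eval x) ∨ ∀ᶠ x in 𝓝[<] (1 : ℝ), p.eval x ≤ 0 := by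
  rcases eq_or_ne p 0 with rfl | hp
  · simp
  obtain ⟨n, q, hq, h⟩ := exists_eval_eq_pow_mul hp
  have hc : Tendsto (fun x => q.eval x) (𝓝[<] (1 : ℝ)) (𝓝 (q.eval 1)) :=
    q.continuous.continuousAt.tendsto.mono_left nhdsWithin_le_nhds
  have hlt : ∀ᶠ x in 𝓝[<] (1 : ℝ), x < 1 := self_mem_nhdsWithin
  rcases lt_or_gt_of_ne hq with h0 | h0
  · right
    filter_upwards [hc.eventually (gt_mem_nhds h0), hlt] with x hx h1
    rw [h]
    exact mul_nonpos_of_nonneg_of_nonpos (pow_nonneg (by linarith) n) hx.le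
  · left
    filter_upwards [hc.eventually (lt_mem_nhds h0), hlt] with x hx h1
    rw [h]
    exact mul_nonneg (pow_nonneg (by linarith) n) hx.le

theorem RationalNearOne.congr {f g : ℝ → ℝ} (hf : RationalNearOne f)
    (h : ∀ᶠ x in 𝓝[<] (1 : ℝ), f x = g x) : RationalNearOne g := by
  obtain ⟨N, D, hD, hN⟩ := hf
  refine ⟨N, D, hD, ?_⟩
  filter_upwards [h, hN] with x h1 h2
  rw [← h1, h2]

theorem RationalNearOne.sub {f g : ℝ → ℝ} (hf : RationalNearOne f) (hg : RationalNearOne g) :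
    RationalNearOne fun x => f x - g x := by
  obtain ⟨N, D, hD, h⟩ := hf
  obtain ⟨N', D', hD', h'⟩ := hg
  refine ⟨N * D' - N' * D, D * D', mul_ne_zero hD hD', ?_⟩
  filter_upwards [h, h'] with x h1 h2
  simp only [eval_mul, eval_sub, ← h1, ← h2]
  ring

theorem RationalNearOne.eval_mul {f : ℝ → ℝ} (hf : RationalNearOne f) (p : ℝ[X]) :
    RationalNearOne fun x => p.eval x * f x := by
  obtain ⟨N, D, hD, h⟩ := hf
  refine ⟨p * N, D, hD, ?_⟩
  filter_upwards [h] with x h1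
  simp only [Polynomial.eval_mul, ← h1]
  ring

/-- The sign of `f - g = N / D` is that of `N * D`, which settles near `1`. Since any two rational
functions are thus comparable there, a finite maximum coincides with one of its members. -/
theorem RationalNearOne.eventually_le_total {f g : ℝ → ℝ} (hf : RationalNearOne f)
    (hg : RationalNearOne g) :
    (∀ᶠ x in 𝓝[<] (1 : ℝ), f x ≤ g x) ∨ ∀ᶠ x in 𝓝[<] (1 : ℝ), g x ≤ f x := by
  obtain ⟨N, D, hD, h⟩ := hf.sub hg
  have hD0 := eventually_eval_ne_zero hD
  refine (eventually_sign_eval (N * D)).symm.imp (fun h0 => ?_) fun h0 => ?_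
  all_goals
    filter_upwards [hD0, h0, h] with x h1 h2 h3
    rw [Polynomial.eval_mul, ← h3] at h2
    have h4 : 0 < D.eval x ^ 2 := by positivity
    nlinarith

theorem RationalNearOne.sup' {ι : Type*} {s : Finset ι} (hs : s.Nonempty) {f : ι → ℝ → ℝ}
    (hf : ∀ i ∈ s, RationalNearOne (f i)) : RationalNearOne fun x => s.sup' hs fun i => f i x := by
  classical
  induction hs using Finset.Nonempty.cons_induction with
  | singleton a => simpa using hf a
  | cons a s ha hs ih =>
    have ih := ih fun i hi => hf i (Finset.mem_cons_of_mem hi)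
    have ha := hf a (Finset.mem_cons_self a s)
    rcases ha.eventually_le_total ih with h | h
    · refine ih.congr ?_
      filter_upwards [h] with x hx
      rw [Finset.sup'_cons hs]
      exact (sup_eq_right.2 hx).symm
    · refine ha.congr ?_
      filter_upwards [h] with x hx
      rw [Finset.sup'_cons hs]
      exact (sup_eq_left.2 hx).symm

/-- A function that is rational and bounded near `1` has a limit there. -/
theorem RationalNearOne.exists_tendsto {f : ℝ → ℝ} (hf : RationalNearOne f) {C : ℝ}
    (hC : ∀ᶠ x in 𝓝[<] (1 : ℝ), |f x| ≤ C) : ∃ l, Tendsto f (𝓝[<] (1 : ℝ)) (𝓝 l) := by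
  obtain ⟨N, D, hD, h⟩ := hf
  have hD0 := eventually_eval_ne_zero hD
  have hlt : ∀ᶠ x in 𝓝[<] (1 : ℝ), x < 1 := self_mem_nhdsWithin
  have hcont : ∀ q : ℝ[X], Tendsto (fun x => q.eval x) (𝓝[<] (1 : ℝ)) (𝓝 (q.eval 1)) := fun q =>
    q.continuous.continuousAt.tendsto.mono_left nhdsWithin_le_nhds
  rcases eq_or_ne N 0 with rfl | hN
  · refine ⟨0, tendsto_const_nhds.congr' ?_⟩
    filter_upwards [hD0, h] with x h1 h2
    simpa [h1, eq_comm] using h2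
  obtain ⟨n, q, hq, hNq⟩ := exists_eval_eq_pow_mul hN
  obtain ⟨d, e, he, hDe⟩ := exists_eval_eq_pow_mul hD
  rcases le_or_gt d n with hle | hgt
  · refine ⟨((1 - X) ^ (n - d) * q).eval 1 / e.eval 1,
      ((hcont ((1 - X) ^ (n - d) * q)).div (hcont e) he).congr' ?_⟩
    filter_upwards [hD0, h, hlt] with x h1 h2 h3
    rw [hDe] at h1
    rw [Pi.div_apply, div_eq_iff (right_ne_zero_of_mul h1)]
    refine mul_left_cancel₀ (left_ne_zero_of_mul h1) ?_
    rw [hNq, hDe] at h2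
    simp only [Polynomial.eval_mul, eval_pow, eval_sub, eval_one, eval_X]
    rw [← mul_assoc, ← pow_add, Nat.add_sub_cancel' hle, ← h2]
    ring
  -- A pole is impossible: multiplying the bounded `f` by `(1 - x) ^ (d - n) * e` gives a limit `0`,
  -- whereas the product equals `q`, which does not vanish at `1`.
  · exfalso
    have h1 : Tendsto (fun x => ((1 - X) ^ (d - n) * e).eval x) (𝓝[<] (1 : ℝ)) (𝓝 0) := by
      have := hcont ((1 - X) ^ (d - n) * e)
      rwa [Polynomial.eval_mul, eval_pow, eval_sub, eval_one, eval_X, sub_self,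
        zero_pow (by omega), zero_mul] at this
    have h2 : Tendsto (fun x => ((1 - X) ^ (d - n) * e).eval x * f x) (𝓝[<] (1 : ℝ)) (𝓝 0) :=
      h1.zero_mul_isBoundedUnder_le ⟨C, by simpa using hC⟩
    refine hq (tendsto_nhds_unique (hcont q) (h2.congr' ?_))
    filter_upwards [h, hlt] with x h3 h4
    rw [hNq, hDe] at h3
    refine mul_left_cancel₀ (pow_ne_zero n (sub_pos.2 h4).ne') ?_
    simp only [Polynomial.eval_mul, eval_pow, eval_sub, eval_one, eval_X]
    rw [← h3, ← mul_assoc, ← mul_assoc, ← pow_add, Nat.add_sub_cancel' hgt.le]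

end Rational

/-! ### The vanishing discount limit -/

section VanishingDiscount

variable {S A : Type*} [Fintype S] [Fintype A] [Nonempty A]

open Polynomial in
/-- The discounted value of a stationary policy is a rational function of the discount factor. -/
theorem exists_policy_value_rational (P : S → A → PMF S) (r : S → A → ℝ) (δ : S → A) (s : S) :
    ∃ N D : ℝ[X], D ≠ 0 ∧ ∀ (γ : ℝ) (V : S → ℝ),
      (∀ s, V s = r s (δ s) + γ * expect (P s (δ s)) V) → D.eval γ * V s = N.eval γ := by
  classical
  set Q : Matrix S S ℝ := Matrix.of fun s s' => (P s (δ s) s').toReal with hQ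
  -- Cramer's rule for `(1 - γ Q) V = r` with the discount factor as an indeterminate. The
  -- determinant equals `1` at `γ = 0`, so it is not the zero polynomial.
  set W : Matrix S S ℝ[X] := 1 - (X : ℝ[X]) • Q.map C with hW
  have hmap : ∀ γ : ℝ, (evalRingHom γ).mapMatrix W = 1 - γ • Q := by
    intro γ
    ext i j
    simp [hW, Matrix.one_apply, apply_ite]
    exact mul_comm _ _
  have hdet : ∀ γ : ℝ, W.det.eval γ = (1 - γ • Q).det := fun γ => by
    rw [← hmap, ← RingHom.map_det, coe_evalRingHom]
  have hadj : ∀ (γ : ℝ) i j, (W.adjugate i j).eval γ = (1 - γ • Q).adjugate i j := fun γ i j => by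
    rw [← hmap, ← RingHom.map_adjugate]
    rfl
  refine ⟨∑ j, W.adjugate s j * C (r j (δ j)), W.det, fun h => ?_, fun γ V hV => ?_⟩
  · have := hdet 0
    simp [h] at this
  · have hV' : (1 - γ • Q).mulVec V = fun s => r s (δ s) := by
      funext i
      rw [Matrix.sub_mulVec, Matrix.one_mulVec, Matrix.smul_mulVec, Pi.sub_apply, Pi.smul_apply,
        sub_eq_iff_eq_add, smul_eq_mul]
      conv_lhs => rw [hV i, expect_fintype]
      rfl
    have h2 : (1 - γ • Q).det • V = (1 - γ • Q).adjugate.mulVec fun s => r s (δ s) := by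
      rw [← hV', Matrix.mulVec_mulVec, Matrix.adjugate_mul, Matrix.smul_mulVec, Matrix.one_mulVec]
    have h3 := congrFun h2 s
    rw [Pi.smul_apply, smul_eq_mul] at h3
    rw [hdet, h3, eval_finsetSum, Matrix.mulVec, dotProduct]
    simp [hadj]

theorem eventually_discount : ∀ᶠ γ in 𝓝[<] (1 : ℝ), 0 ≤ γ ∧ γ < 1 := by
  filter_upwards [self_mem_nhdsWithin,
    nhdsWithin_le_nhds (lt_mem_nhds (zero_lt_one : (0 : ℝ) < 1))] with γ h1 h0
  exact ⟨le_of_lt h0, h1⟩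

/-- An optimal stationary policy exists for each `γ` but may change with `γ`; taking the maximum
over the finitely many policies removes this dependence. -/
theorem discountedValue_rational {P : S → A → PMF S} {r : S → A → ℝ}
    (hr : ∀ s a, r s a ∈ Set.Icc (0 : ℝ) 1) (s : S) :
    RationalNearOne fun γ => discountedValue P r γ s := by
  classical
  choose N D hD hND using fun δ : S → A => exists_policy_value_rational P r δ s
  have hrat : ∀ δ ∈ (Finset.univ : Finset (S → A)),
      RationalNearOne fun γ => (N δ).eval γ / (D δ).eval γ := fun δ _ => by
    refine ⟨N δ, D δ, hD δ, ?_⟩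
    filter_upwards [eventually_eval_ne_zero (hD δ)] with γ h
    rw [mul_div_cancel₀ _ h]
  refine (RationalNearOne.sup' Finset.univ_nonempty hrat).congr ?_
  have hne : ∀ᶠ γ in 𝓝[<] (1 : ℝ), ∀ δ, (D δ).eval γ ≠ 0 :=
    eventually_all.2 fun δ => eventually_eval_ne_zero (hD δ)
  filter_upwards [eventually_discount, hne] with γ hγ hne
  set V := discountedValue P r γ with hV
  have hb : bellman P r γ V = V := bellman_discountedValue hr hγ.1 hγ.2
  refine le_antisymm (Finset.sup'_le _ _ fun δ _ => ?_) ?_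
  -- The value of a fixed policy is the Bellman fixed point of the problem with a single action.
  · obtain ⟨W, hW⟩ : ∃ W : S → ℝ, ∀ s, W s = r s (δ s) + γ * expect (P s (δ s)) W := by
      have hc : ContractingWith ⟨γ, hγ.1⟩
          (bellman (A := Unit) (fun s _ => P s (δ s)) (fun s _ => r s (δ s)) γ) :=
        bellman_contracting _ _ hγ.1 hγ.2
      refine ⟨hc.fixedPoint, fun s => ?_⟩
      conv_lhs => rw [← hc.fixedPoint_isFixedPt.eq]
      simp [bellman]
    -- Maximum principle: at a maximizer the difference is at most `γ` times itself, hence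
    -- nonpositive.
    have hle : ∀ s, W s ≤ V s := by
      have : Nonempty S := ⟨s⟩
      obtain ⟨m, hm⟩ := Finite.exists_max fun s => W s - V s
      have h1 : W m - V m ≤ γ * (W m - V m) := by
        have h2 := (le_bellman P r γ V m (δ m)).trans_eq (congrFun hb m)
        have h3 : expect (P m (δ m)) W - expect (P m (δ m)) V ≤ W m - V m := by
          rw [← expect_sub (Set.toFinite _)]
          exact expect_le (Set.toFinite _) fun x _ => hm x
        rw [hW m] at h3 ⊢
        nlinarith [mul_le_mul_of_nonneg_left h3 hγ.1]
      intro s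
      have := hm s
      nlinarith [hγ.2]
    rw [← hND δ γ W hW, mul_div_cancel_left₀ _ (hne δ)]
    exact hle s
  · obtain ⟨δ, hδ⟩ := exists_bellman_eq P r γ V
    rw [hb] at hδ
    have h := Finset.le_sup' (fun δ => (N δ).eval γ / (D δ).eval γ) (Finset.mem_univ δ)
    refine le_trans (le_of_eq ?_) h
    rw [← hND δ γ V hδ, mul_div_cancel_left₀ _ (hne δ)]

end VanishingDiscount

/-! ### The average reward optimality equation -/

namespace BayesianMDP

variable {S A Θ : Type*} [Fintype S] [Fintype A] [Nonempty A] [MeasurableSpace Θ]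
  (M : BayesianMDP S A Θ)

/-- `limUnder` is meaningful only once a limit is known to exist; this and `tendsto_v` are the only
access to the two definitions. -/
theorem tendsto_rbar (θ : Θ) :
    Tendsto (fun γ => (1 - γ) * discountedValue (M.P θ) M.r γ M.ref) (𝓝[<] (1 : ℝ))
      (𝓝 (M.rbar θ)) := by
  have h1 : RationalNearOne fun γ => (1 - γ) * discountedValue (M.P θ) M.r γ M.ref := by
    exact ((discountedValue_rational (P := M.P θ) M.r_mem M.ref).eval_mul (1 - Polynomial.X)).congr
      (Eventually.of_forall fun γ => by
        rw [Polynomial.eval_sub, Polynomial.eval_one, Polynomial.eval_X])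
  refine tendsto_nhds_limUnder (h1.exists_tendsto (C := 1) ?_)
  filter_upwards [eventually_discount] with γ hγ
  rw [abs_of_nonneg (mul_nonneg (by linarith [hγ.2]) (discountedValue_nonneg M.r_mem hγ.1 _))]
  exact one_sub_mul_discountedValue_le M.r_mem hγ.1 hγ.2 _

theorem tendsto_v {θ : Θ} (hP : Communicating (M.P θ)) (s : S) :
    Tendsto (fun γ => discountedValue (M.P θ) M.r γ s - discountedValue (M.P θ) M.r γ M.ref)
      (𝓝[<] (1 : ℝ)) (𝓝 (M.v θ s)) := by
  obtain ⟨C, hC⟩ := exists_span_discountedValue_le (P := M.P θ) M.r_mem hP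
  refine tendsto_nhds_limUnder (((discountedValue_rational (P := M.P θ) M.r_mem s).sub
    (discountedValue_rational (P := M.P θ) M.r_mem M.ref)).exists_tendsto (C := C) ?_)
  filter_upwards [eventually_discount] with γ hγ
  have h1 := hC γ hγ.1 hγ.2 s M.ref
  have h2 := hC γ hγ.1 hγ.2 M.ref s
  exact abs_le.2 ⟨by linarith, h1⟩

theorem rbar_mem (θ : Θ) : M.rbar θ ∈ Set.Icc (0 : ℝ) 1 := by
  refine isClosed_Icc.mem_of_tendsto (M.tendsto_rbar θ) ?_
  filter_upwards [eventually_discount] with γ hγ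
  exact ⟨mul_nonneg (by linarith [hγ.2]) (discountedValue_nonneg M.r_mem hγ.1 _),
    one_sub_mul_discountedValue_le M.r_mem hγ.1 hγ.2 _⟩

theorem v_ref {θ : Θ} (hP : Communicating (M.P θ)) : M.v θ M.ref = 0 :=
  tendsto_nhds_unique (M.tendsto_v hP M.ref) (by simp)

theorem q_eq (θ : Θ) (s : S) (a : A) : M.q θ s a = M.r s a + expect (M.P θ s a) (M.v θ) := by
  rw [q, expect_fintype]

/-- The optimality equation for the average reward. -/
theorem sup_q_eq {θ : Θ} (hP : Communicating (M.P θ)) (s : S) :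
    Finset.univ.sup' Finset.univ_nonempty (fun a => M.q θ s a) = M.rbar θ + M.v θ s := by
  have hid : Tendsto (fun γ : ℝ => γ) (𝓝[<] (1 : ℝ)) (𝓝 1) :=
    tendsto_id.mono_left nhdsWithin_le_nhds
  have hq : ∀ a, Tendsto (fun γ => M.r s a + γ * ∑ s', (M.P θ s a s').toReal *
      (discountedValue (M.P θ) M.r γ s' - discountedValue (M.P θ) M.r γ M.ref)) (𝓝[<] (1 : ℝ))
      (𝓝 (M.q θ s a)) := fun a => by
    have := (hid.mul (tendsto_finsetSum Finset.univ fun s' _ =>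
      (M.tendsto_v hP s').const_mul (M.P θ s a s').toReal)).const_add (M.r s a)
    rwa [one_mul] at this
  have h1 := Tendsto.finset_sup'_nhds_apply Finset.univ_nonempty fun a _ => hq a
  -- Subtracting `γ V(ref)` from the Bellman equation leaves `(1 - γ) V(ref) + (V s - V(ref))` on
  -- the value side, and on the other side a finite maximum in which only relative values occur;
  -- both converge.
  refine tendsto_nhds_unique h1 (((M.tendsto_rbar θ).add (M.tendsto_v hP s)).congr' ?_)
  filter_upwards [eventually_discount] with γ hγ
  set V := discountedValue (M.P θ) M.r γ with hV
  have hb := congrFun (bellman_discountedValue (P := M.P θ) M.r_mem hγ.1 hγ.2) s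
  have h2 : ∀ a, M.r s a + γ * ∑ s', (M.P θ s a s').toReal * (V s' - V M.ref) =
      (M.r s a + γ * expect (M.P θ s a) V) - γ * V M.ref := fun a => by
    have := expect_sub (p := M.P θ s a) (Set.toFinite _) V (fun _ => V M.ref)
    rw [expect_const (Set.toFinite _), expect_fintype] at this
    rw [this]
    ring
  simp_rw [h2]
  have h3 : ∀ c : ℝ, Finset.univ.sup' Finset.univ_nonempty
      (fun a => (M.r s a + γ * expect (M.P θ s a) V) - c) = bellman (M.P θ) M.r γ V s - c :=
    fun c => by
    refine le_antisymm (Finset.sup'_le _ _ fun a _ => ?_) ?_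
    · linarith [le_bellman (M.P θ) M.r γ V s a]
    · obtain ⟨δ, hδ⟩ := exists_bellman_eq (M.P θ) M.r γ V
      rw [hδ]
      exact Finset.le_sup' (fun a => (M.r s a + γ * expect (M.P θ s a) V) - c)
        (Finset.mem_univ (δ s))
  rw [h3, hb]
  ring

theorem q_le {θ : Θ} (hP : Communicating (M.P θ)) (s : S) (a : A) :
    M.q θ s a ≤ M.rbar θ + M.v θ s :=
  (Finset.le_sup' (fun a => M.q θ s a) (Finset.mem_univ a)).trans_eq (M.sup_q_eq hP s)

theorem q_solve (O : Oracle M) {θ : Θ} (hP : Communicating (M.P θ)) (s : S) :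
    M.q θ s (O.solve θ s) = M.rbar θ + M.v θ s :=
  le_antisymm (M.q_le hP s _) ((M.sup_q_eq hP s).symm.trans_le
    (Finset.sup'_le _ _ fun a _ => O.optimal θ s a))

/-! ### Measurability in the parameter -/

omit [Nonempty A] in
theorem measurable_expect_P (s : S) (a : A) {f : Θ → S → ℝ} (hf : ∀ s, Measurable fun θ => f θ s) :
    Measurable fun θ => expect (M.P θ s a) (f θ) := by
  simp_rw [expect_fintype]
  exact Finset.measurable_sum _ fun s' _ => (M.measurable_P s a s').ennreal_toReal.mul (hf s')

/-- The defining supremum ranges over policies that may be uncountably many, so measurability is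
obtained from value iteration: each Bellman iterate is a finite maximum of measurable functions. -/
theorem measurable_discountedValue {γ : ℝ} (h0 : 0 ≤ γ) (h1 : γ < 1) (s : S) :
    Measurable fun θ => discountedValue (M.P θ) M.r γ s := by
  have hit : ∀ (n : ℕ) (s : S), Measurable fun θ => (bellman (M.P θ) M.r γ)^[n] 0 s := by
    intro n
    induction n with
    | zero => simp
    | succ n ih =>
      intro s
      simp_rw [Function.iterate_succ_apply']
      have := Finset.measurable_sup' (Finset.univ_nonempty (α := A))
        (f := fun a θ => M.r s a + γ * expect (M.P θ s a) ((bellman (M.P θ) M.r γ)^[n] 0))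
        fun a _ => ((M.measurable_expect_P s a ih).const_mul γ).const_add (M.r s a)
      convert this using 1
      funext θ
      rw [Finset.sup'_apply]
      rfl
  refine measurable_of_tendsto_metrizable (fun n => hit n s) (tendsto_pi_nhds.2 fun θ => ?_)
  exact (tendsto_pi_nhds.1 (tendsto_iterate_bellman (P := M.P θ) M.r_mem h0 h1)) s

theorem tendsto_one_sub_inv : Tendsto (fun n : ℕ => 1 - 1 / ((n : ℝ) + 1)) atTop (𝓝[<] 1) := by
  refine tendsto_nhdsWithin_iff.2 ⟨?_, Eventually.of_forall fun n => ?_⟩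
  · simpa using (tendsto_one_div_add_atTop_nhds_zero_nat (𝕜 := ℝ)).const_sub 1
  · have : (0 : ℝ) < 1 / ((n : ℝ) + 1) := by positivity
    simpa using by positivity

theorem one_sub_inv_mem (n : ℕ) :
    0 ≤ 1 - 1 / ((n : ℝ) + 1) ∧ 1 - 1 / ((n : ℝ) + 1) < 1 := by
  have h : (0 : ℝ) < n + 1 := by positivity
  have h2 : 1 / ((n : ℝ) + 1) ≤ 1 := by
    rw [div_le_one h]
    linarith [Nat.cast_nonneg (α := ℝ) n]
  exact ⟨by linarith, by linarith [one_div_pos.2 h]⟩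

theorem measurable_rbar : Measurable M.rbar := by
  refine measurable_of_tendsto_metrizable (f := fun (n : ℕ) θ => (1 - (1 - 1 / ((n : ℝ) + 1))) *
    discountedValue (M.P θ) M.r (1 - 1 / ((n : ℝ) + 1)) M.ref) (fun n => ?_)
    (tendsto_pi_nhds.2 fun θ => (M.tendsto_rbar θ).comp tendsto_one_sub_inv)
  exact (M.measurable_discountedValue (one_sub_inv_mem n).1 (one_sub_inv_mem n).2 _).const_mul _

theorem measurable_v (hP : ∀ θ, Communicating (M.P θ)) (s : S) :
    Measurable fun θ => M.v θ s := by
  refine measurable_of_tendsto_metrizable (f := fun (n : ℕ) θ =>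
    discountedValue (M.P θ) M.r (1 - 1 / ((n : ℝ) + 1)) s -
      discountedValue (M.P θ) M.r (1 - 1 / ((n : ℝ) + 1)) M.ref) (fun n => ?_)
    (tendsto_pi_nhds.2 fun θ => (M.tendsto_v (hP θ) s).comp tendsto_one_sub_inv)
  exact (M.measurable_discountedValue (one_sub_inv_mem n).1 (one_sub_inv_mem n).2 _).sub
    (M.measurable_discountedValue (one_sub_inv_mem n).1 (one_sub_inv_mem n).2 _)

theorem measurable_expertPolicy (hP : ∀ θ, Communicating (M.P θ)) (E : Expert S) (s : S) (a : A) :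
    Measurable fun θ => M.expertPolicy E θ s a := by
  have hq : ∀ a, Measurable fun θ => Real.exp (E.β * M.q θ s a) := fun a => by
    simp_rw [q_eq]
    exact Real.measurable_exp.comp
      (((M.measurable_expect_P s a (M.measurable_v hP)).const_add _).const_mul _)
  exact ((hq a).div (Finset.measurable_sum _ fun a _ => hq a)).ennreal_ofReal

end BayesianMDP

/-! ### Posterior sampling -/

section Posterior

variable {X Θ : Type*} [MeasurableSpace Θ]

/-- When the normalizing constant is zero both sides vanish, so the default branch of `bayesUpdate`
is harmless. -/
theorem withDensity_eq_smul_bayesUpdate (μ : ProbabilityMeasure Θ) {L : Θ → ℝ≥0∞}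
    (hL : Measurable L) (h : ∫⁻ θ, L θ ∂(μ : Measure Θ) ≠ ∞) :
    (μ : Measure Θ).withDensity L =
      (∫⁻ θ, L θ ∂(μ : Measure Θ)) • (bayesUpdate μ L : Measure Θ) := by
  by_cases h0 : ∫⁻ θ, L θ ∂(μ : Measure Θ) = 0
  · rw [h0, zero_smul, withDensity_eq_zero_iff hL.aemeasurable]
    exact (lintegral_eq_zero_iff hL).1 h0
  · have h1 : (bayesUpdate μ L : Measure Θ) =
        (∫⁻ θ, L θ ∂(μ : Measure Θ))⁻¹ • (μ : Measure Θ).withDensity L :=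
      congrArg Subtype.val (dif_pos ⟨h0, h⟩)
    rw [h1, smul_smul, ENNReal.mul_inv_cancel h0 h, one_smul]

/-- `post x` is the posterior law of the parameter given the observation `x`, when the parameter
has prior law `μ` and the observation has law `K θ`, supported in the finite set `F`, given the
parameter `θ`. -/
structure IsPosterior (μ : ProbabilityMeasure Θ) (K : Θ → PMF X) (F : Finset X)
    (post : X → ProbabilityMeasure Θ) : Prop where
  measurable : ∀ x, Measurable fun θ => K θ x
  support : ∀ θ, (K θ).support ⊆ F
  bayes : ∀ x, ∃ w : ℝ≥0∞, (μ : Measure Θ).withDensity (fun θ => K θ x) = w • (post x : Measure Θ)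

/-- Marginal probability of the observation `x`. -/
def evidence (μ : ProbabilityMeasure Θ) (K : Θ → PMF X) (x : X) : ℝ≥0∞ :=
  ∫⁻ θ, K θ x ∂(μ : Measure Θ)

/-- Expectation of `G θ θ' x` when `x` is the observation and `θ`, `θ'` are independent draws from
the posterior given `x`. -/
def pairE (μ : ProbabilityMeasure Θ) (K : Θ → PMF X) (F : Finset X)
    (post : X → ProbabilityMeasure Θ) (G : Θ → Θ → X → ℝ) : ℝ :=
  ∑ x ∈ F, (evidence μ K x).toReal *
    ∫ p, G p.1 p.2 x ∂((post x : Measure Θ).prod (post x : Measure Θ))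

/-- Measurability and boundedness in the parameters. -/
def Regular (G : Θ → Θ → X → ℝ) : Prop :=
  ∀ x, Measurable (fun p : Θ × Θ => G p.1 p.2 x) ∧ ∃ C, ∀ θ θ', |G θ θ' x| ≤ C

theorem Regular.integrable {G : Θ → Θ → X → ℝ} (hG : Regular G) (x : X) (ν : Measure (Θ × Θ))
    [IsFiniteMeasure ν] : Integrable (fun p => G p.1 p.2 x) ν := by
  obtain ⟨C, hC⟩ := (hG x).2
  exact Integrable.of_bound (hG x).1.aestronglyMeasurable C
    (Eventually.of_forall fun p => hC p.1 p.2)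

theorem Regular.add {G G' : Θ → Θ → X → ℝ} (hG : Regular G) (hG' : Regular G') :
    Regular fun θ θ' x => G θ θ' x + G' θ θ' x := fun x => by
  obtain ⟨C, hC⟩ := (hG x).2
  obtain ⟨C', hC'⟩ := (hG' x).2
  exact ⟨(hG x).1.add (hG' x).1, C + C', fun θ θ' =>
    (abs_add_le _ _).trans (add_le_add (hC θ θ') (hC' θ θ'))⟩

theorem Regular.const_mul {G : Θ → Θ → X → ℝ} (hG : Regular G) (c : ℝ) :
    Regular fun θ θ' x => c * G θ θ' x := fun x => by
  obtain ⟨C, hC⟩ := (hG x).2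
  refine ⟨(hG x).1.const_mul c, |c| * C, fun θ θ' => ?_⟩
  rw [abs_mul]
  exact mul_le_mul_of_nonneg_left (hC θ θ') (abs_nonneg c)

theorem Regular.sub {G G' : Θ → Θ → X → ℝ} (hG : Regular G) (hG' : Regular G') :
    Regular fun θ θ' x => G θ θ' x - G' θ θ' x := by
  simpa [sub_eq_add_neg] using hG.add (hG'.const_mul (-1))

theorem Regular.mul {G G' : Θ → Θ → X → ℝ} (hG : Regular G) (hG' : Regular G') :
    Regular fun θ θ' x => G θ θ' x * G' θ θ' x := fun x => by
  obtain ⟨C, hC⟩ := (hG x).2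
  obtain ⟨C', hC'⟩ := (hG' x).2
  refine ⟨(hG x).1.mul (hG' x).1, C * C', fun θ θ' => ?_⟩
  rw [abs_mul]
  exact mul_le_mul (hC θ θ') (hC' θ θ') (abs_nonneg _) ((abs_nonneg _).trans (hC θ θ'))

theorem Regular.swap {G : Θ → Θ → X → ℝ} (hG : Regular G) : Regular fun θ θ' => G θ' θ :=
  fun x => ⟨(hG x).1.comp measurable_swap, (hG x).2.imp fun _ hC θ θ' => hC θ' θ⟩

theorem regular_of_left {f : Θ → X → ℝ} (hf : ∀ x, Measurable fun θ => f θ x)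
    (hC : ∀ x, ∃ C, ∀ θ, |f θ x| ≤ C) : Regular fun θ (_ : Θ) x => f θ x :=
  fun x => ⟨(hf x).comp measurable_fst, (hC x).imp fun _ hC θ _ => hC θ⟩

theorem regular_of_obs (f : X → ℝ) : Regular fun (_ : Θ) (_ : Θ) x => f x :=
  fun x => ⟨measurable_const, |f x|, fun _ _ => le_rfl⟩

variable {μ : ProbabilityMeasure Θ} {K : Θ → PMF X} {F : Finset X}
  {post : X → ProbabilityMeasure Θ}

theorem pairE_swap (G : Θ → Θ → X → ℝ) :
    pairE μ K F post (fun θ θ' => G θ' θ) = pairE μ K F post G := by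
  refine Finset.sum_congr rfl fun x _ => ?_
  congr 1
  exact integral_prod_swap (fun p : Θ × Θ => G p.1 p.2 x)

theorem pairE_mono {G G' : Θ → Θ → X → ℝ} (hG : Regular G) (hG' : Regular G')
    (h : ∀ x ∈ F, ∀ θ θ', G θ θ' x ≤ G' θ θ' x) : pairE μ K F post G ≤ pairE μ K F post G' :=
  Finset.sum_le_sum fun x hx => mul_le_mul_of_nonneg_left
    (integral_mono (hG.integrable x _) (hG'.integrable x _) fun p => h x hx p.1 p.2)
    ENNReal.toReal_nonneg

theorem pairE_add {G G' : Θ → Θ → X → ℝ} (hG : Regular G) (hG' : Regular G') :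
    pairE μ K F post (fun θ θ' x => G θ θ' x + G' θ θ' x) =
      pairE μ K F post G + pairE μ K F post G' := by
  simp only [pairE]
  rw [← Finset.sum_add_distrib]
  refine Finset.sum_congr rfl fun x _ => ?_
  rw [integral_add (hG.integrable x _) (hG'.integrable x _), mul_add]

theorem pairE_const_mul (c : ℝ) (G : Θ → Θ → X → ℝ) :
    pairE μ K F post (fun θ θ' x => c * G θ θ' x) = c * pairE μ K F post G := by
  simp only [pairE]
  rw [Finset.mul_sum]
  refine Finset.sum_congr rfl fun x _ => ?_
  rw [integral_const_mul]
  ring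

theorem pairE_sub {G G' : Θ → Θ → X → ℝ} (hG : Regular G) (hG' : Regular G') :
    pairE μ K F post (fun θ θ' x => G θ θ' x - G' θ θ' x) =
      pairE μ K F post G - pairE μ K F post G' := by
  simp only [pairE]
  rw [← Finset.sum_sub_distrib]
  refine Finset.sum_congr rfl fun x _ => ?_
  rw [integral_sub (hG.integrable x _) (hG'.integrable x _), mul_sub]

/-- Comparing total masses identifies the unspecified scalar in `bayes`. -/
theorem IsPosterior.withDensity_eq (h : IsPosterior μ K F post) (x : X) :
    (μ : Measure Θ).withDensity (fun θ => K θ x) = evidence μ K x • (post x : Measure Θ) := by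
  obtain ⟨w, hw⟩ := h.bayes x
  have h1 := congrArg (fun ν : Measure Θ => ν Set.univ) hw
  simp only [withDensity_apply _ MeasurableSet.univ, Measure.restrict_univ, Measure.smul_apply,
    measure_univ, smul_eq_mul, mul_one] at h1
  rw [hw, evidence, h1]

/-- The joint law of the parameter, the observation, and a posterior sample. -/
theorem IsPosterior.integral_expect (h : IsPosterior μ K F post) {G : Θ → Θ → X → ℝ}
    (hG : Regular G) :
    ∫ θ, expect (K θ) (fun x => ∫ θ', G θ θ' x ∂(post x : Measure Θ)) ∂(μ : Measure Θ) =
      pairE μ K F post G := by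
  simp_rw [expect_eq_sum (h.support _)]
  have hmeas : ∀ x, Measurable fun θ => ∫ θ', G θ θ' x ∂(post x : Measure Θ) := fun x =>
    ((hG x).1.stronglyMeasurable.integral_prod_right' (ν := (post x : Measure Θ))).measurable
  have hK : ∀ x, Measurable fun θ => (K θ x).toReal := fun x => (h.measurable x).ennreal_toReal
  rw [integral_finsetSum]
  · refine Finset.sum_congr rfl fun x _ => ?_
    -- Weighting the prior by the likelihood of `x` yields the evidence times the posterior; this
    -- turns the true parameter into a second posterior draw, independent of `θ'` given `x`.
    have h1 := integral_withDensity_eq_integral_toReal_smul (μ := (μ : Measure Θ))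
      (h.measurable x) (Eventually.of_forall fun θ => (K θ).apply_lt_top x)
      (fun θ => ∫ θ', G θ θ' x ∂(post x : Measure Θ))
    simp only [smul_eq_mul] at h1
    rw [← h1, h.withDensity_eq, integral_smul_measure, integral_prod _ (hG.integrable x _),
      smul_eq_mul]
  · intro x _
    obtain ⟨C, hC⟩ := (hG x).2
    refine Integrable.of_bound ((hK x).mul (hmeas x)).aestronglyMeasurable (1 * C)
      (Eventually.of_forall fun θ => ?_)
    rw [norm_mul]
    refine mul_le_mul ?_ ?_ (norm_nonneg _) zero_le_one
    · rw [Real.norm_of_nonneg ENNReal.toReal_nonneg]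
      exact ENNReal.toReal_le_of_le_ofReal zero_le_one (by simpa using (K θ).coe_le_one x)
    · refine (norm_integral_le_of_norm_le_const (Eventually.of_forall fun θ' => hC θ θ')).trans ?_
      simp

theorem IsPosterior.integral_expect_left (h : IsPosterior μ K F post) {f : Θ → X → ℝ}
    (hf : ∀ x, Measurable fun θ => f θ x) (hC : ∀ x, ∃ C, ∀ θ, |f θ x| ≤ C) :
    ∫ θ, expect (K θ) (f θ) ∂(μ : Measure Θ) = pairE μ K F post fun θ _ x => f θ x := by
  rw [← h.integral_expect (regular_of_left hf hC)]
  simp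

theorem IsPosterior.pairE_const (h : IsPosterior μ K F post) (c : ℝ) :
    pairE μ K F post (fun _ _ _ => c) = c := by
  rw [← h.integral_expect_left (f := fun _ _ => c) (fun _ => measurable_const)
    fun _ => ⟨|c|, fun _ => le_rfl⟩]
  simp_rw [expect_const (F.finite_toSet.subset (h.support _))]
  simp

/-- For centred products, the posterior samples decouple. -/
theorem pairE_centered_mul {f : Θ → ℝ} (hf : ∀ x, Integrable f (post x : Measure Θ)) (u : X → ℝ) :
    pairE μ K F post (fun θ θ' x => (f θ - u x) * (f θ' - u x)) =
      ∑ x ∈ F, (evidence μ K x).toReal * ((∫ θ, f θ ∂(post x : Measure Θ)) - u x) ^ 2 := by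
  refine Finset.sum_congr rfl fun x _ => ?_
  rw [integral_prod_mul (fun θ => f θ - u x) (fun θ => f θ - u x),
    integral_sub (hf x) (integrable_const _)]
  simp [sq]

theorem IsPosterior.measurable_expect_integral (h : IsPosterior μ K F post) {G : Θ → Θ → X → ℝ}
    (hG : Regular G) :
    Measurable fun θ => expect (K θ) (fun x => ∫ θ', G θ θ' x ∂(post x : Measure Θ)) := by
  simp_rw [expect_eq_sum (h.support _)]
  exact Finset.measurable_sum _ fun x _ => (h.measurable x).ennreal_toReal.mul
    ((hG x).1.stronglyMeasurable.integral_prod_right' (ν := (post x : Measure Θ))).measurable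

end Posterior

/-! ### Episodes -/

section Episodes

variable {Tep : ℕ → ℕ}

theorem epStart_one (Tep : ℕ → ℕ) : epStart Tep 1 = 0 := by simp [epStart]

theorem epStart_succ (Tep : ℕ → ℕ) {k : ℕ} (hk : 1 ≤ k) :
    epStart Tep (k + 1) = epStart Tep k + Tep k :=
  Finset.sum_Ico_succ_top hk _

theorem epStart_mono (Tep : ℕ → ℕ) : Monotone (epStart Tep) := fun _ _ h =>
  Finset.sum_le_sum_of_subset (Finset.Ico_subset_Ico_right h)

theorem le_epStart (hT : ∀ k, 1 ≤ k → 1 ≤ Tep k) (k : ℕ) : k ≤ epStart Tep k + 1 := by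
  have : ∑ _j ∈ Finset.Ico 1 k, 1 ≤ epStart Tep k :=
    Finset.sum_le_sum fun j hj => hT j (Finset.mem_Ico.1 hj).1
  simp at this
  omega

theorem epIndex_eq (hT : ∀ k, 1 ≤ k → 1 ≤ Tep k) {k t : ℕ} (h1 : epStart Tep k ≤ t)
    (h2 : t < epStart Tep (k + 1)) : epIndex Tep t = k := by
  rw [epIndex, Nat.findGreatest_eq_iff]
  refine ⟨(le_epStart hT k).trans (by omega), fun _ => h1, fun m hm _ => ?_⟩
  have := epStart_mono Tep (Nat.succ_le_of_lt hm)
  simp only [Nat.succ_eq_add_one] at this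
  omega

theorem epStart_epIndex_le (Tep : ℕ → ℕ) (t : ℕ) : epStart Tep (epIndex Tep t) ≤ t :=
  Nat.findGreatest_spec (P := fun k => epStart Tep k ≤ t) (m := 0) (n := t + 1) (by omega)
    (by simp [epStart])

theorem one_le_epIndex (Tep : ℕ → ℕ) (t : ℕ) : 1 ≤ epIndex Tep t :=
  Nat.le_findGreatest (by omega) (by simp [epStart])

theorem lt_epStart_epIndex_succ (hT : ∀ k, 1 ≤ k → 1 ≤ Tep k) (t : ℕ) :
    t < epStart Tep (epIndex Tep t + 1) := by
  by_contra! h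
  have h1 := le_epStart hT (epIndex Tep t + 1)
  have := Nat.le_findGreatest (P := fun k => epStart Tep k ≤ t) (n := t + 1) (by omega) h
  have h3 : epIndex Tep t + 1 ≤ epIndex Tep t := this
  omega

end Episodes

/-! ### The law of the data -/

section Algorithm

variable {S A Θ : Type*} [Fintype S] [Fintype A] [MeasurableSpace Θ] [Nonempty A]

/-- Offline data, online history, current state. -/
abbrev Obs (S A : Type*) := History S A × History S A × S

/-- One step in the environment `P` under the stationary policy `π`. -/
def runStep (P : S → A → PMF S) (π : S → A) (x : Obs S A) : PMF (Obs S A) :=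
  (P x.2.2 (π x.2.2)).map fun s' => (x.1, x.2.1 ++ [(x.2.2, π x.2.2, s')], s')

/-- Several steps in the environment `P` under the stationary policy `π`. -/
def run (P : S → A → PMF S) (π : S → A) : ℕ → Obs S A → PMF (Obs S A)
  | 0, x => PMF.pure x
  | n + 1, x => (run P π n x).bind (runStep P π)

/-- Law of the offline data, the online history up to time `t`, the state and the policy at time
`t`. -/
def policyLaw (M : BayesianMDP S A Θ) (E : Expert S) (O : Oracle M) (Tep : ℕ → ℕ) (θ : Θ) (t : ℕ) :
    PMF (Obs S A × (S → A)) :=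
  (M.offlineLaw E θ).bind fun D => (onlineLaw M E O Tep θ D t).map fun y => ((D, y.1, y.2.1), y.2.2)

/-- Law of the offline data, the online history up to time `t`, and the state at time `t`. -/
def obsLaw (M : BayesianMDP S A Θ) (E : Expert S) (O : Oracle M) (Tep : ℕ → ℕ) (θ : Θ) :
    ℕ → PMF (Obs S A)
  | 0 => (M.offlineLaw E θ).bind fun D => M.ν.map fun s => (D, [], s)
  | t + 1 => (policyLaw M E O Tep θ t).bind fun y => runStep (M.P θ) y.2 y.1

/-- Belief of the algorithm at the start of episode `k`. -/
def obsBelief (M : BayesianMDP S A Θ) (E : Expert S) (Tep : ℕ → ℕ) (k : ℕ) (x : Obs S A) :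
    ProbabilityMeasure Θ :=
  belief M E Tep x.1 x.2.1 k

variable {M : BayesianMDP S A Θ} {E : Expert S} {O : Oracle M} {Tep : ℕ → ℕ}

/-- `obsLaw` describes the data just before a possible resampling at that time, `policyLaw` includes
the policy in force just after it. -/
theorem policyLaw_epStart (hT : ∀ k, 1 ≤ k → 1 ≤ Tep k) {k : ℕ} (hk : 1 ≤ k) (θ : Θ) :
    policyLaw M E O Tep θ (epStart Tep k) = (obsLaw M E O Tep θ (epStart Tep k)).bind fun x =>
      (samplePolicy O (obsBelief M E Tep k x)).map fun π => (x, π) := by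
  have hidx : epIndex Tep (epStart Tep k) = k :=
    epIndex_eq hT le_rfl (by rw [epStart_succ Tep hk]; have := hT k hk; omega)
  generalize ht : epStart Tep k = t at hidx ⊢
  rcases t with _ | t
  · have h1 : k = 1 := by have := le_epStart hT k; omega
    subst h1
    rw [policyLaw, obsLaw, PMF.bind_bind]
    congr 1
    funext D
    rw [onlineLaw, PMF.map_bind, PMF.bind_map]
    congr 1
    funext s
    rw [PMF.map_comp]
    rfl
  · rw [policyLaw, obsLaw, policyLaw, PMF.bind_bind, PMF.bind_bind]
    congr 1
    funext D
    rw [onlineLaw, PMF.map_bind, PMF.bind_map]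
    congr 1
    funext y
    rw [PMF.map_bind, Function.comp_apply, runStep, PMF.bind_map]
    congr 1
    funext s'
    dsimp only
    rw [hidx, if_pos ht, PMF.map_comp]
    rfl

theorem policyLaw_succ {t : ℕ} (h : epStart Tep (epIndex Tep (t + 1)) ≠ t + 1) (θ : Θ) :
    policyLaw M E O Tep θ (t + 1) = (policyLaw M E O Tep θ t).bind fun y =>
      (runStep (M.P θ) y.2 y.1).map fun x => (x, y.2) := by
  rw [policyLaw, policyLaw, PMF.bind_bind]
  congr 1
  funext D
  rw [onlineLaw, PMF.map_bind, PMF.bind_map]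
  congr 1
  funext y
  rw [PMF.map_bind, Function.comp_apply, runStep, PMF.map_comp]
  simp only [if_neg h, PMF.pure_map]
  rfl

theorem policyLaw_episode (hT : ∀ k, 1 ≤ k → 1 ≤ Tep k) {k : ℕ} (hk : 1 ≤ k) (θ : Θ) {n : ℕ}
    (hn : n < Tep k) :
    policyLaw M E O Tep θ (epStart Tep k + n) = (obsLaw M E O Tep θ (epStart Tep k)).bind fun x =>
      (samplePolicy O (obsBelief M E Tep k x)).bind fun π =>
        (run (M.P θ) π n x).map fun y => (y, π) := by
  induction n with
  | zero =>
    rw [add_zero, policyLaw_epStart hT hk]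
    congr 1
    funext x
    simp only [run, PMF.pure_map]
    rfl
  | succ n ih =>
    have hidx : epIndex Tep (epStart Tep k + n + 1) = k :=
      epIndex_eq hT (by omega) (by rw [epStart_succ Tep hk]; omega)
    rw [← add_assoc, policyLaw_succ (by rw [hidx]; omega), ih (by omega), PMF.bind_bind]
    congr 1
    funext x
    rw [PMF.bind_bind]
    congr 1
    funext π
    rw [PMF.bind_map, run, PMF.map_bind]
    rfl

/-- Within an episode, the algorithm runs the policy sampled at its start. -/
theorem obsLaw_episode (hT : ∀ k, 1 ≤ k → 1 ≤ Tep k) {k : ℕ} (hk : 1 ≤ k) (θ : Θ) {n : ℕ}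
    (hn : n ≤ Tep k) :
    obsLaw M E O Tep θ (epStart Tep k + n) = (obsLaw M E O Tep θ (epStart Tep k)).bind fun x =>
      (samplePolicy O (obsBelief M E Tep k x)).bind fun π => run (M.P θ) π n x := by
  rcases n with _ | n
  · simp only [run, add_zero, PMF.bind_const, PMF.bind_pure]
  -- The last transition is taken from `policyLaw` one time earlier. The full length `n = Tep k` is
  -- therefore allowed, because the draw opening the next episode is not part of `obsLaw`.
  · rw [← add_assoc, obsLaw, policyLaw_episode hT hk θ hn, PMF.bind_bind]
    congr 1
    funext x
    rw [PMF.bind_bind]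
    congr 1
    funext π
    rw [PMF.bind_map, run]
    rfl

/-! ### Supports -/

theorem finite_support_offlineLaw (M : BayesianMDP S A Θ) (E : Expert S) (θ : Θ) :
    (M.offlineLaw E θ).support.Finite :=
  finite_support_map _ (finite_support_trajLaw ..)

theorem finite_support_onlineLaw (M : BayesianMDP S A Θ) (E : Expert S) (O : Oracle M)
    (Tep : ℕ → ℕ) (θ : Θ) (D : History S A) (t : ℕ) :
    (onlineLaw M E O Tep θ D t).support.Finite := by
  classical
  induction t with
  | zero =>
    exact finite_support_bind (Set.toFinite _) fun s => finite_support_map _ (Set.toFinite _)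
  | succ t ih =>
    refine finite_support_bind ih fun x => finite_support_bind (Set.toFinite _) fun s' => ?_
    dsimp only
    split_ifs
    · exact finite_support_map _ (Set.toFinite _)
    · exact finite_support_pure _

theorem finite_support_policyLaw (M : BayesianMDP S A Θ) (E : Expert S) (O : Oracle M)
    (Tep : ℕ → ℕ) (θ : Θ) (t : ℕ) : (policyLaw M E O Tep θ t).support.Finite :=
  finite_support_bind (finite_support_offlineLaw M E θ) fun _ =>
    finite_support_map _ (finite_support_onlineLaw ..)

theorem finite_support_runStep (P : S → A → PMF S) (π : S → A) (x : Obs S A) :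
    (runStep P π x).support.Finite :=
  finite_support_map _ (Set.toFinite _)

theorem finite_support_run (P : S → A → PMF S) (π : S → A) (n : ℕ) (x : Obs S A) :
    (run P π n x).support.Finite := by
  induction n with
  | zero => exact finite_support_pure _
  | succ n ih => exact finite_support_bind ih fun y => finite_support_runStep P π y

theorem length_of_mem_support_run {P : S → A → PMF S} {π : S → A} {n : ℕ} {x y : Obs S A}
    (h : y ∈ (run P π n x).support) : y.1 = x.1 ∧ y.2.1.length = x.2.1.length + n := by
  induction n generalizing y with
  | zero =>
    rw [run, PMF.support_pure, Set.mem_singleton_iff] at h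
    simp [h]
  | succ n ih =>
    rw [run, PMF.mem_support_bind_iff] at h
    obtain ⟨z, hz, h⟩ := h
    rw [runStep, PMF.mem_support_map_iff] at h
    obtain ⟨s', -, rfl⟩ := h
    have := ih hz
    simp only [List.length_append, List.length_singleton]
    exact ⟨this.1, by omega⟩

theorem length_of_mem_support_trajLaw {P : S → A → PMF S} {π : History S A → S → PMF A}
    {init : PMF S} {t : ℕ} {x : History S A × S} (h : x ∈ (trajLaw P π init t).support) :
    x.1.length = t := by
  induction t generalizing x with
  | zero =>
    rw [trajLaw, PMF.mem_support_map_iff] at h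
    obtain ⟨s, -, rfl⟩ := h
    rfl
  | succ t ih =>
    rw [trajLaw, PMF.mem_support_bind_iff] at h
    obtain ⟨z, hz, h⟩ := h
    rw [PMF.mem_support_bind_iff] at h
    obtain ⟨a, -, h⟩ := h
    rw [PMF.mem_support_map_iff] at h
    obtain ⟨s', -, rfl⟩ := h
    simp [ih hz]

theorem length_of_mem_support_onlineLaw {θ : Θ} {D : History S A} {t : ℕ}
    {x : History S A × S × (S → A)} (h : x ∈ (onlineLaw M E O Tep θ D t).support) :
    x.1.length = t := by
  classical
  induction t generalizing x with
  | zero =>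
    rw [onlineLaw, PMF.mem_support_bind_iff] at h
    obtain ⟨s, -, h⟩ := h
    rw [PMF.mem_support_map_iff] at h
    obtain ⟨π, -, rfl⟩ := h
    rfl
  | succ t ih =>
    rw [onlineLaw, PMF.mem_support_bind_iff] at h
    obtain ⟨z, hz, h⟩ := h
    rw [PMF.mem_support_bind_iff] at h
    obtain ⟨s', -, h⟩ := h
    have hz := ih hz
    dsimp only at h
    split_ifs at h
    · rw [PMF.mem_support_map_iff] at h
      obtain ⟨π, -, rfl⟩ := h
      simp [hz]
    · rw [PMF.support_pure, Set.mem_singleton_iff] at h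
      simp [h, hz]

/-- The observations with `N` offline and `t` online transitions. -/
def obsOfLength (S A : Type*) [Finite S] [Finite A] (N t : ℕ) : Finset (Obs S A) :=
  (((List.finite_length_eq (S × A × S) N).prod
    ((List.finite_length_eq (S × A × S) t).prod (Set.finite_univ (α := S))))).toFinset

theorem mem_obsOfLength {N t : ℕ} {x : Obs S A} :
    x ∈ obsOfLength S A N t ↔ x.1.length = N ∧ x.2.1.length = t := by
  simp [obsOfLength]

theorem support_obsLaw_subset (θ : Θ) (t : ℕ) :
    (obsLaw M E O Tep θ t).support ⊆ obsOfLength S A E.N t := by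
  have hoff : ∀ D ∈ (M.offlineLaw E θ).support, D.length = E.N := fun D hD => by
    rw [BayesianMDP.offlineLaw, PMF.mem_support_map_iff] at hD
    obtain ⟨x, hx, rfl⟩ := hD
    exact length_of_mem_support_trajLaw hx
  intro x hx
  rw [Finset.mem_coe, mem_obsOfLength]
  rcases t with _ | t
  · rw [obsLaw, PMF.mem_support_bind_iff] at hx
    obtain ⟨D, hD, hx⟩ := hx
    rw [PMF.mem_support_map_iff] at hx
    obtain ⟨s, -, rfl⟩ := hx
    exact ⟨hoff D hD, rfl⟩
  · rw [obsLaw, PMF.mem_support_bind_iff] at hx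
    obtain ⟨y, hy, hx⟩ := hx
    rw [policyLaw, PMF.mem_support_bind_iff] at hy
    obtain ⟨D, hD, hy⟩ := hy
    rw [PMF.mem_support_map_iff] at hy
    obtain ⟨z, hz, rfl⟩ := hy
    rw [runStep, PMF.mem_support_map_iff] at hx
    obtain ⟨s', -, rfl⟩ := hx
    exact ⟨hoff D hD, by simp [length_of_mem_support_onlineLaw hz]⟩

theorem finite_support_obsLaw (θ : Θ) (t : ℕ) : (obsLaw M E O Tep θ t).support.Finite :=
  (Finset.finite_toSet _).subset (support_obsLaw_subset θ t)

/-! ### Expectations -/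

/-- The offline data are a function of the observation. -/
theorem expect_obsLaw_fst (θ : Θ) (t : ℕ) (f : History S A → ℝ) :
    expect (obsLaw M E O Tep θ t) (fun x => f x.1) = expect (M.offlineLaw E θ) f := by
  rcases t with _ | t
  · rw [obsLaw, expect_bind (finite_support_offlineLaw ..) fun _ =>
      finite_support_map _ (Set.toFinite _)]
    refine expect_congr fun D _ => ?_
    rw [expect_map (Set.toFinite _)]
    exact expect_const (c := f D) (Set.toFinite (PMF.support _))
  · rw [obsLaw, expect_bind (finite_support_policyLaw ..) fun _ => finite_support_runStep ..,
      policyLaw, expect_bind (finite_support_offlineLaw ..) fun _ =>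
        finite_support_map _ (finite_support_onlineLaw ..)]
    refine expect_congr fun D _ => ?_
    rw [expect_map (finite_support_onlineLaw ..)]
    have : ∀ y : History S A × S × (S → A),
        expect (runStep (M.P θ) y.2.2 (D, y.1, y.2.1)) (fun x => f x.1) = f D := fun y => by
      rw [runStep, expect_map (Set.toFinite _)]
      exact expect_const (c := f D) (Set.toFinite (PMF.support _))
    simp_rw [this]
    exact expect_const (finite_support_onlineLaw ..) _

/-- The history in the law of the algorithm. -/
theorem expect_onlineLaw_history (θ : Θ) (t : ℕ) (f : History S A → ℝ) :
    expect ((M.offlineLaw E θ).bind fun D => onlineLaw M E O Tep θ D t) (fun x => f x.1) =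
      expect (obsLaw M E O Tep θ t) fun x => f x.2.1 := by
  classical
  rw [expect_bind (finite_support_offlineLaw ..) fun _ => finite_support_onlineLaw ..]
  rcases t with _ | t
  · rw [obsLaw, expect_bind (finite_support_offlineLaw ..) fun _ =>
      finite_support_map _ (Set.toFinite _)]
    refine expect_congr fun D _ => ?_
    rw [onlineLaw, expect_bind (Set.toFinite _) fun _ => finite_support_map _ (Set.toFinite _),
      expect_map (Set.toFinite _)]
    refine expect_congr fun s _ => ?_
    rw [expect_map (Set.toFinite _)]
    exact expect_const (c := f []) (Set.toFinite (PMF.support _))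
  · rw [obsLaw, expect_bind (finite_support_policyLaw ..) fun _ => finite_support_runStep ..,
      policyLaw, expect_bind (finite_support_offlineLaw ..) fun _ =>
        finite_support_map _ (finite_support_onlineLaw ..)]
    refine expect_congr fun D _ => ?_
    have hfin : ∀ (x : History S A × S × (S → A)) (s' : S), (if epStart Tep (epIndex Tep (t + 1)) =
        t + 1 then (samplePolicy O (belief M E Tep D (x.1 ++ [(x.2.1, x.2.2 x.2.1, s')])
          (epIndex Tep (t + 1)))).map fun π' => (x.1 ++ [(x.2.1, x.2.2 x.2.1, s')], s', π')
        else PMF.pure (x.1 ++ [(x.2.1, x.2.2 x.2.1, s')], s', x.2.2)).support.Finite := by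
      intro x s'
      split_ifs
      · exact finite_support_map _ (Set.toFinite _)
      · exact finite_support_pure _
    rw [expect_map (finite_support_onlineLaw ..), onlineLaw,
      expect_bind (finite_support_onlineLaw ..) fun x =>
        finite_support_bind (Set.toFinite _) (hfin x)]
    refine expect_congr fun x _ => ?_
    rw [expect_bind (Set.toFinite _) (hfin x), runStep, expect_map (Set.toFinite _)]
    refine expect_congr fun s' _ => ?_
    dsimp only
    split_ifs
    · rw [expect_map (Set.toFinite _)]
      exact expect_const (c := f _) (Set.toFinite (PMF.support _))
    · rw [expect_pure]

theorem measurableSet_solve (O : Oracle M) (q : (S → A) → Prop) :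
    MeasurableSet {θ | q (O.solve θ)} := by
  have : {θ | q (O.solve θ)} = ⋃ π ∈ {π | q π}, {θ | O.solve θ = π} := by ext; simp
  rw [this]
  exact MeasurableSet.biUnion (Set.to_countable _) fun π _ => O.measurable_solve π

theorem measurable_comp_solve (O : Oracle M) {β : Type*} [MeasurableSpace β] (f : (S → A) → β) :
    Measurable fun θ => f (O.solve θ) := fun s _ =>
  measurableSet_solve O fun π => f π ∈ s

theorem expect_samplePolicy (μ : ProbabilityMeasure Θ) (f : (S → A) → ℝ) :
    expect (samplePolicy O μ) f = ∫ θ, f (O.solve θ) ∂(μ : Measure Θ) := by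
  classical
  have h1 : ∀ θ, f (O.solve θ) = ∑ π, {θ | O.solve θ = π}.indicator (fun _ => f π) θ := fun θ => by
    rw [Finset.sum_eq_single (O.solve θ)]
    · simp
    · intro π _ hne
      exact Set.indicator_of_notMem (fun h => hne (Eq.symm h)) _
    · simp
  rw [expect_fintype]
  simp_rw [h1]
  rw [integral_finsetSum]
  · refine Finset.sum_congr rfl fun π _ => ?_
    rw [integral_indicator_const _ (O.measurable_solve π)]
    rfl
  · intro π _
    exact (integrable_const _).indicator (O.measurable_solve π)

theorem expect_obsLaw_episode (hT : ∀ k, 1 ≤ k → 1 ≤ Tep k) {k : ℕ} (hk : 1 ≤ k) (θ : Θ) {n : ℕ}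
    (hn : n ≤ Tep k) (f : Obs S A → ℝ) :
    expect (obsLaw M E O Tep θ (epStart Tep k + n)) f =
      expect (obsLaw M E O Tep θ (epStart Tep k)) fun x =>
        ∫ θ', expect (run (M.P θ) (O.solve θ') n x) f ∂(obsBelief M E Tep k x : Measure Θ) := by
  rw [obsLaw_episode hT hk θ hn, expect_bind (finite_support_obsLaw ..) fun x =>
    finite_support_bind (Set.toFinite _) fun π => finite_support_run ..]
  refine expect_congr fun x _ => ?_
  rw [expect_bind (Set.toFinite _) fun π => finite_support_run .., expect_samplePolicy]

end Algorithm

/-! ### Likelihoods -/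

section Likelihood

/-- The law `K θ` has likelihood `ℓ` with respect to a reference weight independent of `θ`. -/
def HasLikelihood {Θ α : Type*} (K : Θ → PMF α) (ℓ : α → Θ → ℝ≥0∞) : Prop :=
  ∃ c : α → ℝ≥0∞, ∀ θ x, K θ x = c x * ℓ x θ

variable {Θ α β : Type*}

/-- Factorization criterion: likelihood factors multiply along a kernel, and the remaining weights,
summed over the intermediate variable, stay free of `θ`. The compatibility of the factors matters
only where the weight `d` is nonzero. -/
theorem HasLikelihood.bind {K : Θ → PMF α} {ℓ : α → Θ → ℝ≥0∞} (hK : HasLikelihood K ℓ)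
    {J : Θ → α → PMF β} {ℓ' : β → Θ → ℝ≥0∞} (d : α → β → ℝ≥0∞) (ρ : α → β → Θ → ℝ≥0∞)
    (hJ : ∀ θ x y, J θ x y = d x y * ρ x y θ)
    (hℓ : ∀ x y, d x y ≠ 0 → ∀ θ, ℓ x θ * ρ x y θ = ℓ' y θ) :
    HasLikelihood (fun θ => (K θ).bind (J θ)) ℓ' := by
  obtain ⟨c, hc⟩ := hK
  refine ⟨fun y => ∑' x, c x * d x y, fun θ y => ?_⟩
  rw [PMF.bind_apply, ← ENNReal.tsum_mul_right]
  refine tsum_congr fun x => ?_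
  rw [hc, hJ]
  by_cases h : d x y = 0
  · simp [h]
  · rw [← hℓ x y h]
    ring

theorem HasLikelihood.bind_of_hasLikelihood {K : Θ → PMF α} {ℓ : α → Θ → ℝ≥0∞}
    (hK : HasLikelihood K ℓ) {J : Θ → α → PMF β} {ℓ' : β → Θ → ℝ≥0∞} {ρ : α → β → Θ → ℝ≥0∞}
    (hJ : ∀ x, HasLikelihood (fun θ => J θ x) (ρ x))
    (hℓ : ∀ x y θ₀, J θ₀ x y ≠ 0 → ∀ θ, ℓ x θ * ρ x y θ = ℓ' y θ) :
    HasLikelihood (fun θ => (K θ).bind (J θ)) ℓ' := by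
  classical
  choose d hd using hJ
  refine hK.bind (fun x y => if ∃ θ, J θ x y ≠ 0 then d x y else 0) ρ (fun θ x y => ?_)
    fun x y h => ?_
  · split_ifs with h
    · exact hd x θ y
    · push Not at h
      rw [h, zero_mul]
  · rw [ne_eq, ite_eq_right_iff, Classical.not_imp] at h
    obtain ⟨⟨θ₀, h0⟩, -⟩ := h
    exact hℓ x y θ₀ h0

theorem hasLikelihood_const (p : PMF α) : HasLikelihood (fun _ : Θ => p) fun _ _ => 1 :=
  ⟨p, fun _ _ => by simp⟩

theorem hasLikelihood_self {K : Θ → PMF α} : HasLikelihood K fun x θ => K θ x :=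
  ⟨1, fun _ _ => by simp⟩

theorem HasLikelihood.map {K : Θ → PMF α} {ℓ : α → Θ → ℝ≥0∞} (hK : HasLikelihood K ℓ)
    (f : α → β) {ℓ' : β → Θ → ℝ≥0∞} (h : ∀ x θ, ℓ x θ = ℓ' (f x) θ) :
    HasLikelihood (fun θ => (K θ).map f) ℓ' := by
  refine hK.bind_of_hasLikelihood (fun x => hasLikelihood_const (PMF.pure (f x))) ?_
  intro x y θ₀ hy θ
  rw [Function.comp_apply, PMF.pure_apply] at hy
  have : y = f x := by by_contra hne; simp [hne] at hy
  rw [mul_one, h, this]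

end Likelihood

/-! ### The beliefs of the algorithm are exact posteriors -/

section Algorithm

variable {S A Θ : Type*} [Fintype S] [Fintype A] [MeasurableSpace Θ] [Nonempty A]
variable {M : BayesianMDP S A Θ} {E : Expert S} {O : Oracle M} {Tep : ℕ → ℕ}

namespace BayesianMDP

theorem onlineLik_append (M : BayesianMDP S A Θ) (h h' : History S A) (θ : Θ) :
    M.onlineLik (h ++ h') θ = M.onlineLik h θ * M.onlineLik h' θ := by
  simp [onlineLik]

theorem offlineLik_append (M : BayesianMDP S A Θ) (E : Expert S) (h h' : History S A) (θ : Θ) :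
    M.offlineLik E (h ++ h') θ = M.offlineLik E h θ * M.offlineLik E h' θ := by
  simp [offlineLik]

theorem measurable_onlineLik (M : BayesianMDP S A Θ) (h : History S A) :
    Measurable (M.onlineLik h) := by
  induction h with
  | nil => exact measurable_const
  | cons x h ih =>
    have := (M.measurable_P x.1 x.2.1 x.2.2).mul ih
    convert this using 1
    funext θ
    simp [onlineLik]

theorem measurable_offlineLik (M : BayesianMDP S A Θ) (hP : ∀ θ, Communicating (M.P θ))
    (E : Expert S) (h : History S A) : Measurable (M.offlineLik E h) := by
  induction h with
  | nil => exact measurable_const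
  | cons x h ih =>
    have := ((M.measurable_P x.1 x.2.1 x.2.2).mul (M.measurable_expertPolicy hP E x.1 x.2.1)).mul ih
    convert this using 1
    funext θ
    simp [offlineLik]

theorem onlineLik_le_one (M : BayesianMDP S A Θ) (h : History S A) (θ : Θ) :
    M.onlineLik h θ ≤ 1 := by
  induction h with
  | nil => exact le_rfl
  | cons x h ih =>
    rw [onlineLik, List.map_cons, List.prod_cons]
    exact mul_le_one' (PMF.coe_le_one _ _) ih

theorem offlineLik_le_one (M : BayesianMDP S A Θ) (E : Expert S) (h : History S A) (θ : Θ) :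
    M.offlineLik E h θ ≤ 1 := by
  induction h with
  | nil => exact le_rfl
  | cons x h ih =>
    rw [offlineLik, List.map_cons, List.prod_cons]
    exact mul_le_one' (mul_le_one' (PMF.coe_le_one _ _) (PMF.coe_le_one _ _)) ih

end BayesianMDP

theorem hasLikelihood_offlineLaw (M : BayesianMDP S A Θ) (E : Expert S) :
    HasLikelihood (M.offlineLaw E) (M.offlineLik E) := by
  have htraj : ∀ t, HasLikelihood
      (fun θ => trajLaw (M.P θ) (fun _ => M.expertPolicy E θ) (PMF.pure E.init) t)
      fun x θ => M.offlineLik E x.1 θ := by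
    intro t
    induction t with
    | zero =>
      exact (hasLikelihood_const (PMF.pure E.init)).map (fun s => (([] : History S A), s))
        fun x θ => by simp [BayesianMDP.offlineLik]
    | succ t ih =>
      refine ih.bind_of_hasLikelihood (ρ := fun x y θ =>
        M.offlineLik E (y.1.drop x.1.length) θ) (fun x => ?_) ?_
      · refine hasLikelihood_self.bind_of_hasLikelihood (ρ := fun a y θ => M.P θ x.2 a y.2)
          (fun a => hasLikelihood_self.map _ fun _ _ => rfl) ?_
        intro a y θ₀ hy θ
        rw [← PMF.mem_support_iff, PMF.mem_support_map_iff] at hy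
        obtain ⟨s', -, rfl⟩ := hy
        simp [BayesianMDP.offlineLik, mul_comm]
      · intro x y θ₀ hy θ
        rw [← PMF.mem_support_iff, PMF.mem_support_bind_iff] at hy
        obtain ⟨a, -, hy⟩ := hy
        rw [PMF.mem_support_map_iff] at hy
        obtain ⟨s', -, rfl⟩ := hy
        rw [M.offlineLik_append, List.drop_left]
  exact (htraj E.N).map Prod.fst fun _ _ => rfl

/-- Given the data, the draw of a policy does not involve the true parameter. Its probability goes
into the reference weight and only transitions enter the likelihood. -/
theorem hasLikelihood_onlineLaw (M : BayesianMDP S A Θ) (E : Expert S) (O : Oracle M) (Tep : ℕ → ℕ)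
    (D : History S A) (t : ℕ) :
    HasLikelihood (fun θ => onlineLaw M E O Tep θ D t) fun x θ => M.onlineLik x.1 θ := by
  classical
  induction t with
  | zero =>
    simp only [onlineLaw]
    refine ((hasLikelihood_const (Θ := Θ) M.ν).bind_of_hasLikelihood
      (fun s => hasLikelihood_const _) ?_)
    intro s y θ₀ hy θ
    rw [← PMF.mem_support_iff, PMF.mem_support_map_iff] at hy
    obtain ⟨π, -, rfl⟩ := hy
    simp [BayesianMDP.onlineLik]
  | succ t ih =>
    have hsupp : ∀ (x : History S A × S × (S → A)) (s' : S) (y : History S A × S × (S → A)),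
        y ∈ (if epStart Tep (epIndex Tep (t + 1)) = t + 1 then
          (samplePolicy O (belief M E Tep D (x.1 ++ [(x.2.1, x.2.2 x.2.1, s')])
            (epIndex Tep (t + 1)))).map fun π' => (x.1 ++ [(x.2.1, x.2.2 x.2.1, s')], s', π')
        else PMF.pure (x.1 ++ [(x.2.1, x.2.2 x.2.1, s')], s', x.2.2)).support →
        y.1 = x.1 ++ [(x.2.1, x.2.2 x.2.1, s')] ∧ y.2.1 = s' := by
      intro x s' y hy
      split_ifs at hy
      · rw [PMF.mem_support_map_iff] at hy
        obtain ⟨π, -, rfl⟩ := hy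
        exact ⟨rfl, rfl⟩
      · rw [PMF.support_pure, Set.mem_singleton_iff] at hy
        rw [hy]
        exact ⟨rfl, rfl⟩
    refine ih.bind_of_hasLikelihood (ρ := fun x y θ =>
        M.onlineLik (y.1.drop x.1.length) θ) (fun x => ?_) ?_
    · refine hasLikelihood_self.bind_of_hasLikelihood (fun s' => hasLikelihood_const _) ?_
      intro s' y θ₀ hy θ
      obtain ⟨h1, -⟩ := hsupp x s' y ((PMF.mem_support_iff _ _).2 hy)
      rw [h1, List.drop_left]
      simp [BayesianMDP.onlineLik]
    · intro x y θ₀ hy θ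
      rw [← PMF.mem_support_iff, PMF.mem_support_bind_iff] at hy
      obtain ⟨s', -, hy⟩ := hy
      obtain ⟨h1, -⟩ := hsupp x s' y hy
      rw [h1, List.drop_left, M.onlineLik_append]

theorem hasLikelihood_obsLaw (M : BayesianMDP S A Θ) (E : Expert S) (O : Oracle M) (Tep : ℕ → ℕ)
    (t : ℕ) : HasLikelihood (fun θ => obsLaw M E O Tep θ t)
      fun x θ => M.offlineLik E x.1 θ * M.onlineLik x.2.1 θ := by
  rcases t with _ | t
  · refine (hasLikelihood_offlineLaw M E).bind_of_hasLikelihood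
      (fun D => hasLikelihood_const _) ?_
    intro D y θ₀ hy θ
    rw [← PMF.mem_support_iff, PMF.mem_support_map_iff] at hy
    obtain ⟨s, -, rfl⟩ := hy
    simp [BayesianMDP.onlineLik]
  · have h1 : HasLikelihood (fun θ => policyLaw M E O Tep θ t)
        fun y θ => M.offlineLik E y.1.1 θ * M.onlineLik y.1.2.1 θ := by
      refine (hasLikelihood_offlineLaw M E).bind_of_hasLikelihood
        (fun D => (hasLikelihood_onlineLaw M E O Tep D t).map _
          (ℓ' := fun y θ => M.onlineLik y.1.2.1 θ) fun x θ => rfl) ?_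
      intro D y θ₀ hy θ
      rw [← PMF.mem_support_iff, PMF.mem_support_map_iff] at hy
      obtain ⟨s, -, rfl⟩ := hy
      rfl
    refine h1.bind_of_hasLikelihood (J := fun θ y => runStep (M.P θ) y.2 y.1)
      (ρ := fun x y θ => M.onlineLik (y.2.1.drop x.1.2.1.length) θ)
      (fun x => hasLikelihood_self.map _ fun s' θ => ?_) ?_
    · rw [List.drop_left]
      simp [BayesianMDP.onlineLik]
    · intro x y θ₀ hy θ
      rw [← PMF.mem_support_iff, runStep, PMF.mem_support_map_iff] at hy
      obtain ⟨s', -, rfl⟩ := hy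
      rw [List.drop_left, M.onlineLik_append]
      ring

/-- Updating episode by episode multiplies the likelihoods of consecutive stretches of the history,
so the batches combine into a single update. Proportionality is all that `IsPosterior` asks for. -/
theorem exists_withDensity_eq_smul_belief (hP : ∀ θ, Communicating (M.P θ)) (D h : History S A)
    (k : ℕ) : ∃ z : ℝ≥0∞, (M.prior : Measure Θ).withDensity
      (fun θ => M.offlineLik E D θ * M.onlineLik (h.take (epStart Tep (k + 1))) θ) =
        z • (belief M E Tep D h (k + 1) : Measure Θ) := by
  have hfin : ∀ (μ : ProbabilityMeasure Θ) (L : Θ → ℝ≥0∞), (∀ θ, L θ ≤ 1) →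
      ∫⁻ θ, L θ ∂(μ : Measure Θ) ≠ ∞ := fun μ L hL =>
    ((lintegral_mono hL).trans_lt (by simp)).ne
  induction k with
  | zero =>
    refine ⟨_, Eq.trans ?_ (withDensity_eq_smul_bayesUpdate M.prior
      (M.measurable_offlineLik hP E D) (hfin _ _ fun θ => M.offlineLik_le_one E D θ))⟩
    simp [epStart_one, BayesianMDP.onlineLik]
  | succ k ih =>
    obtain ⟨z, hz⟩ := ih
    set L := M.onlineLik ((h.drop (epStart Tep (k + 1))).take (Tep (k + 1))) with hL
    have hLm : Measurable L := M.measurable_onlineLik _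
    have h1 := withDensity_eq_smul_bayesUpdate (belief M E Tep D h (k + 1)) hLm
      (hfin _ _ fun θ => M.onlineLik_le_one _ θ)
    have h2 : (fun θ => M.offlineLik E D θ * M.onlineLik (h.take (epStart Tep (k + 1 + 1))) θ) =
        (fun θ => M.offlineLik E D θ * M.onlineLik (h.take (epStart Tep (k + 1))) θ) * L := by
      funext θ
      rw [epStart_succ Tep (by omega), List.take_add, M.onlineLik_append, Pi.mul_apply, hL, mul_assoc]
    have hm : Measurable fun θ =>
        M.offlineLik E D θ * M.onlineLik (h.take (epStart Tep (k + 1))) θ :=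
      (M.measurable_offlineLik hP E D).mul (M.measurable_onlineLik _)
    rw [h2, withDensity_mul _ hm hLm, hz, withDensity_smul_measure, h1, smul_smul]
    exact ⟨_, rfl⟩

/-- The belief at the start of an episode is the posterior given the data. -/
theorem isPosterior_obsBelief (hP : ∀ θ, Communicating (M.P θ)) {k : ℕ} (hk : 1 ≤ k) :
    IsPosterior M.prior (fun θ => obsLaw M E O Tep θ (epStart Tep k))
      (obsOfLength S A E.N (epStart Tep k)) (obsBelief M E Tep k) := by
  obtain ⟨c, hc⟩ := hasLikelihood_obsLaw M E O Tep (epStart Tep k)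
  have hmeas : ∀ x : Obs S A, Measurable fun θ => M.offlineLik E x.1 θ * M.onlineLik x.2.1 θ :=
    fun x => (M.measurable_offlineLik hP E _).mul (M.measurable_onlineLik _)
  refine ⟨fun x => ?_, fun θ => support_obsLaw_subset θ _, fun x => ?_⟩
  · simp_rw [hc]
    exact (hmeas x).const_mul _
  · by_cases hx : x ∈ obsOfLength S A E.N (epStart Tep k)
    · obtain ⟨j, rfl⟩ := Nat.exists_eq_add_of_le' hk
      obtain ⟨z, hz⟩ := exists_withDensity_eq_smul_belief (E := E) (Tep := Tep) hP x.1 x.2.1 j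
      rw [List.take_of_length_le (mem_obsOfLength.1 hx).2.le] at hz
      refine ⟨c x * z, ?_⟩
      have : (fun θ => obsLaw M E O Tep θ (epStart Tep (j + 1)) x) =
          c x • fun θ => M.offlineLik E x.1 θ * M.onlineLik x.2.1 θ := by
        funext θ
        rw [hc]
        rfl
      rw [this, withDensity_smul _ (hmeas x), hz, smul_smul]
      rfl
    -- Data of any other length have probability zero under every parameter.
    · refine ⟨0, ?_⟩
      have : (fun θ => obsLaw M E O Tep θ (epStart Tep k) x) = 0 := by
        funext θ
        by_contra h0
        exact hx (support_obsLaw_subset θ _ ((PMF.mem_support_iff _ _).2 h0))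
      rw [this, withDensity_zero, zero_smul]

end Algorithm

/-! ### Self-normalized concentration by the method of mixtures -/

section Mixture

theorem integrable_exp_linear_sub_sq {m : ℝ} (hm : 0 < m) (a : ℝ) :
    Integrable fun x : ℝ => Real.exp (a * x - m * x ^ 2 / 2) := by
  have h := ((integrable_exp_neg_mul_sq (half_pos hm)).comp_sub_right (a / m)).const_mul
    (Real.exp (a ^ 2 / (2 * m)))
  refine h.congr (Eventually.of_forall fun x => ?_)
  dsimp only
  rw [← Real.exp_add]
  congr 1
  field_simp
  ring

theorem integral_exp_linear_sub_sq {m : ℝ} (hm : 0 < m) (a : ℝ) :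
    ∫ x : ℝ, Real.exp (a * x - m * x ^ 2 / 2) =
      √(2 * Real.pi / m) * Real.exp (a ^ 2 / (2 * m)) := by
  have h1 : ∀ x : ℝ, Real.exp (a * x - m * x ^ 2 / 2) =
      Real.exp (a ^ 2 / (2 * m)) * Real.exp (-(m / 2) * (x - a / m) ^ 2) := fun x => by
    rw [← Real.exp_add]
    congr 1
    field_simp
    ring
  simp_rw [h1]
  rw [integral_const_mul, integral_sub_right_eq_self (fun x => Real.exp (-(m / 2) * x ^ 2)),
    integral_gaussian, mul_comm]
  congr 2
  field_simp

/-- Hoeffding's lemma for a finitely supported law. -/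
theorem expect_exp_le {S : Type*} [Fintype S] (p : PMF S) {σ : S → ℝ} (hσ : ∀ s, |σ s| ≤ 1)
    (l : ℝ) : expect p (fun s => Real.exp (l * (σ s - expect p σ))) ≤ Real.exp (l ^ 2 / 2) := by
  let _ : MeasurableSpace S := ⊤
  have hint : ∀ f : S → ℝ, ∫ s, f s ∂p.toMeasure = expect p f := fun f => by
    rw [PMF.integral_eq_sum, expect_fintype]
    rfl
  have h := (ProbabilityTheory.hasSubgaussianMGF_of_mem_Icc (μ := p.toMeasure) (X := σ)
    (a := -1) (b := 1) measurable_from_top.aemeasurable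
    (Eventually.of_forall fun s => abs_le.1 (hσ s))).mgf_le l
  rw [ProbabilityTheory.mgf, hint, hint] at h
  refine h.trans (le_of_eq ?_)
  congr 1
  norm_num

/-- The normalized Gaussian mixture of the exponential martingales. -/
def mixture (N : ℕ) (d : ℝ) : ℝ := Real.exp (d ^ 2 / (2 * (N + 1))) / √(N + 1)

theorem mixture_pos (N : ℕ) (d : ℝ) : 0 < mixture N d := by unfold mixture; positivity

theorem mixture_eq (N : ℕ) (d : ℝ) :
    mixture N d = (√(2 * Real.pi))⁻¹ * ∫ x : ℝ, Real.exp (d * x - (N + 1) * x ^ 2 / 2) := by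
  rw [integral_exp_linear_sub_sq (by positivity), mixture, Real.sqrt_div' _ (by positivity)]
  have : √(2 * Real.pi) ≠ 0 := by positivity
  field_simp

/-- For each fixed slope `x`, Hoeffding's lemma makes the exponential a supermartingale, and
integrating over a Gaussian slope preserves this. The mixture adapts to the random number of visits,
so no union bound over visit counts is needed. -/
theorem expect_mixture_le {S : Type*} [Fintype S] (p : PMF S) {σ : S → ℝ} (hσ : ∀ s, |σ s| ≤ 1)
    (N : ℕ) (d : ℝ) :
    expect p (fun s => mixture (N + 1) (d + (σ s - expect p σ))) ≤ mixture N d := by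
  simp_rw [mixture_eq]
  rw [expect_const_mul]
  refine mul_le_mul_of_nonneg_left ?_ (by positivity)
  have hi : ∀ s, Integrable fun x : ℝ => Real.exp ((d + (σ s - expect p σ)) * x -
      (((N + 1 : ℕ) : ℝ) + 1) * x ^ 2 / 2) := fun s =>
    integrable_exp_linear_sub_sq (by positivity) _
  rw [expect_fintype]
  simp_rw [← integral_const_mul]
  rw [← integral_finsetSum _ fun s _ => (hi s).const_mul _]
  refine integral_mono (integrable_finsetSum _ fun s _ => (hi s).const_mul _)
    (integrable_exp_linear_sub_sq (by positivity) _) fun x => ?_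
  have h := mul_le_mul_of_nonneg_left (expect_exp_le p hσ x)
    (Real.exp_pos (d * x - (((N + 1 : ℕ) : ℝ) + 1) * x ^ 2 / 2)).le
  rw [← expect_const_mul, expect_fintype] at h
  refine (le_of_eq ?_).trans (h.trans (le_of_eq ?_))
  · refine Finset.sum_congr rfl fun s _ => ?_
    rw [← Real.exp_add]
    congr 2
    ring
  · rw [← Real.exp_add]
    congr 1
    push_cast
    ring

end Mixture

/-! ### Empirical deviations along a history -/

section Deviation

variable {S A : Type*}

open Classical in
/-- Number of visits to a state-action pair. -/
def visits (h : History S A) (s : S) (a : A) : ℕ := h.countP fun x => x.1 = s ∧ x.2.1 = a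

open Classical in
/-- Sum of the centred values of `σ` at the successors of a state-action pair. -/
def deviation (P : S → A → PMF S) (h : History S A) (s : S) (a : A) (σ : S → ℝ) : ℝ :=
  (h.map fun x => if x.1 = s ∧ x.2.1 = a then σ x.2.2 - expect (P s a) σ else 0).sum

theorem visits_append_self (h : History S A) (s : S) (a : A) (s' : S) :
    visits (h ++ [(s, a, s')]) s a = visits h s a + 1 := by
  simp [visits]

theorem visits_append_ne (h : History S A) {s t : S} {a b : A} (s' : S)
    (hne : ¬ (t = s ∧ b = a)) : visits (h ++ [(t, b, s')]) s a = visits h s a := by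
  simp only [visits, List.countP_append, List.countP_cons, List.countP_nil]
  simp [hne]

theorem visits_le_length (h : History S A) (s : S) (a : A) : visits h s a ≤ h.length :=
  List.countP_le_length

theorem deviation_append_self (P : S → A → PMF S) (h : History S A) (s : S) (a : A) (s' : S)
    (σ : S → ℝ) : deviation P (h ++ [(s, a, s')]) s a σ =
      deviation P h s a σ + (σ s' - expect (P s a) σ) := by
  simp [deviation]

theorem deviation_append_ne (P : S → A → PMF S) (h : History S A) {s t : S} {a b : A} (s' : S)
    (hne : ¬ (t = s ∧ b = a)) (σ : S → ℝ) :
    deviation P (h ++ [(t, b, s')]) s a σ = deviation P h s a σ := by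
  simp [deviation, hne]

/-- The observed successors are the same on both sides and cancel, leaving only the two means. This
is how one data set compares two transition laws. -/
theorem deviation_sub (P P' : S → A → PMF S) (h : History S A) (s : S) (a : A) (σ : S → ℝ) :
    deviation P h s a σ - deviation P' h s a σ =
      visits h s a * (expect (P' s a) σ - expect (P s a) σ) := by
  induction h with
  | nil => simp [deviation, visits]
  | cons x h ih =>
    simp only [deviation, visits, List.map_cons, List.sum_cons, List.countP_cons] at ih ⊢
    by_cases hx : x.1 = s ∧ x.2.1 = a
    · simp only [hx, and_self, decide_true, if_true]
      push_cast
      linarith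
    · simp only [hx, decide_false, if_false, zero_add, Bool.false_eq_true, add_zero]
      exact ih

open Classical in
theorem abs_deviation_le [Fintype S] (P : S → A → PMF S) (h : History S A) (s : S) (a : A)
    {σ : S → ℝ} (hσ : ∀ s, |σ s| ≤ 1) : |deviation P h s a σ| ≤ 2 * h.length := by
  have he : |expect (P s a) σ| ≤ 1 := abs_expect_le (Set.toFinite _) fun s _ => hσ s
  induction h with
  | nil => simp [deviation]
  | cons x h ih =>
    simp only [deviation, List.map_cons, List.sum_cons, List.length_cons] at ih ⊢
    refine (abs_add_le _ _).trans ?_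
    have : |if x.1 = s ∧ x.2.1 = a then σ x.2.2 - expect (P s a) σ else 0| ≤ 2 := by
      split_ifs
      · exact (abs_sub _ _).trans (by linarith [hσ x.2.2])
      · simp
    push_cast
    linarith

/-- The test function of a sign pattern. -/
def signVal (σ : S → Bool) (s : S) : ℝ := if σ s then 1 else -1

theorem abs_signVal_le (σ : S → Bool) (s : S) : |signVal σ s| ≤ 1 := by
  unfold signVal
  split_ifs <;> simp

variable [Fintype S] [Fintype A]

open Classical in
/-- Sum of the mixtures over all state-action pairs and all sign patterns. -/
def totalMixture (P : S → A → PMF S) (h : History S A) : ℝ :=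
  ∑ s, ∑ a, ∑ σ : S → Bool, mixture (visits h s a) (deviation P h s a (signVal σ))

theorem totalMixture_nonneg (P : S → A → PMF S) (h : History S A) : 0 ≤ totalMixture P h :=
  Finset.sum_nonneg fun _ _ => Finset.sum_nonneg fun _ _ => Finset.sum_nonneg fun _ _ =>
    (mixture_pos _ _).le

theorem totalMixture_nil (P : S → A → PMF S) :
    totalMixture P ([] : History S A) = Fintype.card S * Fintype.card A * 2 ^ Fintype.card S := by
  classical
  simp [totalMixture, mixture, visits, deviation, mul_assoc]

theorem mixture_le_totalMixture (P : S → A → PMF S) (h : History S A) (s : S) (a : A)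
    (σ : S → Bool) :
    mixture (visits h s a) (deviation P h s a (signVal σ)) ≤ totalMixture P h := by
  classical
  refine (Finset.single_le_sum (f := fun σ : S → Bool =>
    mixture (visits h s a) (deviation P h s a (signVal σ)))
    (fun _ _ => (mixture_pos _ _).le) (Finset.mem_univ σ)).trans ?_
  refine (Finset.single_le_sum (f := fun a => ∑ σ : S → Bool,
    mixture (visits h s a) (deviation P h s a (signVal σ)))
    (fun _ _ => Finset.sum_nonneg fun _ _ => (mixture_pos _ _).le) (Finset.mem_univ a)).trans ?_
  exact Finset.single_le_sum (f := fun s => ∑ a, ∑ σ : S → Bool,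
    mixture (visits h s a) (deviation P h s a (signVal σ)))
    (fun _ _ => Finset.sum_nonneg fun _ _ => Finset.sum_nonneg fun _ _ => (mixture_pos _ _).le)
    (Finset.mem_univ s)

theorem expect_runStep (P : S → A → PMF S) (π : S → A) (x : Obs S A) (f : Obs S A → ℝ) :
    expect (runStep P π x) f = expect (P x.2.2 (π x.2.2)) fun s' =>
      f (x.1, x.2.1 ++ [(x.2.2, π x.2.2, s')], s') := by
  rw [runStep, expect_map (Set.toFinite _)]

/-- A step changes only the summands of the pair just visited, and their expectation does not
increase, whichever policy chose the pair. -/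
theorem expect_runStep_totalMixture_le (P : S → A → PMF S) (π : S → A) (x : Obs S A) :
    expect (runStep P π x) (fun y => totalMixture P y.2.1) ≤ totalMixture P x.2.1 := by
  classical
  rw [expect_runStep]
  simp only [totalMixture]
  rw [expect_sum (Set.toFinite _)]
  refine Finset.sum_le_sum fun s _ => ?_
  rw [expect_sum (Set.toFinite _)]
  refine Finset.sum_le_sum fun a _ => ?_
  rw [expect_sum (Set.toFinite _)]
  refine Finset.sum_le_sum fun σ _ => ?_
  by_cases h : x.2.2 = s ∧ π x.2.2 = a
  · obtain ⟨rfl, rfl⟩ := h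
    simp_rw [visits_append_self, deviation_append_self]
    exact expect_mixture_le _ (abs_signVal_le σ) _ _
  · simp_rw [visits_append_ne _ _ h, deviation_append_ne P _ _ h]
    rw [expect_const (Set.toFinite _)]

variable [Nonempty A]

/-- If a function gains at least `c` at each step in expectation, it gains at least `m c` in `m`
steps. -/
theorem mul_le_expect_run_sub {P : S → A → PMF S} {π : S → A} {x : Obs S A} {f : Obs S A → ℝ}
    {c : ℝ} {m : ℕ} (h : ∀ n < m, ∀ y ∈ (run P π n x).support, c ≤ expect (runStep P π y) f - f y) :
    m * c ≤ expect (run P π m x) f - f x := by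
  induction m with
  | zero => simp [run, expect_pure]
  | succ m ih =>
    have ih := ih fun n hn => h n (hn.trans (Nat.lt_succ_self m))
    have hf := finite_support_run P π m x
    have h1 := le_expect hf (h m (Nat.lt_succ_self m))
    rw [expect_sub hf, ← expect_bind hf fun y => finite_support_runStep P π y] at h1
    rw [run]
    push_cast
    linarith

theorem expect_run_totalMixture_le (P : S → A → PMF S) (π : S → A) (n : ℕ) (x : Obs S A) :
    expect (run P π n x) (fun y => totalMixture P y.2.1) ≤ totalMixture P x.2.1 := by
  have h := mul_le_expect_run_sub (P := P) (π := π) (x := x) (m := n) (c := 0)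
    (f := fun y => (-1) * totalMixture P y.2.1) fun k _ y _ => by
      rw [expect_const_mul]
      linarith [expect_runStep_totalMixture_le P π y]
  rw [expect_const_mul] at h
  linarith

end Deviation

/-! ### Distance between transition laws -/

section Distance

variable {S A : Type*} [Fintype S] [Fintype A]

/-- The `ℓ¹` distance of two laws. -/
def lOneDist (p q : PMF S) : ℝ := ∑ s, |(p s).toReal - (q s).toReal|

theorem expect_sub_expect_le (p q : PMF S) {f : S → ℝ} {c : ℝ} (hf : ∀ s, |f s| ≤ c) :
    expect p f - expect q f ≤ c * lOneDist p q := by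
  rw [expect_fintype, expect_fintype, ← Finset.sum_sub_distrib, lOneDist, Finset.mul_sum]
  refine Finset.sum_le_sum fun s _ => ?_
  rw [← sub_mul]
  refine (le_abs_self _).trans ?_
  rw [abs_mul, mul_comm]
  exact mul_le_mul_of_nonneg_right (hf s) (abs_nonneg _)

theorem sum_toReal_eq_one (p : PMF S) : ∑ s, (p s).toReal = 1 := by
  simpa [expect_fintype] using expect_const (p := p) (Set.toFinite _) 1

theorem lOneDist_le_two (p q : PMF S) : lOneDist p q ≤ 2 := by
  calc lOneDist p q ≤ ∑ s, ((p s).toReal + (q s).toReal) :=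
        Finset.sum_le_sum fun s _ => (abs_sub _ _).trans_eq (by
          rw [abs_of_nonneg ENNReal.toReal_nonneg, abs_of_nonneg ENNReal.toReal_nonneg])
    _ = 2 := by rw [Finset.sum_add_distrib, sum_toReal_eq_one, sum_toReal_eq_one]; norm_num

theorem exists_sign_lOneDist_eq (p q : PMF S) :
    ∃ σ : S → Bool, lOneDist p q = expect p (signVal σ) - expect q (signVal σ) := by
  refine ⟨fun s => decide ((q s).toReal ≤ (p s).toReal), ?_⟩
  rw [expect_fintype, expect_fintype, ← Finset.sum_sub_distrib, lOneDist]
  refine Finset.sum_congr rfl fun s _ => ?_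
  rw [← sub_mul, signVal]
  by_cases h : (q s).toReal ≤ (p s).toReal
  · simp [h]
  · simp [h, abs_of_nonpos (sub_nonpos.2 (not_le.1 h).le)]

/-- Upper bound on the squared normalized deviations, with free parameters `B` and `T`. -/
def width (P : S → A → PMF S) (B : ℝ) (T : ℕ) (h : History S A) : ℝ :=
  2 * (B⁻¹ * totalMixture P h + Real.log B - 1) + Real.log (T + 1)

/-- Since each mixture is at most the total, a logarithm bounds the squared deviation. The logarithm
of the total is then replaced by its tangent at `B`; `width` is thereby affine in `totalMixture`,
and expectations pass through it without Jensen's inequality. -/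
theorem deviation_sq_le (P : S → A → PMF S) {B : ℝ} (hB : 0 < B) {T : ℕ} {h : History S A}
    (hT : h.length ≤ T) (s : S) (a : A) (σ : S → Bool) :
    deviation P h s a (signVal σ) ^ 2 ≤ (visits h s a + 1) * width P B T h := by
  have h1 := mixture_le_totalMixture P h s a σ
  set N := visits h s a with hN
  set d := deviation P h s a (signVal σ) with hd
  have hpos := mixture_pos N d
  have h2 := Real.log_le_log hpos h1
  have hN1 : (0 : ℝ) < N + 1 := by positivity
  rw [mixture, Real.log_div (Real.exp_pos _).ne' (Real.sqrt_pos.2 hN1).ne', Real.log_exp,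
    Real.log_sqrt hN1.le] at h2
  have h3 : Real.log (totalMixture P h) ≤ B⁻¹ * totalMixture P h + Real.log B - 1 := by
    have hL : 0 < totalMixture P h := hpos.trans_le h1
    have := Real.log_le_sub_one_of_pos (mul_pos (inv_pos.2 hB) hL)
    rw [Real.log_mul (inv_pos.2 hB).ne' hL.ne', Real.log_inv] at this
    linarith
  have h4 : Real.log ((N : ℝ) + 1) ≤ Real.log (T + 1) := by
    refine Real.log_le_log hN1 ?_
    have : N ≤ T := (visits_le_length h s a).trans hT
    exact_mod_cast Nat.succ_le_succ this
  have h5 : d ^ 2 / (2 * (N + 1)) ≤ width P B T h / 2 := by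
    unfold width
    linarith
  rw [div_le_iff₀ (by positivity)] at h5
  linarith

/-- For the sign pattern realizing the distance, the visit count times the distance is a difference
of two deviations. AM-GM with weight `η` separates width from visit count, so that the two can be
summed independently over time. -/
theorem lOneDist_le_of_visits (P P' : S → A → PMF S) {B : ℝ} (hB : 0 < B) {T : ℕ}
    {h : History S A} (hT : h.length ≤ T) (s : S) (a : A) {η : ℝ} (hη : 0 < η)
    (hN : 0 < visits h s a) :
    lOneDist (P' s a) (P s a) ≤ η / 2 * (width P B T h + width P' B T h) +
      2 / (η * visits h s a) := by
  obtain ⟨σ, hσ⟩ := exists_sign_lOneDist_eq (P' s a) (P s a)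
  have h1 := deviation_sub P P' h s a (signVal σ)
  rw [← hσ] at h1
  have h2 := deviation_sq_le P hB hT s a σ
  have h3 := deviation_sq_le P' hB hT s a σ
  set N := visits h s a
  set d := deviation P h s a (signVal σ)
  set d' := deviation P' h s a (signVal σ)
  have hN0 : (0 : ℝ) < N := by exact_mod_cast hN
  have hN1 : (1 : ℝ) ≤ N := by exact_mod_cast hN
  have key : ∀ e w : ℝ, e ^ 2 ≤ (N + 1) * w → |e| ≤ N * (η / 2 * w + 1 / (η * N)) := by
    intro e w hw
    have hw' : e ^ 2 / (N + 1) ≤ w := by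
      rw [div_le_iff₀ (by positivity)]
      linarith
    have hamgm : |e| ≤ η * N / 2 * (e ^ 2 / (N + 1)) + (N + 1) / (2 * η * N) := by
      rw [← sq_abs e]
      have : 0 ≤ (η * N * |e| - (N + 1)) ^ 2 / (2 * η * N * (N + 1)) := by positivity
      have heq : (η * N * |e| - (N + 1)) ^ 2 / (2 * η * N * (N + 1)) =
          η * N / 2 * (|e| ^ 2 / (N + 1)) + (N + 1) / (2 * η * N) - |e| := by
        field_simp
        ring
      linarith
    have h5 : (N + 1) / (2 * η * N) ≤ N * (1 / (η * N)) := by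
      rw [mul_one_div, div_le_div_iff₀ (by positivity) (by positivity)]
      have : 0 < η * N := by positivity
      nlinarith
    have h6 := mul_le_mul_of_nonneg_left hw' (by positivity : 0 ≤ η * N / 2)
    linarith
  have h4 := key d _ h2
  have h5 := key d' _ h3
  have h6 : N * lOneDist (P' s a) (P s a) ≤
      N * (η / 2 * (width P B T h + width P' B T h) + 2 / (η * N)) := by
    have e1 := le_abs_self d
    have e2 := neg_abs_le d'
    have e3 : 2 / (η * (N : ℝ)) = 1 / (η * N) + 1 / (η * N) := by ring
    rw [← h1, e3]
    nlinarith
  exact le_of_mul_le_mul_left h6 hN0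

end Distance

/-! ### A potential that counts visits -/

section Potential

variable {S A : Type*} [Fintype S] [Fintype A]

/-- Sum over all visits along a history of a weight depending on the number of earlier visits. -/
def potential (g : ℕ → ℝ) (h : History S A) : ℝ :=
  ∑ s, ∑ a, ∑ j ∈ Finset.range (visits h s a), g j

theorem potential_append (g : ℕ → ℝ) (h : History S A) (s : S) (a : A) (s' : S) :
    potential g (h ++ [(s, a, s')]) = potential g h + g (visits h s a) := by
  classical
  have h1 : ∀ t b, ∑ j ∈ Finset.range (visits (h ++ [(s, a, s')]) t b), g j =
      ∑ j ∈ Finset.range (visits h t b), g j +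
        if s = t then (if a = b then g (visits h s a) else 0) else 0 := by
    intro t b
    by_cases hst : s = t ∧ a = b
    · obtain ⟨rfl, rfl⟩ := hst
      rw [visits_append_self, Finset.sum_range_succ]
      simp
    · rw [visits_append_ne _ _ hst]
      by_cases hs : s = t
      · have ha : a ≠ b := fun ha => hst ⟨hs, ha⟩
        simp [hs, ha]
      · simp [hs]
  simp only [potential, h1, Finset.sum_add_distrib]
  simp

theorem potential_nil (g : ℕ → ℝ) : potential g ([] : History S A) = 0 := by
  simp [potential, visits]

theorem potential_le {g : ℕ → ℝ} (hg : ∀ j, 0 ≤ g j) {h : History S A} {T : ℕ}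
    (hT : h.length ≤ T) :
    potential g h ≤ Fintype.card S * Fintype.card A * ∑ j ∈ Finset.range T, g j := by
  have h1 : ∀ s a, ∑ j ∈ Finset.range (visits h s a), g j ≤ ∑ j ∈ Finset.range T, g j :=
    fun s a => Finset.sum_le_sum_of_subset_of_nonneg
      (Finset.range_subset_range.2 ((visits_le_length h s a).trans hT)) fun j _ _ => hg j
  refine (Finset.sum_le_sum fun s _ => Finset.sum_le_sum fun a _ => h1 s a).trans ?_
  simp [mul_assoc]

end Potential

/-! ### Regret decomposition -/

section Regret

variable {S A Θ : Type*} [Fintype S] [Fintype A] [MeasurableSpace Θ] [Nonempty A]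
variable {M : BayesianMDP S A Θ} {E : Expert S} {O : Oracle M} {Tep : ℕ → ℕ}

/-- A function of the parameter and the observation that is measurable and bounded in the
parameter. -/
def Observable (H : Θ → Obs S A → ℝ) : Prop :=
  (∀ x, Measurable fun θ => H θ x) ∧ ∀ x, ∃ C, ∀ θ, |H θ x| ≤ C

theorem observable_const (f : Obs S A → ℝ) : Observable fun (_ : Θ) x => f x :=
  ⟨fun _ => measurable_const, fun x => ⟨|f x|, fun _ => le_rfl⟩⟩

theorem Observable.regular {H : Θ → Obs S A → ℝ} (hH : Observable H) :
    Regular fun θ (_ : Θ) x => H θ x :=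
  regular_of_left hH.1 hH.2

theorem measurable_expect_run (M : BayesianMDP S A Θ) (π : S → A) (n : ℕ) (x : Obs S A)
    {H : Θ → Obs S A → ℝ} (hH : ∀ x, Measurable fun θ => H θ x) :
    Measurable fun θ => expect (run (M.P θ) π n x) (H θ) := by
  induction n generalizing H with
  | zero =>
    simp only [run, expect_pure]
    exact hH x
  | succ n ih =>
    have : ∀ θ, expect (run (M.P θ) π (n + 1) x) (H θ) =
        expect (run (M.P θ) π n x) fun y => expect (runStep (M.P θ) π y) (H θ) := fun θ => by
      rw [run, expect_bind (finite_support_run ..) fun y => finite_support_runStep ..]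
    simp_rw [this]
    refine ih fun y => ?_
    simp_rw [expect_runStep]
    exact M.measurable_expect_P _ _ fun s' => hH _

theorem Observable.regular_run (O : Oracle M) {H : Θ → Obs S A → ℝ} (hH : Observable H) (n : ℕ) :
    Regular fun θ θ' x => expect (run (M.P θ) (O.solve θ') n x) (H θ) := by
  intro x
  constructor
  -- There are finitely many policies, so joint measurability follows from measurability in the
  -- environment for each fixed policy.
  · let _ : MeasurableSpace (S → A) := ⊤
    have h1 : Measurable fun p : Θ × (S → A) => expect (run (M.P p.1) p.2 n x) (H p.1) :=
      measurable_from_prod_countable_left fun π => measurable_expect_run M π n x hH.1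
    exact h1.comp (measurable_fst.prodMk ((measurable_comp_solve O id).comp measurable_snd))
  · choose C hC using hH.2
    refine ⟨∑ y ∈ obsOfLength S A x.1.length (x.2.1.length + n), |C y|, fun θ θ' => ?_⟩
    refine abs_expect_le (finite_support_run ..) fun y hy => ?_
    have hl := length_of_mem_support_run hy
    refine ((hC y θ).trans (le_abs_self _)).trans
      (Finset.single_le_sum (f := fun y => |C y|) (fun _ _ => abs_nonneg _) ?_)
    rw [mem_obsOfLength, hl.1]
    exact ⟨rfl, hl.2⟩

theorem measurable_obsLaw (hP : ∀ θ, Communicating (M.P θ)) (t : ℕ) (x : Obs S A) :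
    Measurable fun θ => obsLaw M E O Tep θ t x := by
  obtain ⟨c, hc⟩ := hasLikelihood_obsLaw M E O Tep t
  simp_rw [hc]
  exact ((M.measurable_offlineLik hP E _).mul (M.measurable_onlineLik _)).const_mul _

theorem measurable_expect_obsLaw (hP : ∀ θ, Communicating (M.P θ)) (t : ℕ)
    {H : Θ → Obs S A → ℝ} (hH : ∀ x, Measurable fun θ => H θ x) :
    Measurable fun θ => expect (obsLaw M E O Tep θ t) (H θ) := by
  simp_rw [expect_eq_sum (support_obsLaw_subset _ t)]
  exact Finset.measurable_sum _ fun x _ => (measurable_obsLaw hP t x).ennreal_toReal.mul (hH x)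

/-- Bayesian expectation of a function of the parameter and the observation at time `t`. -/
def avg (M : BayesianMDP S A Θ) (E : Expert S) (O : Oracle M) (Tep : ℕ → ℕ) (H : Θ → Obs S A → ℝ)
    (t : ℕ) : ℝ :=
  ∫ θ, expect (obsLaw M E O Tep θ t) (H θ) ∂(M.prior : Measure Θ)

/-- Expectation over the observation at the start of episode `k` and two posterior samples. -/
def epE (M : BayesianMDP S A Θ) (E : Expert S) (O : Oracle M) (Tep : ℕ → ℕ) (k : ℕ)
    (G : Θ → Θ → Obs S A → ℝ) : ℝ :=
  pairE M.prior (fun θ => obsLaw M E O Tep θ (epStart Tep k)) (obsOfLength S A E.N (epStart Tep k))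
    (obsBelief M E Tep k) G

theorem avg_epStart (hP : ∀ θ, Communicating (M.P θ)) {k : ℕ} (hk : 1 ≤ k) {H : Θ → Obs S A → ℝ}
    (hH : Observable H) :
    avg M E O Tep H (epStart Tep k) = epE M E O Tep k fun θ _ x => H θ x :=
  (isPosterior_obsBelief hP hk).integral_expect_left hH.1 hH.2

/-- In the pair on the right, the first draw drives the environment and the second selects the
policy. -/
theorem avg_epStart_add (hP : ∀ θ, Communicating (M.P θ)) (hT : ∀ k, 1 ≤ k → 1 ≤ Tep k) {k : ℕ}
    (hk : 1 ≤ k) {n : ℕ} (hn : n ≤ Tep k) {H : Θ → Obs S A → ℝ} (hH : Observable H) :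
    avg M E O Tep H (epStart Tep k + n) =
      epE M E O Tep k fun θ θ' x => expect (run (M.P θ) (O.solve θ') n x) (H θ) := by
  rw [epE, ← (isPosterior_obsBelief hP hk).integral_expect (hH.regular_run O n), avg]
  simp_rw [expect_obsLaw_episode hT hk _ hn]

/-- Total reward of a history. -/
def rewardSum (M : BayesianMDP S A Θ) (h : History S A) : ℝ := (h.map fun y => M.r y.1 y.2.1).sum

theorem rewardSum_append (M : BayesianMDP S A Θ) (h : History S A) (s : S) (a : A) (s' : S) :
    rewardSum M (h ++ [(s, a, s')]) = rewardSum M h + M.r s a := by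
  simp [rewardSum]

theorem rewardSum_mem (M : BayesianMDP S A Θ) (h : History S A) :
    rewardSum M h ∈ Set.Icc (0 : ℝ) h.length := by
  induction h with
  | nil => simp [rewardSum]
  | cons x h ih =>
    have := M.r_mem x.1 x.2.1
    simp only [rewardSum, List.map_cons, List.sum_cons, List.length_cons, Set.mem_Icc] at *
    push_cast
    exact ⟨by linarith, by linarith⟩

theorem abs_v_le (hP : ∀ θ, Communicating (M.P θ)) {vbar : ℝ}
    (hv : ∀ θ s s', M.v θ s - M.v θ s' ≤ vbar) (θ : Θ) (s : S) : |M.v θ s| ≤ vbar := by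
  have h1 := hv θ s M.ref
  have h2 := hv θ M.ref s
  rw [M.v_ref (hP θ)] at h1 h2
  exact abs_le.2 ⟨by linarith, by linarith⟩

theorem observable_v (hP : ∀ θ, Communicating (M.P θ)) {vbar : ℝ}
    (hv : ∀ θ s s', M.v θ s - M.v θ s' ≤ vbar) : Observable fun θ (x : Obs S A) => M.v θ x.2.2 :=
  ⟨fun _ => M.measurable_v hP _, fun _ => ⟨vbar, fun θ => abs_v_le hP hv θ _⟩⟩

theorem observable_rbar (M : BayesianMDP S A Θ) : Observable fun θ (_ : Obs S A) => M.rbar θ :=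
  ⟨fun _ => M.measurable_rbar, fun _ => ⟨1, fun θ => abs_le.2
    ⟨by linarith [(M.rbar_mem θ).1], (M.rbar_mem θ).2⟩⟩⟩

theorem regret_eq (θ : Θ) (T : ℕ) : regret M E O Tep T θ =
    T * M.rbar θ - expect (obsLaw M E O Tep θ T) fun x => rewardSum M x.2.1 := by
  rw [regret, ← expect_onlineLaw_history θ T (rewardSum M)]
  rfl

theorem abs_expect_rewardSum_le (θ : Θ) (T : ℕ) :
    |expect (obsLaw M E O Tep θ T) fun x => rewardSum M x.2.1| ≤ T := by
  refine abs_expect_le (finite_support_obsLaw θ T) fun x hx => ?_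
  have h1 := rewardSum_mem M x.2.1
  rw [(mem_obsOfLength.1 (support_obsLaw_subset θ T hx)).2] at h1
  rw [abs_of_nonneg h1.1]
  exact h1.2

theorem integrable_rbar (M : BayesianMDP S A Θ) : Integrable M.rbar (M.prior : Measure Θ) :=
  Integrable.of_bound M.measurable_rbar.aestronglyMeasurable 1 (Eventually.of_forall fun θ =>
    abs_le.2 ⟨by linarith [(M.rbar_mem θ).1], (M.rbar_mem θ).2⟩)

theorem integrable_expect_rewardSum (hP : ∀ θ, Communicating (M.P θ)) (T : ℕ) :
    Integrable (fun θ => expect (obsLaw M E O Tep θ T) fun x => rewardSum M x.2.1)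
      (M.prior : Measure Θ) :=
  Integrable.of_bound (measurable_expect_obsLaw (H := fun _ x => rewardSum M x.2.1) hP T
    fun _ => measurable_const).aestronglyMeasurable T (Eventually.of_forall fun θ => abs_expect_rewardSum_le θ T)

/-- Guarantees that `bayesRegret` is a genuine expectation, not the value `0` assigned to a
non-integrable function. -/
theorem integrable_regret (hP : ∀ θ, Communicating (M.P θ)) (T : ℕ) :
    Integrable (regret M E O Tep T) (M.prior : Measure Θ) := by
  have : regret M E O Tep T = fun θ =>
      T * M.rbar θ - expect (obsLaw M E O Tep θ T) fun x => rewardSum M x.2.1 :=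
    funext fun θ => regret_eq θ T
  rw [this]
  exact ((integrable_rbar M).const_mul _).sub (integrable_expect_rewardSum hP T)

theorem bayesRegret_eq (hP : ∀ θ, Communicating (M.P θ)) (T : ℕ) :
    bayesRegret M E O Tep T = T * ∫ θ, M.rbar θ ∂(M.prior : Measure Θ) -
      avg M E O Tep (fun _ x => rewardSum M x.2.1) T := by
  rw [bayesRegret, avg, ← integral_const_mul, ← integral_sub ((integrable_rbar M).const_mul _)
    (integrable_expect_rewardSum hP T)]
  exact integral_congr_ae (Eventually.of_forall fun θ => regret_eq θ T)

theorem epE_rbar (hP : ∀ θ, Communicating (M.P θ)) {k : ℕ} (hk : 1 ≤ k) :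
    epE M E O Tep k (fun θ _ _ => M.rbar θ) = ∫ θ, M.rbar θ ∂(M.prior : Measure Θ) := by
  rw [← avg_epStart hP hk (observable_rbar M), avg]
  simp_rw [expect_const (finite_support_obsLaw _ _)]

/-! ### Mismatch of the policies -/

open Classical in
/-- Indicator that the optimal policies of two parameters differ. -/
def mismatch (O : Oracle M) (θ θ' : Θ) : ℝ := if O.solve θ = O.solve θ' then 0 else 1

open Classical in
/-- Indicator that `π` is the optimal policy of the parameter. -/
def solves (O : Oracle M) (π : S → A) (θ : Θ) : ℝ := if O.solve θ = π then 1 else 0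

-- Writing agreement as a sum of products separates the two parameters, which makes it a second
-- moment of posterior probabilities.
open Classical in
theorem mismatch_eq (O : Oracle M) (θ θ' : Θ) :
    mismatch O θ θ' = 1 - ∑ π : S → A, solves O π θ * solves O π θ' := by
  unfold mismatch solves
  by_cases h : O.solve θ = O.solve θ'
  · simp [h]
  · simp [h]

theorem measurable_solves (O : Oracle M) (π : S → A) : Measurable (solves O π) := by
  classical
  exact measurable_comp_solve O fun ρ => if ρ = π then (1 : ℝ) else 0

theorem abs_solves_le (O : Oracle M) (π : S → A) (θ : Θ) : |solves O π θ| ≤ 1 := by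
  unfold solves
  split_ifs <;> simp

theorem observable_solves (O : Oracle M) (π : S → A) :
    Observable fun θ (_ : Obs S A) => solves O π θ :=
  ⟨fun _ => measurable_solves O π, fun _ => ⟨1, fun θ => abs_solves_le O π θ⟩⟩

theorem integrable_solves (O : Oracle M) (π : S → A) (μ : Measure Θ) [IsFiniteMeasure μ] :
    Integrable (solves O π) μ :=
  Integrable.of_bound (measurable_solves O π).aestronglyMeasurable 1
    (Eventually.of_forall fun θ => abs_solves_le O π θ)

theorem regular_solves_mul (O : Oracle M) (π : S → A) :
    Regular fun θ θ' (_ : Obs S A) => solves O π θ * solves O π θ' :=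
  (observable_solves O π).regular.mul (observable_solves O π).regular.swap

theorem regular_mismatch (O : Oracle M) : Regular fun θ θ' (_ : Obs S A) => mismatch O θ θ' := by
  classical
  intro x
  refine ⟨?_, 1, fun θ θ' => ?_⟩
  · simp_rw [mismatch_eq]
    exact (Finset.measurable_sum _ fun π _ => (regular_solves_mul O π x).1).const_sub 1
  · change |mismatch O θ θ'| ≤ 1
    unfold mismatch
    split_ifs <;> simp

/-- Probability that a posterior sample at the start of episode `k` has a different optimal policy
than the true parameter. -/
def mismatchAt (M : BayesianMDP S A Θ) (E : Expert S) (O : Oracle M) (Tep : ℕ → ℕ) (k : ℕ) : ℝ :=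
  epE M E O Tep k fun θ θ' _ => mismatch O θ θ'

open Classical in
theorem mismatchAt_eq (hP : ∀ θ, Communicating (M.P θ)) {k : ℕ} (hk : 1 ≤ k) :
    mismatchAt M E O Tep k =
      1 - ∑ π : S → A, epE M E O Tep k fun θ θ' _ => solves O π θ * solves O π θ' := by
  have hsum : ∀ s : Finset (S → A),
      (Regular fun θ θ' (_ : Obs S A) => ∑ π ∈ s, solves O π θ * solves O π θ') ∧
      epE M E O Tep k (fun θ θ' _ => ∑ π ∈ s, solves O π θ * solves O π θ') =
        ∑ π ∈ s, epE M E O Tep k fun θ θ' _ => solves O π θ * solves O π θ' := by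
    intro s
    induction s using Finset.induction_on with
    | empty =>
      simp only [Finset.sum_empty]
      exact ⟨regular_of_obs _, (isPosterior_obsBelief hP hk).pairE_const 0⟩
    | insert π s hπ ih =>
      simp only [Finset.sum_insert hπ]
      refine ⟨(regular_solves_mul O π).add ih.1, ?_⟩
      rw [← ih.2]
      exact pairE_add (regular_solves_mul O π) ih.1
  simp only [mismatchAt, mismatch_eq]
  rw [← (hsum Finset.univ).2]
  refine (pairE_sub (regular_of_obs _) (hsum Finset.univ).1).trans ?_
  rw [(isPosterior_obsBelief hP hk).pairE_const]
  rfl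

/-- Expectations of functions of the parameter and the offline data do not depend on the episode. -/
theorem epE_offline (hP : ∀ θ, Communicating (M.P θ)) {k : ℕ} (hk : 1 ≤ k)
    {f : Θ → History S A → ℝ} (hf : Observable fun θ (x : Obs S A) => f θ x.1) :
    epE M E O Tep k (fun θ _ x => f θ x.1) =
      ∫ θ, expect (M.offlineLaw E θ) (f θ) ∂(M.prior : Measure Θ) := by
  rw [← avg_epStart hP hk hf, avg]
  simp_rw [expect_obsLaw_fst]

/-- More data do not increase the mismatch probability. -/
theorem mismatchAt_le_one (hP : ∀ θ, Communicating (M.P θ)) {k : ℕ} (hk : 1 ≤ k) :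
    mismatchAt M E O Tep k ≤ mismatchAt M E O Tep 1 := by
  classical
  rw [mismatchAt_eq hP hk, mismatchAt_eq hP le_rfl]
  refine sub_le_sub_left (Finset.sum_le_sum fun π _ => ?_) 1
  -- The posterior probability of `π` given the offline data alone, used as centring for every
  -- episode.
  set c : History S A → ℝ := fun D => ∫ θ, solves O π θ ∂(belief M E Tep D [] 1 : Measure Θ) with hc
  have hobs1 : Observable fun θ (x : Obs S A) => solves O π θ * c x.1 := by
    refine ⟨fun x => (measurable_solves O π).mul_const _, fun x => ⟨|c x.1|, fun θ => ?_⟩⟩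
    rw [abs_mul]
    exact mul_le_of_le_one_left (abs_nonneg _) (abs_solves_le O π θ)
  have hobs2 : Observable fun (_ : Θ) (x : Obs S A) => c x.1 * c x.1 := observable_const _
  -- After expansion, the last two terms involve only the parameter and the offline data, hence do
  -- not depend on `j`.
  have key : ∀ j, 1 ≤ j → epE M E O Tep j (fun θ θ' x =>
      (solves O π θ - c x.1) * (solves O π θ' - c x.1)) =
      epE M E O Tep j (fun θ θ' _ => solves O π θ * solves O π θ') -
        2 * (∫ θ, expect (M.offlineLaw E θ) (fun D => solves O π θ * c D) ∂(M.prior : Measure Θ)) +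
        ∫ θ, expect (M.offlineLaw E θ) (fun D => c D * c D) ∂(M.prior : Measure Θ) := by
    intro j hj
    rw [← epE_offline (O := O) (Tep := Tep) hP hj (f := fun θ D => solves O π θ * c D) hobs1,
      ← epE_offline (O := O) (Tep := Tep) hP hj (f := fun _ D => c D * c D) hobs2]
    have e1 : (fun (θ θ' : Θ) (x : Obs S A) => (solves O π θ - c x.1) * (solves O π θ' - c x.1)) =
        fun θ θ' x => (solves O π θ * solves O π θ' -
          (solves O π θ * c x.1 + solves O π θ' * c x.1)) + c x.1 * c x.1 := by
      funext θ θ' x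
      ring
    rw [e1]
    unfold epE
    rw [pairE_add ((regular_solves_mul O π).sub (hobs1.regular.add hobs1.regular.swap))
        hobs2.regular,
      pairE_sub (regular_solves_mul O π) (hobs1.regular.add hobs1.regular.swap),
      pairE_add hobs1.regular hobs1.regular.swap,
      pairE_swap (fun (θ _ : Θ) (x : Obs S A) => solves O π θ * c x.1)]
    ring
  have hk' := key k hk
  have h1' := key 1 le_rfl
  have hsq : ∀ j, epE M E O Tep j (fun θ θ' x =>
      (solves O π θ - c x.1) * (solves O π θ' - c x.1)) = _ := fun j =>
    pairE_centered_mul (fun x => integrable_solves O π _) fun x : Obs S A => c x.1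
  -- The centred product is the mean square distance between the current posterior probability and
  -- the offline one: nonnegative in general, and zero in the first episode.
  have h2 : 0 ≤ epE M E O Tep k (fun θ θ' x =>
      (solves O π θ - c x.1) * (solves O π θ' - c x.1)) := by
    rw [hsq]
    exact Finset.sum_nonneg fun x _ => mul_nonneg ENNReal.toReal_nonneg (sq_nonneg _)
  have h3 : epE M E O Tep 1 (fun θ θ' x =>
      (solves O π θ - c x.1) * (solves O π θ' - c x.1)) = 0 := by
    rw [hsq]
    refine Finset.sum_eq_zero fun x _ => ?_
    have : ∫ θ, solves O π θ ∂(obsBelief M E Tep 1 x : Measure Θ) = c x.1 := rfl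
    rw [this, sub_self]
    simp
  linarith

theorem toReal_toOuterMeasure {α : Type*} (p : PMF α) (s : Set α) :
    (p.toOuterMeasure s).toReal = expect p (s.indicator 1) := by
  rw [PMF.toOuterMeasure_apply, ENNReal.tsum_toReal_eq]
  · refine tsum_congr fun x => ?_
    by_cases hx : x ∈ s <;> simp [hx]
  · intro x
    by_cases hx : x ∈ s <;> simp [hx, p.apply_ne_top]

theorem toOuterMeasure_le_one {α : Type*} (p : PMF α) (s : Set α) : p.toOuterMeasure s ≤ 1 := by
  rw [PMF.toOuterMeasure_apply, ← p.tsum_coe]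
  exact ENNReal.tsum_le_tsum fun x => Set.indicator_le_self s p x

theorem mismatchProb_eq (hP : ∀ θ, Communicating (M.P θ)) (Tep : ℕ → ℕ) :
    mismatchProb M E O = mismatchAt M E O Tep 1 := by
  classical
  have hpost := isPosterior_obsBelief (E := E) (O := O) (Tep := Tep) hP le_rfl
  have hreg : Regular fun θ θ' (_ : Obs S A) => mismatch O θ θ' := regular_mismatch O
  set g : Θ → ℝ := fun θ => expect (M.offlineLaw E θ) fun D =>
    ∫ θ', mismatch O θ θ' ∂(bayesUpdate M.prior (M.offlineLik E D) : Measure Θ) with hg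
  have hgeq : ∀ θ, expect (obsLaw M E O Tep θ (epStart Tep 1)) (fun x =>
      ∫ θ', mismatch O θ θ' ∂(obsBelief M E Tep 1 x : Measure Θ)) = g θ := fun θ =>
    expect_obsLaw_fst θ _ fun D =>
      ∫ θ', mismatch O θ θ' ∂(bayesUpdate M.prior (M.offlineLik E D) : Measure Θ)
  have hgm : Measurable g := by
    have := hpost.measurable_expect_integral hreg
    simp only [hgeq] at this
    exact this
  have h1 : mismatchAt M E O Tep 1 = ∫ θ, g θ ∂(M.prior : Measure Θ) := by
    rw [mismatchAt, epE, ← hpost.integral_expect hreg]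
    simp only [hgeq]
  have hg0 : ∀ θ, 0 ≤ g θ := fun θ => expect_nonneg fun D => integral_nonneg fun θ' => by
    change 0 ≤ mismatch O θ θ'
    unfold mismatch
    split_ifs <;> simp
  rw [h1, integral_eq_lintegral_of_nonneg_ae (Eventually.of_forall hg0) hgm.aestronglyMeasurable,
    mismatchProb]
  congr 1
  refine lintegral_congr fun θ => ?_
  have hne : ((M.offlineLaw E θ).bind fun D =>
      samplePolicy O (bayesUpdate M.prior (M.offlineLik E D))).toOuterMeasure
        {π | π ≠ O.solve θ} ≠ ∞ :=
    ne_top_of_le_ne_top ENNReal.one_ne_top (toOuterMeasure_le_one _ _)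
  rw [← ENNReal.ofReal_toReal hne, toReal_toOuterMeasure,
    expect_bind (finite_support_offlineLaw ..) fun D => Set.toFinite _]
  congr 1
  refine expect_congr fun D _ => ?_
  rw [expect_samplePolicy]
  refine integral_congr_ae (Eventually.of_forall fun θ' => ?_)
  by_cases h : O.solve θ = O.solve θ'
  · simp [mismatch, h]
  · simp [mismatch, h, Ne.symm h]

theorem mismatchProb_mem (M : BayesianMDP S A Θ) (E : Expert S) (O : Oracle M) :
    mismatchProb M E O ∈ Set.Icc (0 : ℝ) 1 := by
  refine ⟨ENNReal.toReal_nonneg, ENNReal.toReal_le_of_le_ofReal zero_le_one ?_⟩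
  rw [ENNReal.ofReal_one]
  exact (lintegral_mono fun θ => toOuterMeasure_le_one _ _).trans_eq
    (b := ∫⁻ _, 1 ∂(M.prior : Measure Θ)) (by simp)

end Regret

section Bounds

variable {S A Θ : Type*} [Fintype S] [Fintype A] [MeasurableSpace Θ] [Nonempty A]
variable {M : BayesianMDP S A Θ} {E : Expert S} {O : Oracle M} {Tep : ℕ → ℕ}

/-! ### The regret of one episode, through the mismatch probability -/

theorem rbar_add_v_eq (hP : ∀ θ, Communicating (M.P θ)) (O : Oracle M) (θ : Θ) (s : S) :
    M.rbar θ + M.v θ s =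
      M.r s (O.solve θ s) + expect (M.P θ s (O.solve θ s)) (M.v θ) := by
  rw [← M.q_solve O (hP θ), M.q_eq]

theorem expect_v_mem {vbar : ℝ}
    (hv : ∀ θ s s', M.v θ s - M.v θ s' ≤ vbar) (θ : Θ) (p : PMF S) (s : S) :
    |expect p (M.v θ) - M.v θ s| ≤ vbar := by
  have h := expect_sub (p := p) (Set.toFinite _) (M.v θ) fun _ => M.v θ s
  rw [expect_const (Set.toFinite _)] at h
  rw [← h]
  exact abs_expect_le (Set.toFinite _) fun s' _ =>
    abs_le.2 ⟨by linarith [hv θ s s'], hv θ s' s⟩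

theorem expect_runStep_reward_add_v (θ θ₁ : Θ) (π : S → A) (y : Obs S A) :
    expect (runStep (M.P θ) π y) (fun z => rewardSum M z.2.1 + M.v θ₁ z.2.2) =
      rewardSum M y.2.1 + M.r y.2.2 (π y.2.2) + expect (M.P θ y.2.2 (π y.2.2)) (M.v θ₁) := by
  rw [expect_runStep]
  simp_rw [rewardSum_append]
  rw [expect_add (Set.toFinite _), expect_const (Set.toFinite _)]

/-- If the policies differ, the reward is read off the optimality equation of `θ'`, and the one-step
changes of `v_θ'` and of `v_θ` each cost at most `vbar`. -/
theorem episode_mismatch_pointwise (hP : ∀ θ, Communicating (M.P θ)) {vbar : ℝ}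
    (hv : ∀ θ s s', M.v θ s - M.v θ s' ≤ vbar) (θ θ' : Θ) (n : ℕ) (x : Obs S A) :
    n * (M.rbar θ - mismatch O θ θ' * (M.rbar θ - M.rbar θ') - 2 * vbar * mismatch O θ θ') ≤
      expect (run (M.P θ) (O.solve θ') n x) (fun z => rewardSum M z.2.1 + M.v θ z.2.2) -
        (rewardSum M x.2.1 + M.v θ x.2.2) := by
  classical
  refine mul_le_expect_run_sub (f := fun z => rewardSum M z.2.1 + M.v θ z.2.2) fun m _ y _ => ?_
  rw [expect_runStep_reward_add_v]
  by_cases h : O.solve θ = O.solve θ'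
  · have h1 := rbar_add_v_eq hP O θ y.2.2
    rw [h] at h1
    simp only [mismatch, h, if_true]
    linarith
  · have h1 := rbar_add_v_eq hP O θ' y.2.2
    have h2 := abs_le.1 (expect_v_mem hv θ' (M.P θ' y.2.2 (O.solve θ' y.2.2)) y.2.2)
    have h3 := abs_le.1 (expect_v_mem hv θ (M.P θ y.2.2 (O.solve θ' y.2.2)) y.2.2)
    simp only [mismatch, h, if_false]
    linarith [h2.2, h3.1]

theorem episode_mismatch_bound (hP : ∀ θ, Communicating (M.P θ)) (hT : ∀ k, 1 ≤ k → 1 ≤ Tep k)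
    {vbar : ℝ} (hv0 : 0 ≤ vbar) (hv : ∀ θ s s', M.v θ s - M.v θ s' ≤ vbar) {k : ℕ} (hk : 1 ≤ k)
    {n : ℕ} (hn : n ≤ Tep k) :
    n * ∫ θ, M.rbar θ ∂(M.prior : Measure Θ) -
        (avg M E O Tep (fun _ x => rewardSum M x.2.1) (epStart Tep k + n) -
          avg M E O Tep (fun _ x => rewardSum M x.2.1) (epStart Tep k)) ≤
      (avg M E O Tep (fun θ x => M.v θ x.2.2) (epStart Tep k + n) -
        avg M E O Tep (fun θ x => M.v θ x.2.2) (epStart Tep k)) +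
      n * (2 * mismatchProb M E O * vbar) := by
  have hR : Observable fun (_ : Θ) (x : Obs S A) => rewardSum M x.2.1 := observable_const _
  have hV := observable_v (M := M) hP hv
  have hrb := (observable_rbar M).regular
  have hmis := regular_mismatch O
  have hdiff : Regular fun θ θ' (_ : Obs S A) => mismatch O θ θ' * (M.rbar θ - M.rbar θ') :=
    hmis.mul (hrb.sub hrb.swap)
  -- The mismatch is symmetric, the difference antisymmetric, and the two parameters are
  -- exchangeable.
  have hzero : epE M E O Tep k (fun θ θ' _ => mismatch O θ θ' * (M.rbar θ - M.rbar θ')) = 0 := by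
    have h1 : epE M E O Tep k (fun θ θ' _ => mismatch O θ' θ * (M.rbar θ' - M.rbar θ)) =
        epE M E O Tep k (fun θ θ' _ => mismatch O θ θ' * (M.rbar θ - M.rbar θ')) :=
      pairE_swap fun θ θ' _ => mismatch O θ θ' * (M.rbar θ - M.rbar θ')
    have h2 : (fun (θ θ' : Θ) (_ : Obs S A) => mismatch O θ' θ * (M.rbar θ' - M.rbar θ)) =
        fun θ θ' _ => (-1) * (mismatch O θ θ' * (M.rbar θ - M.rbar θ')) := by
      funext θ θ' _
      have : mismatch O θ' θ = mismatch O θ θ' := by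
        by_cases h : O.solve θ = O.solve θ'
        · simp [mismatch, h]
        · simp [mismatch, h, Ne.symm h]
      rw [this]
      ring
    rw [h2] at h1
    have h3 : epE M E O Tep k (fun θ θ' _ => (-1) * (mismatch O θ θ' * (M.rbar θ - M.rbar θ'))) =
        (-1) * epE M E O Tep k (fun θ θ' _ => mismatch O θ θ' * (M.rbar θ - M.rbar θ')) :=
      pairE_const_mul _ _
    linarith
  have hmain : epE M E O Tep k (fun θ θ' x => (n : ℝ) * (M.rbar θ -
        mismatch O θ θ' * (M.rbar θ - M.rbar θ') - 2 * vbar * mismatch O θ θ')) ≤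
      epE M E O Tep k fun θ θ' x =>
        (expect (run (M.P θ) (O.solve θ') n x) (fun z => rewardSum M z.2.1) +
          expect (run (M.P θ) (O.solve θ') n x) (fun z => M.v θ z.2.2)) -
        (rewardSum M x.2.1 + M.v θ x.2.2) := by
    refine pairE_mono (((hrb.sub hdiff).sub (hmis.const_mul _)).const_mul _)
      (((hR.regular_run O n).add (hV.regular_run O n)).sub (hR.regular.add hV.regular))
      fun x _ θ θ' => ?_
    rw [← expect_add (finite_support_run ..)]
    exact episode_mismatch_pointwise hP hv θ θ' n x
  have hl : epE M E O Tep k (fun θ θ' x => (n : ℝ) * (M.rbar θ -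
        mismatch O θ θ' * (M.rbar θ - M.rbar θ') - 2 * vbar * mismatch O θ θ')) =
      n * (∫ θ, M.rbar θ ∂(M.prior : Measure Θ) - 2 * vbar * mismatchAt M E O Tep k) := by
    rw [← epE_rbar (E := E) (O := O) (Tep := Tep) hP hk, mismatchAt]
    refine (pairE_const_mul _ _).trans ?_
    congr 1
    refine (pairE_sub (hrb.sub hdiff) (hmis.const_mul _)).trans ?_
    rw [pairE_sub hrb hdiff, pairE_const_mul]
    unfold epE at hzero ⊢
    rw [hzero]
    ring
  have hr : epE M E O Tep k (fun θ θ' x =>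
        (expect (run (M.P θ) (O.solve θ') n x) (fun z => rewardSum M z.2.1) +
          expect (run (M.P θ) (O.solve θ') n x) (fun z => M.v θ z.2.2)) -
        (rewardSum M x.2.1 + M.v θ x.2.2)) =
      (avg M E O Tep (fun _ x => rewardSum M x.2.1) (epStart Tep k + n) +
        avg M E O Tep (fun θ x => M.v θ x.2.2) (epStart Tep k + n)) -
      (avg M E O Tep (fun _ x => rewardSum M x.2.1) (epStart Tep k) +
        avg M E O Tep (fun θ x => M.v θ x.2.2) (epStart Tep k)) := by
    rw [avg_epStart_add hP hT hk hn hR, avg_epStart_add hP hT hk hn hV, avg_epStart hP hk hR,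
      avg_epStart hP hk hV]
    unfold epE
    rw [pairE_sub ((hR.regular_run O n).add (hV.regular_run O n)) (hR.regular.add hV.regular),
      pairE_add (hR.regular_run O n) (hV.regular_run O n), pairE_add hR.regular hV.regular]
  rw [hl, hr] at hmain
  have hmk : mismatchAt M E O Tep k ≤ mismatchProb M E O :=
    (mismatchAt_le_one hP hk).trans_eq (mismatchProb_eq hP Tep).symm
  have h5 : (n : ℝ) * (2 * vbar * mismatchAt M E O Tep k) ≤
      n * (2 * vbar * mismatchProb M E O) := by gcongr
  linarith

/-! ### The regret of one episode, through the concentration of the posterior -/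

/-- Weight of a visit, given the number of earlier visits. -/
def visitWeight (K : ℕ) (η : ℝ) (j : ℕ) : ℝ := (if j < 2 * K then 2 else 0) + 8 / (η * (j + 1))

theorem visitWeight_nonneg (K : ℕ) {η : ℝ} (hη : 0 < η) (j : ℕ) : 0 ≤ visitWeight K η j := by
  unfold visitWeight
  have : 0 < 8 / (η * ((j : ℝ) + 1)) := by positivity
  split_ifs <;> linarith

theorem visits_le_of_mem_support_run {P : S → A → PMF S} {π : S → A} {n : ℕ} {x y : Obs S A}
    (h : y ∈ (run P π n x).support) (s : S) (a : A) :
    visits x.2.1 s a ≤ visits y.2.1 s a ∧ visits y.2.1 s a ≤ visits x.2.1 s a + n := by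
  induction n generalizing y with
  | zero =>
    rw [run, PMF.support_pure, Set.mem_singleton_iff] at h
    simp [h]
  | succ n ih =>
    rw [run, PMF.mem_support_bind_iff] at h
    obtain ⟨z, hz, h⟩ := h
    rw [runStep, PMF.mem_support_map_iff] at h
    obtain ⟨s', -, rfl⟩ := h
    have := ih hz
    by_cases hs : z.2.2 = s ∧ π z.2.2 = a
    · obtain ⟨rfl, rfl⟩ := hs
      simp only [visits_append_self]
      omega
    · simp only [visits_append_ne _ _ hs]
      omega

theorem width_nonneg [Nonempty S] (P : S → A → PMF S) {B : ℝ} (hB : 0 < B) {T : ℕ}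
    {h : History S A} (hT : h.length ≤ T) : 0 ≤ width P B T h := by
  obtain ⟨s⟩ := ‹Nonempty S›
  obtain ⟨a⟩ := ‹Nonempty A›
  have h1 := (sq_nonneg _).trans (deviation_sq_le P hB hT s a fun _ => true)
  exact nonneg_of_mul_nonneg_right h1 (by positivity)

/-- Posterior information is frozen at the start of the episode, while the potential uses the
current count `N`. If `N < 2 * K` the trivial bound `2` is charged. Otherwise the frozen count is at
least `K`, so `N + 1` is at most four times it, whence the `8`. -/
theorem lOneDist_le_visitWeight [Nonempty S] (P P' : S → A → PMF S) {B : ℝ} (hB : 0 < B) {T : ℕ}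
    {h : History S A} (hT : h.length ≤ T) (s : S) (a : A) {η : ℝ} (hη : 0 < η) {K N : ℕ}
    (hK : 0 < K) (hN : N ≤ visits h s a + K) :
    lOneDist (P' s a) (P s a) ≤
      visitWeight K η N + η / 2 * (width P B T h + width P' B T h) := by
  have hw : 0 ≤ η / 2 * (width P B T h + width P' B T h) :=
    mul_nonneg (by positivity) (add_nonneg (width_nonneg P hB hT) (width_nonneg P' hB hT))
  unfold visitWeight
  split_ifs with hNK
  · have h1 := lOneDist_le_two (P' s a) (P s a)
    have : 0 < 8 / (η * ((N : ℝ) + 1)) := by positivity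
    linarith
  · have hpos : 0 < visits h s a := by omega
    have h1 := lOneDist_le_of_visits P P' hB hT s a hη hpos
    have h2 : 2 / (η * (visits h s a : ℝ)) ≤ 8 / (η * ((N : ℝ) + 1)) := by
      have h3 : N + 1 ≤ 4 * visits h s a := by omega
      have h4 : (N : ℝ) + 1 ≤ 4 * visits h s a := by exact_mod_cast h3
      have h5 : (0 : ℝ) < visits h s a := by exact_mod_cast hpos
      rw [div_le_div_iff₀ (by positivity) (by positivity)]
      nlinarith
    linarith

/-- The drift is computed with `v_θ'`, so the environment mismatch enters through the `ℓ¹` distance,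
whose visit-dependent part is paid by the potential. As `θ'` changes with the episode, the boundary
values do not telescope and cost `vbar` each time. -/
theorem episode_concentration_pointwise (hP : ∀ θ, Communicating (M.P θ)) {vbar : ℝ}
    (hv0 : 0 ≤ vbar) (hv : ∀ θ s s', M.v θ s - M.v θ s' ≤ vbar) {B : ℝ} (hB : 0 < B) {η : ℝ}
    (hη : 0 < η) {T K : ℕ} {n : ℕ} (hn : n ≤ K) {x : Obs S A} (hx : x.2.1.length ≤ T) (θ θ' : Θ) :
    n * (M.rbar θ' - vbar * (η / 2) * (width (M.P θ) B T x.2.1 + width (M.P θ') B T x.2.1)) ≤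
      (expect (run (M.P θ) (O.solve θ') n x) (fun z => rewardSum M z.2.1) +
        (vbar + vbar * expect (run (M.P θ) (O.solve θ') n x)
          (fun z => potential (visitWeight K η) z.2.1))) -
      (rewardSum M x.2.1 + vbar * potential (visitWeight K η) x.2.1) := by
  have hS : Nonempty S := ⟨x.2.2⟩
  have hfin := finite_support_run (M.P θ) (O.solve θ') n x
  have hmain := mul_le_expect_run_sub (P := M.P θ) (π := O.solve θ') (x := x) (m := n)
    (f := fun z => (rewardSum M z.2.1 + M.v θ' z.2.2) +
      vbar * potential (visitWeight K η) z.2.1)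
    (c := M.rbar θ' - vbar * (η / 2) * (width (M.P θ) B T x.2.1 + width (M.P θ') B T x.2.1))
    fun m hm y hy => by
      rw [expect_add (finite_support_runStep ..), expect_runStep_reward_add_v, expect_runStep]
      simp_rw [potential_append]
      rw [expect_const (Set.toFinite _)]
      have h1 := rbar_add_v_eq hP O θ' y.2.2
      have h2 := expect_sub_expect_le (M.P θ' y.2.2 (O.solve θ' y.2.2))
        (M.P θ y.2.2 (O.solve θ' y.2.2)) (f := M.v θ') (abs_v_le hP hv θ')
      have hvis := (visits_le_of_mem_support_run hy y.2.2 (O.solve θ' y.2.2)).2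
      have h3 := lOneDist_le_visitWeight (M.P θ) (M.P θ') hB hx y.2.2 (O.solve θ' y.2.2) hη
        (K := K) (N := visits y.2.1 y.2.2 (O.solve θ' y.2.2)) (by omega) (by omega)
      have h4 := mul_le_mul_of_nonneg_left h3 hv0
      linarith
  rw [expect_add hfin, expect_add hfin, expect_const_mul] at hmain
  have h5 : expect (run (M.P θ) (O.solve θ') n x) (fun z => M.v θ' z.2.2) - M.v θ' x.2.2 ≤ vbar := by
    have h6 := expect_sub hfin (fun z => M.v θ' z.2.2) fun _ => M.v θ' x.2.2
    rw [expect_const hfin] at h6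
    rw [← h6]
    exact expect_le hfin fun z _ => hv θ' _ _
  linarith

theorem observable_totalMixture (M : BayesianMDP S A Θ) :
    Observable fun θ (x : Obs S A) => totalMixture (M.P θ) x.2.1 := by
  classical
  have hdev : ∀ (h : History S A) (s : S) (a : A) (σ : S → ℝ),
      Measurable fun θ => deviation (M.P θ) h s a σ := by
    intro h s a σ
    have hE : Measurable fun θ => expect (M.P θ s a) σ :=
      M.measurable_expect_P s a fun _ => measurable_const
    induction h with
    | nil => exact measurable_const
    | cons x h ih =>
      simp only [deviation, List.map_cons, List.sum_cons] at ih ⊢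
      refine Measurable.add ?_ ih
      split_ifs
      · exact hE.const_sub _
      · exact measurable_const
  refine ⟨fun x => ?_, fun x => ?_⟩
  · refine Finset.measurable_sum _ fun s _ => Finset.measurable_sum _ fun a _ =>
      Finset.measurable_sum _ fun σ _ => ?_
    exact ((Real.measurable_exp.comp (((hdev x.2.1 s a _).pow_const 2).div_const _))).div_const _
  · refine ⟨∑ s : S, ∑ a : A, ∑ _σ : S → Bool, mixture (visits x.2.1 s a) (2 * x.2.1.length),
      fun θ => ?_⟩
    rw [abs_of_nonneg (totalMixture_nonneg _ _)]
    refine Finset.sum_le_sum fun s _ => Finset.sum_le_sum fun a _ => Finset.sum_le_sum fun σ _ => ?_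
    have h1 := abs_deviation_le (M.P θ) x.2.1 s a (abs_signVal_le σ)
    have h2 := sq_le_sq' (by linarith [(abs_le.1 h1).1]) (abs_le.1 h1).2
    unfold mixture
    gcongr

theorem expect_totalMixture_le (hT : ∀ k, 1 ≤ k → 1 ≤ Tep k) (θ : Θ) {k : ℕ} (hk : 1 ≤ k) :
    expect (obsLaw M E O Tep θ (epStart Tep k)) (fun x => totalMixture (M.P θ) x.2.1) ≤
      Fintype.card S * Fintype.card A * 2 ^ Fintype.card S := by
  induction k, hk using Nat.le_induction with
  | base =>
    rw [epStart_one, obsLaw, expect_bind (finite_support_offlineLaw ..) fun _ =>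
      finite_support_map _ (Set.toFinite _)]
    refine expect_le (finite_support_offlineLaw ..) fun D _ => ?_
    rw [expect_map (Set.toFinite _)]
    exact expect_le (Set.toFinite _) fun s _ => (totalMixture_nil _).le
  | succ k hk ih =>
    refine le_trans ?_ ih
    rw [epStart_succ Tep hk, obsLaw_episode hT hk θ le_rfl, expect_bind (finite_support_obsLaw ..)
      fun x => finite_support_bind (Set.toFinite _) fun π => finite_support_run ..]
    refine expect_mono (finite_support_obsLaw ..) fun x _ => ?_
    rw [expect_bind (Set.toFinite _) fun π => finite_support_run ..]
    exact expect_le (Set.toFinite _) fun π _ => expect_run_totalMixture_le _ _ _ _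

theorem observable_width (M : BayesianMDP S A Θ) (B : ℝ) (T : ℕ) :
    Observable fun θ (x : Obs S A) => width (M.P θ) B T x.2.1 := by
  obtain ⟨h1, h2⟩ := observable_totalMixture M
  refine ⟨fun x => (((((h1 x).const_mul _).add_const _).sub_const _).const_mul _).add_const _,
    fun x => ?_⟩
  obtain ⟨C, hC⟩ := h2 x
  refine ⟨2 * (|B⁻¹| * C + |Real.log B| + 1) + |Real.log (T + 1)|, fun θ => ?_⟩
  unfold width
  refine (abs_add_le _ _).trans (add_le_add_left ?_ _)
  rw [abs_mul, abs_two]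
  refine mul_le_mul_of_nonneg_left ((abs_sub _ _).trans ?_) zero_le_two
  rw [abs_one]
  refine add_le_add_left ((abs_add_le _ _).trans (add_le_add_left ?_ _)) _
  rw [abs_mul]
  exact mul_le_mul_of_nonneg_left (hC θ) (abs_nonneg _)

/-- `B` is the initial value of the supermartingale, so `B⁻¹ * totalMixture` has mean at most `1`
and cancels the `-1` in `width`. -/
theorem epE_width_le (hP : ∀ θ, Communicating (M.P θ)) (hT : ∀ k, 1 ≤ k → 1 ≤ Tep k) {B : ℝ}
    (hB : 0 < B) (hBeq : B = Fintype.card S * Fintype.card A * 2 ^ Fintype.card S) (T : ℕ) {k : ℕ}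
    (hk : 1 ≤ k) :
    epE M E O Tep k (fun θ _ x => width (M.P θ) B T x.2.1) ≤
      2 * Real.log B + Real.log (T + 1) := by
  rw [← avg_epStart hP hk (observable_width M B T), avg]
  have h1 : ∀ θ, expect (obsLaw M E O Tep θ (epStart Tep k))
      (fun x => width (M.P θ) B T x.2.1) ≤ 2 * Real.log B + Real.log (T + 1) := by
    intro θ
    have hfin := finite_support_obsLaw (M := M) (E := E) (O := O) (Tep := Tep) θ (epStart Tep k)
    have h2 : (fun x : Obs S A => width (M.P θ) B T x.2.1) = fun x =>
        2 * B⁻¹ * totalMixture (M.P θ) x.2.1 + (2 * (Real.log B - 1) + Real.log (T + 1)) := by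
      funext x
      unfold width
      ring
    rw [h2, expect_add hfin, expect_const_mul, expect_const hfin]
    have h3 := expect_totalMixture_le (M := M) (E := E) (O := O) hT θ hk
    rw [← hBeq] at h3
    have h4 := mul_le_mul_of_nonneg_left h3 (inv_pos.2 hB).le
    rw [inv_mul_cancel₀ hB.ne'] at h4
    linarith
  have hT0 : 0 ≤ Real.log ((T : ℝ) + 1) := Real.log_nonneg (by simp)
  have hB1 : 0 ≤ Real.log B := by
    refine Real.log_natCast_nonneg (Fintype.card S * Fintype.card A * 2 ^ Fintype.card S) |>.trans_eq ?_
    rw [hBeq]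
    push_cast
    rfl
  by_cases hi : Integrable (fun θ => expect (obsLaw M E O Tep θ (epStart Tep k))
      fun x => width (M.P θ) B T x.2.1) (M.prior : Measure Θ)
  · refine (integral_mono hi (integrable_const _) h1).trans ?_
    simp
  -- A non-integrable function would have integral `0`, and the bound is nonnegative.
  · rw [integral_undef hi]
    positivity

theorem episode_concentration_bound (hP : ∀ θ, Communicating (M.P θ))
    (hT : ∀ k, 1 ≤ k → 1 ≤ Tep k) {vbar : ℝ} (hv0 : 0 ≤ vbar)
    (hv : ∀ θ s s', M.v θ s - M.v θ s' ≤ vbar) {B : ℝ} (hB : 0 < B)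
    (hBeq : B = Fintype.card S * Fintype.card A * 2 ^ Fintype.card S) {η : ℝ} (hη : 0 < η)
    {T K : ℕ} {k : ℕ} (hk : 1 ≤ k) (hkT : epStart Tep k ≤ T) {n : ℕ} (hn : n ≤ Tep k)
    (hnK : n ≤ K) :
    n * ∫ θ, M.rbar θ ∂(M.prior : Measure Θ) -
        (avg M E O Tep (fun _ x => rewardSum M x.2.1) (epStart Tep k + n) -
          avg M E O Tep (fun _ x => rewardSum M x.2.1) (epStart Tep k)) ≤
      vbar + vbar * (avg M E O Tep (fun _ x => potential (visitWeight K η) x.2.1)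
          (epStart Tep k + n) -
        avg M E O Tep (fun _ x => potential (visitWeight K η) x.2.1) (epStart Tep k)) +
      n * (vbar * η * (2 * Real.log B + Real.log (T + 1))) := by
  have hR : Observable fun (_ : Θ) (x : Obs S A) => rewardSum M x.2.1 := observable_const _
  have hΦ : Observable fun (_ : Θ) (x : Obs S A) => potential (visitWeight K η) x.2.1 :=
    observable_const _
  have hW := (observable_width M B T).regular
  have hrb := (observable_rbar M).regular
  have hc : Regular fun (_ _ : Θ) (_ : Obs S A) => vbar := regular_of_obs _
  have hpost := isPosterior_obsBelief (E := E) (O := O) (Tep := Tep) hP hk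
  have hmain : epE M E O Tep k (fun θ θ' x => (n : ℝ) * (M.rbar θ' -
        vbar * (η / 2) * (width (M.P θ) B T x.2.1 + width (M.P θ') B T x.2.1))) ≤
      epE M E O Tep k fun θ θ' x =>
        (expect (run (M.P θ) (O.solve θ') n x) (fun z => rewardSum M z.2.1) +
          (vbar + vbar * expect (run (M.P θ) (O.solve θ') n x)
            (fun z => potential (visitWeight K η) z.2.1))) -
        (rewardSum M x.2.1 + vbar * potential (visitWeight K η) x.2.1) := by
    refine pairE_mono ((hrb.swap.sub ((hW.add hW.swap).const_mul _)).const_mul _)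
      (((hR.regular_run O n).add (hc.add ((hΦ.regular_run O n).const_mul _))).sub
        (hR.regular.add (hΦ.regular.const_mul _))) fun x hx θ θ' => ?_
    exact episode_concentration_pointwise hP hv0 hv hB hη hnK
      ((mem_obsOfLength.1 hx).2.le.trans hkT) θ θ'
  -- By exchange symmetry the sampled parameter has the same mean width and mean `rbar` as the true
  -- one; the two halves `η / 2` add up to `η`.
  have hl : epE M E O Tep k (fun θ θ' x => (n : ℝ) * (M.rbar θ' -
        vbar * (η / 2) * (width (M.P θ) B T x.2.1 + width (M.P θ') B T x.2.1))) =
      n * (∫ θ, M.rbar θ ∂(M.prior : Measure Θ) -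
        vbar * η * epE M E O Tep k fun θ _ x => width (M.P θ) B T x.2.1) := by
    rw [← epE_rbar (E := E) (O := O) (Tep := Tep) hP hk]
    refine (pairE_const_mul _ _).trans ?_
    congr 1
    refine (pairE_sub hrb.swap ((hW.add hW.swap).const_mul _)).trans ?_
    rw [pairE_const_mul, pairE_add hW hW.swap,
      pairE_swap (fun (θ _ : Θ) (x : Obs S A) => width (M.P θ) B T x.2.1),
      pairE_swap (fun (θ _ : Θ) (_ : Obs S A) => M.rbar θ)]
    unfold epE
    ring
  have hr : epE M E O Tep k (fun θ θ' x =>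
        (expect (run (M.P θ) (O.solve θ') n x) (fun z => rewardSum M z.2.1) +
          (vbar + vbar * expect (run (M.P θ) (O.solve θ') n x)
            (fun z => potential (visitWeight K η) z.2.1))) -
        (rewardSum M x.2.1 + vbar * potential (visitWeight K η) x.2.1)) =
      (avg M E O Tep (fun _ x => rewardSum M x.2.1) (epStart Tep k + n) + (vbar + vbar *
        avg M E O Tep (fun _ x => potential (visitWeight K η) x.2.1) (epStart Tep k + n))) -
      (avg M E O Tep (fun _ x => rewardSum M x.2.1) (epStart Tep k) + vbar *
        avg M E O Tep (fun _ x => potential (visitWeight K η) x.2.1) (epStart Tep k)) := by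
    rw [avg_epStart_add hP hT hk hn hR, avg_epStart_add hP hT hk hn hΦ, avg_epStart hP hk hR,
      avg_epStart hP hk hΦ]
    unfold epE
    rw [pairE_sub ((hR.regular_run O n).add (hc.add ((hΦ.regular_run O n).const_mul _)))
        (hR.regular.add (hΦ.regular.const_mul _)),
      pairE_add (hR.regular_run O n) (hc.add ((hΦ.regular_run O n).const_mul _)),
      pairE_add hc ((hΦ.regular_run O n).const_mul _), pairE_add hR.regular (hΦ.regular.const_mul _),
      pairE_const_mul, pairE_const_mul, hpost.pairE_const]
  rw [hl, hr] at hmain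
  have h5 := mul_le_mul_of_nonneg_left (mul_le_mul_of_nonneg_left
    (epE_width_le (M := M) (E := E) (O := O) hP hT hB hBeq T hk) (mul_nonneg hv0 hη.le))
    (Nat.cast_nonneg (α := ℝ) n)
  linarith

/-! ### Summation over the episodes -/

/-- Sum of per-episode bounds, the last episode being truncated at time `T`. -/
theorem sum_over_episodes (hT : ∀ k, 1 ≤ k → 1 ≤ Tep k) {F G : ℕ → ℝ} {a b : ℝ} {T : ℕ}
    (h : ∀ k n, 1 ≤ k → k ≤ epIndex Tep T → n ≤ Tep k → epStart Tep k + n ≤ T →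
      F (epStart Tep k + n) - F (epStart Tep k) ≤
        a + (G (epStart Tep k + n) - G (epStart Tep k)) + n * b) :
    F T - F 0 ≤ epIndex Tep T * a + (G T - G 0) + T * b := by
  set K := epIndex Tep T with hK
  have hKT : epStart Tep K ≤ T := epStart_epIndex_le Tep T
  have hind : ∀ k, 1 ≤ k → k ≤ K → F (epStart Tep k) - F 0 ≤
      ((k : ℝ) - 1) * a + (G (epStart Tep k) - G 0) + epStart Tep k * b := by
    intro k hk
    induction k, hk using Nat.le_induction with
    | base => intro _; simp [epStart_one]
    | succ k hk ih =>
      intro hkK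
      have h1 := ih (by omega)
      have h2 := epStart_succ Tep hk
      have h3 := h k (Tep k) hk (by omega) le_rfl
        (h2 ▸ (epStart_mono Tep hkK).trans hKT)
      rw [← h2] at h3
      have h4 : (epStart Tep (k + 1) : ℝ) = epStart Tep k + Tep k := by exact_mod_cast h2
      rw [h4]
      push_cast
      linarith
  have hK1 : 1 ≤ K := one_le_epIndex Tep T
  have h1 := hind K hK1 le_rfl
  have hlt : T < epStart Tep (K + 1) := lt_epStart_epIndex_succ hT T
  rw [epStart_succ Tep hK1] at hlt
  have h2 := h K (T - epStart Tep K) hK1 le_rfl (by omega) (by omega)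
  rw [Nat.add_sub_cancel' hKT, Nat.cast_sub hKT] at h2
  linarith

/-- There is no charge per episode (`a = 0`): after telescoping, only the mean of the true relative
value at times `T` and `0` remains, each at most `vbar` in absolute value. -/
theorem bayesRegret_le_of_mismatch (hP : ∀ θ, Communicating (M.P θ))
    (hT : ∀ k, 1 ≤ k → 1 ≤ Tep k) {vbar : ℝ} (hv0 : 0 ≤ vbar)
    (hv : ∀ θ s s', M.v θ s - M.v θ s' ≤ vbar) (T : ℕ) :
    bayesRegret M E O Tep T ≤ 2 * vbar + T * (2 * mismatchProb M E O * vbar) := by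
  have h := sum_over_episodes (Tep := Tep) hT (T := T) (a := 0)
    (F := fun t => t * (∫ θ, M.rbar θ ∂(M.prior : Measure Θ)) -
      avg M E O Tep (fun _ x => rewardSum M x.2.1) t)
    (G := avg M E O Tep fun θ x => M.v θ x.2.2) (b := 2 * mismatchProb M E O * vbar)
    fun k n hk _ hn _ => by
      have := episode_mismatch_bound (E := E) (O := O) hP hT hv0 hv hk hn
      push_cast
      linarith
  have hzero : avg M E O Tep (fun _ x => rewardSum M x.2.1) 0 = 0 := by
    rw [avg]
    refine (integral_congr_ae (Eventually.of_forall fun θ => ?_)).trans (integral_zero _ _)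
    have := abs_expect_rewardSum_le (E := E) (O := O) (Tep := Tep) θ 0
    simpa using this
  have hvavg : ∀ t, |avg M E O Tep (fun θ x => M.v θ x.2.2) t| ≤ vbar := fun t => by
    have h := norm_integral_le_of_norm_le_const (μ := (M.prior : Measure Θ)) (C := vbar)
      (f := fun θ => expect (obsLaw M E O Tep θ t) fun x => M.v θ x.2.2)
      (Eventually.of_forall fun θ => abs_expect_le (finite_support_obsLaw ..) fun x _ =>
        abs_v_le hP hv θ _)
    simpa [avg] using h
  have h1 := abs_le.1 (hvavg T)
  have h2 := abs_le.1 (hvavg 0)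
  rw [bayesRegret_eq hP]
  simp only [hzero, Nat.cast_zero, zero_mul, mul_zero, sub_zero] at h
  linarith [h1.2, h2.1]

theorem sum_visitWeight_le (K T : ℕ) {η : ℝ} (hη : 0 < η) :
    ∑ j ∈ Finset.range T, visitWeight K η j ≤ 4 * K + 8 / η * (1 + Real.log T) := by
  unfold visitWeight
  rw [Finset.sum_add_distrib]
  refine add_le_add ?_ ?_
  · rw [← Finset.sum_filter, Finset.sum_const, nsmul_eq_mul]
    have : ((Finset.range T).filter fun j => j < 2 * K).card ≤ 2 * K := by
      refine (Finset.card_le_card (t := Finset.range (2 * K)) fun j hj => ?_).trans_eq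
        (Finset.card_range _)
      exact Finset.mem_range.2 (Finset.mem_filter.1 hj).2
    have h2 : ((((Finset.range T).filter fun j => j < 2 * K).card : ℕ) : ℝ) ≤ 2 * K := by
      exact_mod_cast this
    linarith
  · have h1 := harmonic_le_one_add_log T
    have h2 : ∑ j ∈ Finset.range T, 8 / (η * ((j : ℝ) + 1)) = 8 / η * (harmonic T : ℚ) := by
      rw [harmonic]
      push_cast
      rw [Finset.mul_sum]
      refine Finset.sum_congr rfl fun j _ => ?_
      field_simp
    rw [h2]
    gcongr

/-- By monotonicity the nominal length of the last episode bounds all earlier ones, so one visit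
weight serves throughout and its potential telescopes over the episodes. -/
theorem bayesRegret_le_of_concentration [Nonempty S] (hP : ∀ θ, Communicating (M.P θ))
    (hT : ∀ k, 1 ≤ k → 1 ≤ Tep k) (hTm : Monotone Tep) {vbar : ℝ} (hv0 : 0 ≤ vbar)
    (hv : ∀ θ s s', M.v θ s - M.v θ s' ≤ vbar) {η : ℝ} (hη : 0 < η) (T : ℕ) :
    bayesRegret M E O Tep T ≤ epIndex Tep T * vbar + vbar * (Fintype.card S * Fintype.card A *
      (4 * Tep (epIndex Tep T) + 8 / η * (1 + Real.log T))) + T * (vbar * η * (2 *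
        Real.log (Fintype.card S * Fintype.card A * 2 ^ Fintype.card S) + Real.log (T + 1))) := by
  set B : ℝ := Fintype.card S * Fintype.card A * 2 ^ Fintype.card S with hB
  have hB0 : 0 < B := by
    have h1 : (0 : ℝ) < Fintype.card S := by exact_mod_cast Fintype.card_pos
    have h2 : (0 : ℝ) < Fintype.card A := by exact_mod_cast Fintype.card_pos
    positivity
  set K := Tep (epIndex Tep T) with hK
  set Φ : ℕ → ℝ := avg M E O Tep fun _ x => potential (visitWeight K η) x.2.1 with hΦ
  have h := sum_over_episodes (Tep := Tep) hT (T := T) (a := vbar)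
    (F := fun t => t * (∫ θ, M.rbar θ ∂(M.prior : Measure Θ)) -
      avg M E O Tep (fun _ x => rewardSum M x.2.1) t)
    (G := fun t => vbar * Φ t) (b := vbar * η * (2 * Real.log B + Real.log (T + 1)))
    fun k n hk hkK hn hnT => by
      have := episode_concentration_bound (M := M) (E := E) (O := O) hP hT hv0 hv hB0 hB hη hk
        (T := T) (K := K) (by omega) hn (hn.trans (hTm hkK))
      push_cast
      linarith
  have hzero : ∀ f : History S A → ℝ, f [] = 0 → avg M E O Tep (fun _ x => f x.2.1) 0 = 0 := by
    intro f hf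
    rw [avg]
    refine (integral_congr_ae (Eventually.of_forall fun θ => ?_)).trans (integral_zero _ _)
    have h0 : ∀ x ∈ (obsLaw M E O Tep θ 0).support, f x.2.1 = 0 := fun x hx => by
      rw [List.length_eq_zero_iff.1 (mem_obsOfLength.1 (support_obsLaw_subset θ 0 hx)).2, hf]
    exact (expect_congr h0).trans (expect_const (finite_support_obsLaw ..) 0)
  have hΦ0 : Φ 0 = 0 := hzero _ (potential_nil _)
  have hR0 : avg M E O Tep (fun _ x => rewardSum M x.2.1) 0 = 0 := hzero _ rfl
  have hΦT : Φ T ≤ Fintype.card S * Fintype.card A * (4 * K + 8 / η * (1 + Real.log T)) := by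
    have hle : ∀ θ, expect (obsLaw M E O Tep θ T) (fun x => potential (visitWeight K η) x.2.1) ≤
        Fintype.card S * Fintype.card A * (4 * K + 8 / η * (1 + Real.log T)) := fun θ => by
      refine expect_le (finite_support_obsLaw ..) fun x hx => ?_
      refine (potential_le (visitWeight_nonneg K hη)
        (mem_obsOfLength.1 (support_obsLaw_subset θ T hx)).2.le).trans ?_
      exact mul_le_mul_of_nonneg_left (sum_visitWeight_le K T hη) (by positivity)
    refine (integral_mono_of_nonneg (Eventually.of_forall fun θ => ?_) (integrable_const _)
      (Eventually.of_forall hle)).trans_eq (by simp)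
    exact expect_nonneg fun x => Finset.sum_nonneg fun _ _ => Finset.sum_nonneg fun _ _ =>
      Finset.sum_nonneg fun _ _ => visitWeight_nonneg K hη _
  have h1 := mul_le_mul_of_nonneg_left hΦT hv0
  rw [bayesRegret_eq hP]
  simp only [hΦ0, hR0, Nat.cast_zero, zero_mul, mul_zero, sub_zero] at h
  linarith

end Bounds

/-! ### Linearly growing episodes -/

theorem two_mul_epStart_id (k : ℕ) : 2 * epStart (fun k => k) (k + 1) = k * (k + 1) := by
  induction k with
  | zero => rfl
  | succ k ih =>
    rw [epStart_succ _ (by omega), mul_add, ih]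
    ring

/-- For index `k + 1` the start `k (k + 1) / 2` is at most `T`, so `k ≤ 2 √T`; the last unit is
absorbed by `1 ≤ √T`. -/
theorem epIndex_id_le {T : ℕ} (hT : 1 ≤ T) : (epIndex (fun k => k) T : ℝ) ≤ 3 * √T := by
  have h1 := epStart_epIndex_le (fun k => k) T
  obtain ⟨k, hk⟩ := Nat.exists_eq_add_of_le' (one_le_epIndex (fun k => k) T)
  rw [hk] at h1 ⊢
  have h2 := two_mul_epStart_id k
  have h3 : k * (k + 1) ≤ 2 * T := by omega
  have h4 : (k : ℝ) * (k + 1) ≤ 2 * T := by exact_mod_cast h3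
  have h5 : (1 : ℝ) ≤ T := by exact_mod_cast hT
  have h6 : √(T : ℝ) ^ 2 = T := Real.sq_sqrt (by positivity)
  have h7 : 1 ≤ √(T : ℝ) := Real.one_le_sqrt.2 h5
  push_cast
  have h8 : (k : ℝ) ≤ 2 * √T := by
    by_contra! h
    nlinarith
  linarith

end InfIPSRL

end

/-! ### Explicit constants in the regret bounds -/

open InfIPSRL in
theorem corollary1 :
    ∃ (C : ℝ) (p : ℕ) (B : ℝ → ℕ → ℕ → ℕ → ℝ),
      ∀ (S A Θ : Type*) [Fintype S] [Fintype A] [Nonempty A] [MeasurableSpace Θ]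
        (M : InfIPSRL.BayesianMDP S A Θ) (E : InfIPSRL.Expert S) (O : InfIPSRL.Oracle M)
        (vbar : ℝ) (T : ℕ),
        (∀ θ, InfIPSRL.Communicating (M.P θ)) →
        0 ≤ vbar → (∀ θ s s', M.v θ s - M.v θ s' ≤ vbar) →
        1 ≤ T →
        let nS : ℕ := Fintype.card S
        let nA : ℕ := Fintype.card A
        let ε : ℝ := InfIPSRL.mismatchProb M E O
        let BR : ℝ := InfIPSRL.bayesRegret M E O (fun k => k) T
        let L : ℝ := (1 + Real.log (nS * nA * T)) ^ p
        MeasureTheory.Integrable (InfIPSRL.regret M E O (fun k => k) T)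
          (M.prior : MeasureTheory.Measure Θ) ∧
        BR ≤ C * (vbar * nS * nA * Real.sqrt T) * L ∧
        BR ≤ 3 * vbar + 2 * ε * vbar * T
            + Real.sqrt ε * vbar * (C * Real.sqrt (nS ^ 2 * nA * T) * L) ∧
        BR ≤ 3 * vbar + B vbar nS nA T * Real.sqrt ε := by
  -- The constant is `3 + 20 + 5`, from the episode count (`e1`), the potential (`e2`) and the width
  -- (`e3`). One logarithmic factor suffices. The function `B` is the coefficient of `ε` in the
  -- mismatch bound, usable because `ε ≤ √ε`.
  refine ⟨28, 1, fun vbar _ _ T => 2 * vbar * T, ?_⟩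
  intro S A Θ _ _ _ _ M E O vbar T hP hv0 hv hT1
  dsimp only
  have hS : Nonempty S := ⟨M.ref⟩
  have hep : ∀ k : ℕ, 1 ≤ k → 1 ≤ k := fun k hk => hk
  have hε := mismatchProb_mem M E O
  have hmis := bayesRegret_le_of_mismatch (E := E) (O := O) (Tep := fun k => k) hP hep hv0 hv T
  have hs : (1 : ℝ) ≤ Fintype.card S := by exact_mod_cast Fintype.card_pos (α := S)
  have ha : (1 : ℝ) ≤ Fintype.card A := by exact_mod_cast Fintype.card_pos (α := A)
  have ht : (1 : ℝ) ≤ T := by exact_mod_cast hT1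
  have hlog : Real.log (Fintype.card S * Fintype.card A * T) =
      Real.log (Fintype.card S * Fintype.card A) + Real.log T :=
    Real.log_mul (by positivity) (by positivity)
  have hlsa : 0 ≤ Real.log (Fintype.card S * Fintype.card A : ℝ) :=
    Real.log_nonneg (one_le_mul_of_one_le_of_one_le hs ha)
  have hlt : 0 ≤ Real.log (T : ℝ) := Real.log_nonneg ht
  rw [pow_one, hlog]
  have hL : 1 ≤ 1 + (Real.log (Fintype.card S * Fintype.card A : ℝ) + Real.log T) := by linarith
  refine ⟨integrable_regret hP T, ?_, ?_, ?_⟩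
  · have hR : 1 ≤ √(T : ℝ) := Real.one_le_sqrt.2 ht
    have hRR : √(T : ℝ) * √(T : ℝ) = T := Real.mul_self_sqrt (by positivity)
    -- The choice `η = 1 / √T` makes both `1 / η` and `T * η` equal to `√T`.
    have hη : 0 < (√(T : ℝ))⁻¹ := by positivity
    have hcon := bayesRegret_le_of_concentration (E := E) (O := O) (Tep := fun k => k) hP hep
      monotone_id hv0 hv hη T
    have hK := epIndex_id_le hT1
    -- The `2 ^ S` sign patterns contribute at most `S` to the logarithm.
    have hlB : Real.log (Fintype.card S * Fintype.card A * 2 ^ Fintype.card S : ℝ) ≤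
        Real.log (Fintype.card S * Fintype.card A : ℝ) + Fintype.card S := by
      rw [Real.log_mul (by positivity) (by positivity), Real.log_pow]
      have := Real.log_two_lt_d9
      nlinarith
    have hlT : Real.log ((T : ℝ) + 1) ≤ 1 + Real.log T := by
      have h1 : Real.log ((T : ℝ) + 1) ≤ Real.log (2 * T) :=
        Real.log_le_log (by positivity) (by linarith)
      rw [Real.log_mul (by positivity) (by positivity)] at h1
      linarith [Real.log_two_lt_d9]
    have hdiv : 8 / (√(T : ℝ))⁻¹ = 8 * √(T : ℝ) := by rw [div_inv_eq_mul]
    have hTη : (T : ℝ) * (√(T : ℝ))⁻¹ = √(T : ℝ) := by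
      rw [← div_eq_mul_inv, div_eq_iff (by positivity), hRR]
    rw [hdiv] at hcon
    set L := 1 + (Real.log (Fintype.card S * Fintype.card A : ℝ) + Real.log T) with hLdef
    set s : ℝ := (Fintype.card S : ℝ)
    set a : ℝ := (Fintype.card A : ℝ)
    set R := √(T : ℝ)
    set K : ℝ := (epIndex (fun k => k) T : ℝ)
    set l₁ := Real.log (s * a * 2 ^ Fintype.card S)
    set l₂ := Real.log ((T : ℝ) + 1)
    have hw : 2 * l₁ + l₂ ≤ 5 * (s * L) := by nlinarith
    have hsa : 1 ≤ s * a := one_le_mul_of_one_le_of_one_le hs ha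
    have e1 : K ≤ 3 * (s * a * R * L) := by
      have : R ≤ s * a * R * L := by
        have := one_le_mul_of_one_le_of_one_le hsa hL
        nlinarith
      linarith
    have e2 : s * a * (4 * K + 8 * R * (1 + Real.log T)) ≤ 20 * (s * a * R * L) := by
      have h1 : 4 * K + 8 * R * (1 + Real.log T) ≤ 20 * (R * L) := by
        have h2 : R * (1 + Real.log T) ≤ R * L :=
          mul_le_mul_of_nonneg_left (by linarith) (by linarith)
        have h3 : R ≤ R * L := le_mul_of_one_le_right (by linarith) hL
        linarith
      calc _ ≤ s * a * (20 * (R * L)) := mul_le_mul_of_nonneg_left h1 (by linarith)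
        _ = _ := by ring
    have e3 : R * (2 * l₁ + l₂) ≤ 5 * (s * a * R * L) := by
      have h1 : R * (2 * l₁ + l₂) ≤ R * (5 * (s * L)) :=
        mul_le_mul_of_nonneg_left hw (by linarith)
      have h2 : R * (5 * (s * L)) ≤ R * (5 * (s * L)) * a :=
        le_mul_of_one_le_right (by positivity) ha
      linarith
    have e4 : (T : ℝ) * (vbar * R⁻¹ * (2 * l₁ + l₂)) = vbar * (R * (2 * l₁ + l₂)) := by
      calc _ = vbar * (((T : ℝ) * R⁻¹) * (2 * l₁ + l₂)) := by ring
        _ = _ := by rw [hTη]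
    rw [e4] at hcon
    have e5 := mul_le_mul_of_nonneg_left (add_le_add (add_le_add e1 e2) e3) hv0
    linarith
  -- The mismatch bound is already below the first two terms, so the `√ε` term only has to be
  -- nonnegative.
  · have h1 : 0 ≤ √(mismatchProb M E O) * vbar * (28 * √((Fintype.card S : ℝ) ^ 2 *
        Fintype.card A * T) * (1 + (Real.log (Fintype.card S * Fintype.card A : ℝ) +
          Real.log T))) := by positivity
    linarith
  · have h1 : mismatchProb M E O ≤ √(mismatchProb M E O) := by
      refine Real.le_sqrt_of_sq_le ?_
      rw [sq]
      exact mul_le_of_le_one_left hε.1 hε.2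
    have h2 : 0 ≤ 2 * vbar * T := by positivity
    have h3 := mul_le_mul_of_nonneg_left h1 h2
    linarith
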